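/- Circuits below are built from the reversible gates $X$, $CX$, $CCX$. The gate count is the number of gates, and the depth is the least number of layers of gates, obtained by scheduling each gate as early as possible, gates in one layer acting on disjoint qubits. Write $\log$ for the natural logarithm, with the convention $\log 0=0$. **(1) Controlled classical–quantum adder.** There are constants $A,B>0$ such that for all integers $k\ge 0$, $n\ge 1$ with $k\ge 2$ or $n\ge 2$ and every classical constant $c\in\{0,\dots,2^n-1\}$ there is a circuit over $\{CCX,CX,X\}$ on $k+n+1$ qubits that implements the $k$-controlled $n$-bit addition of $c$ with one dirty ancilla, i.e. the unitary $$|u\rangle|x\rangle|g\rangle\mapsto\begin{cases}|u\rangle|(x+c)\bmod 2^n\rangle|g\rangle & \text{if } u=1^k,\\ |u\rangle|x\rangle|g\rangle&\text{otherwise,}\end{cases}\qquad u\in\{0,1\}^k,\ 0\le x<2^n,\ g\in\{0,1\},$$ whose gate count lies between $A\,(k+n\log n)$ and $B\,(k+n\log n)$ and whose depth lies between $A\,(\log k+\log^2 n)$ and $B\,(\log k+\log^2 n)$. That is, the $k$-controlled $n$-bit classical–quantum adder can be implemented with $\Theta(k+n\log n)$ gates and $\Theta(\log k+\log^2 n)$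 depth, using one dirty ancilla. **(2) Shor's circuit on $2n+2$ qubits.** There is a constant $B>0$ such that for all $n\ge 2$, every $n$-bit integer $N$ ($2^{n-1}\le N<2^n$) and every $a$ coprime to $N$ there are circuits $M_0,\dots,M_{2n-1}$ over $\{CCX,CX,X\}$ on $2n+2$ qubits (two $n$-qubit registers, one ancilla, one control) with $$M_j:\ |x\rangle|0\rangle|0\rangle|b\rangle\mapsto\bigl|\,(a^{2^{2n-1-j}})^b\,x \bmod N\bigr\rangle|0\rangle|0\rangle|b\rangle\qquad(0\le x<N,\ b\in\{0,1\}),$$ such that the following circuit, started in $|1\rangle|0\rangle|0\rangle|0\rangle$, is an implementation of the quantum part of Shor's algorithm. For $j=0,\dots,2n-1$ in turn: apply a Hadamard gate to the control; apply $M_j$; apply to the control the classically controlled rotation $\mathrm{diag}\bigl(1,e^{-2\pi i(\sum_{i<j}y_i2^i)/2^{j+1}}\bigr)$, where $y_0,\dots,y_{j-1}$ are the bits measured so far; apply a Hadamard gate to the control; measure the control, obtaining the bit $y_j$, and reset it to $|0\rangle$. The probability of obtaining the bits of $y=\sum_{i<2n}y_i2^i$ is that of Shor's order-finding algorithm, $$\sum_{z=0}^{N-1}\Bigl|\frac1{2^{2n}}\sum_{0\le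 x<2^{2n},\ a^x\equiv z\ (N)}e^{2\pi i xy/2^{2n}}\Bigr|^2\qquad(0\le y<2^{2n}),$$ and the whole circuit has at most $B\,n^3\log n$ operations and depth at most $B\,n^2\log^2 n$. (Each gate, rotation, and measurement with reset counts as one operation; rotations and measurements are also taken to act on the classical register that holds the measured bits.) -/

import Mathlib

noncomputable section

namespace QCirc

/-! ### Gates, circuits, size and depth -/

/-- A `C^j X` gate with `j ≤ 2` on qubits labelled by `W`: an `X` gate (`j = 0`), a `CX` gate
(`j = 1`) or a `CCX` gate (`j = 2`). -/
structure Gate (W : Type) where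
  controls : Finset W
  target : W
  target_notMem : target ∉ controls
  card_le : controls.card ≤ 2

/-- A circuit over the gate set `{CCX, CX, X}`: its gates in order of application. -/
abbrev Circuit (W : Type) := List (Gate W)

/-- Vectors of amplitudes of the qubits `W` in the computational basis. -/
abbrev State (W : Type) := (W → Bool) → ℂ

variable {W : Type} [DecidableEq W]

/-- The computational basis state `|s⟩`. -/
def ket [Fintype W] (s : W → Bool) : State W := fun s' => if s' = s then 1 else 0

/-- Action on bit strings: the target is flipped iff all the controls are `1`. -/
def Gate.act (g : Gate W) (s : W → Bool) : W → Bool :=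
  Function.update s g.target (xor (s g.target) (decide (∀ q ∈ g.controls, s q = true)))

/-- The unitary of a gate. As `act` is an involution, it is the linear map
`|s⟩ ↦ |g.act s⟩` (see `Gate.apply_ket`). -/
def Gate.apply (g : Gate W) (ψ : State W) : State W := fun s => ψ (g.act s)

theorem Gate.act_act (g : Gate W) (s : W → Bool) : g.act (g.act s) = s := by
  have h : ∀ q ∈ g.controls, g.act s q = s q := by
    intro q hq
    have : q ≠ g.target := fun e => g.target_notMem (e ▸ hq)
    simp [Gate.act, this]
  have h2 : (∀ q ∈ g.controls, g.act s q = true) ↔ (∀ q ∈ g.controls, s q = true) :=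
    forall₂_congr fun q hq => by rw [h q hq]
  have h3 : ∀ s' : W → Bool, g.act s' = Function.update s' g.target
      (xor (s' g.target) (decide (∀ q ∈ g.controls, s' q = true))) := fun _ => rfl
  rw [h3 (g.act s)]
  simp only [h2]
  rw [h3 s]
  simp

theorem Gate.apply_ket [Fintype W] (g : Gate W) (s : W → Bool) :
    g.apply (ket s) = ket (g.act s) := by
  funext s'
  have : g.act s' = s ↔ s' = g.act s :=
    ⟨fun h => by rw [← h, g.act_act], fun h => by rw [h, g.act_act]⟩
  simp [Gate.apply, ket, this]

/-- The unitary of a circuit. -/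
def Circuit.apply (C : Circuit W) (ψ : State W) : State W :=
  C.foldl (fun φ g => g.apply φ) ψ

/-- The circuit implements the unitary `|s⟩ ↦ |f s⟩`. -/
def Circuit.Implements [Fintype W] (C : Circuit W) (f : (W → Bool) → (W → Bool)) : Prop :=
  ∀ s, Circuit.apply C (ket s) = ket (f s)

/-- For a sequence of operations, given by the sets of wires on which they act and scheduled as
early as possible: the time at which each wire becomes free. -/
def finishTime (L : List (Finset W)) : W → ℕ :=
  L.foldl (fun t S q => if q ∈ S then S.sup t + 1 else t q) (fun _ => 0)

/-- The depth of a sequence of operations: the least number of layers, operations in the same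
layer acting on disjoint sets of wires. -/
def schedDepth [Fintype W] (L : List (Finset W)) : ℕ := Finset.univ.sup (finishTime L)

/-- The qubits on which a gate acts. -/
def Gate.support (g : Gate W) : Finset W := insert g.target g.controls

/-- Circuit depth. (The gate count is `List.length`.) -/
def Circuit.depth [Fintype W] (C : Circuit W) : ℕ := schedDepth (C.map Gate.support)

/-! ### The controlled classical–quantum adder -/

/-- Qubits of the `k`-controlled `n`-bit adder: `k` controls, the register of `n` qubits, and one
ancilla. Registers are read with the least significant bit at index `0`. -/
abbrev AdderQubit (k n : ℕ) := Fin k ⊕ Fin n ⊕ Unit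

/-- The binary digits of `(x + c) mod 2^n`. -/
def addConst {n : ℕ} (c x : Fin n → Bool) : Fin n → Bool :=
  fun i => ((Nat.ofBits x + Nat.ofBits c) % 2 ^ n).testBit i

/-- The `k`-controlled adder of the constant `c`, together with a dirty ancilla: the register is
replaced by `(x + c) mod 2^n` if all controls are `1`; the controls, and the ancilla whatever its
value, are preserved. -/
def controlledAdder {k n : ℕ} (c : Fin n → Bool) (s : AdderQubit k n → Bool) :
    AdderQubit k n → Bool :=
  let u : Fin k → Bool := fun i => s (.inl i)
  let x : Fin n → Bool := fun i => s (.inr (.inl i))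
  Sum.elim u (Sum.elim (if ∀ i, u i = true then addConst c x else x)
    (fun _ => s (.inr (.inr ()))))

/-! ### Shor's circuit with a semiclassical Fourier transform -/

/-- The instructions of Shor's circuit: gates from `{CCX, CX, X}`, Hadamard gates, the
classically controlled phase rotations of the semiclassical Fourier transform, and measurements
of a qubit in the computational basis followed by a reset to `|0⟩`. -/
inductive Instr (W : Type) where
  | gate (g : Gate W)
  | had (q : W)
  | rot (q : W)
  | measure (q : W)

/-- The wires on which an instruction acts; `none` is the classical register that holds the
measured bits. -/
def Instr.support : Instr W → Finset (Option W)
  | .gate g => g.support.image some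
  | .had q => {some q}
  | .rot q => {some q, none}
  | .measure q => {some q, none}

/-- Depth of a sequence of instructions. -/
def instrDepth [Fintype W] (P : List (Instr W)) : ℕ := schedDepth (P.map Instr.support)

/-- One step of the branch of the computation in which the measured bits are the binary digits of
`y`, least significant digit first. The first component counts the measurements so far; the
second one is the unnormalized state of the branch, whose squared norm is the probability of the
branch. After measured bits `y_0, …, y_{j-1}`, `rot q` is the gate
`diag (1, exp (-2πi (∑_{i<j} y_i 2^i) / 2^(j+1)))` on `q`. -/
def Instr.step (y : ℕ) : ℕ × State W → Instr W → ℕ × State W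
  | (j, ψ), .gate g => (j, g.apply ψ)
  | (j, ψ), .had q => (j, fun s =>
      (ψ (Function.update s q false) + (if s q then -1 else 1) * ψ (Function.update s q true))
        / (Real.sqrt 2 : ℂ))
  | (j, ψ), .rot q => (j, fun s =>
      (if s q then Complex.exp (-2 * Real.pi * Complex.I * (y % 2 ^ j : ℕ) / 2 ^ (j + 1)) else 1)
        * ψ s)
  | (j, ψ), .measure q => (j + 1, fun s =>
      if s q then 0 else ψ (Function.update s q (y.testBit j)))

/-- The probability that the measured bits of the program `P`, started in `ψ`, are the binary
digits of `y`, least significant digit first. -/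
def outcomeProb [Fintype W] (P : List (Instr W)) (ψ : State W) (y : ℕ) : ℝ :=
  ∑ s : W → Bool, ‖(P.foldl (Instr.step y) (0, ψ)).2 s‖ ^ 2

/-- Qubits of Shor's circuit: two registers of `n` qubits, one ancilla and one control. -/
abbrev ShorQubit (n : ℕ) := (Fin n ⊕ Fin n) ⊕ (Unit ⊕ Unit)

/-- The control qubit. -/
def ctrlQubit (n : ℕ) : ShorQubit n := .inr (.inr ())

/-- The bit string with `x` in the first register, `b` in the control qubit, and `0` in the
second register and the ancilla. -/
def shorBits (n x : ℕ) (b : Bool) : ShorQubit n → Bool :=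
  Sum.elim (Sum.elim (fun i => x.testBit i) (fun _ => false))
    (Sum.elim (fun _ => false) (fun _ => b))

/-- The circuit `M` is a controlled modular multiplication by `a` modulo `N`:
`|x⟩|0⟩|0⟩|b⟩ ↦ |a^b x mod N⟩|0⟩|0⟩|b⟩` for `x < N`. -/
def IsControlledModMul (n N a : ℕ) (M : Circuit (ShorQubit n)) : Prop :=
  ∀ x < N, ∀ b : Bool, Circuit.apply M (ket (shorBits n x b)) =
    ket (shorBits n (if b then a * x % N else x) b)

/-- Shor's circuit with a single recycled control qubit: `2n` rounds, each of which puts the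
control into `|+⟩`, applies the controlled modular multiplication of that round, and performs one
step of the semiclassical inverse Fourier transform. -/
def shorCircuit (n : ℕ) (M : ℕ → Circuit (ShorQubit n)) : List (Instr (ShorQubit n)) :=
  (List.range (2 * n)).flatMap fun j =>
    [.had (ctrlQubit n)] ++ (M j).map .gate ++
      [.rot (ctrlQubit n), .had (ctrlQubit n), .measure (ctrlQubit n)]

/-- The output distribution of Shor's order-finding algorithm for `a` modulo `N` with `t` bits of
precision: the probability of measuring `y` after a Fourier transform over `ℤ/2^t` of the first
register of `2^(-t/2) ∑_{x < 2^t} |x⟩|a^x mod N⟩`. -/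
def shorProb (t N a y : ℕ) : ℝ :=
  ∑ z ∈ Finset.range N, ‖(∑ x ∈ Finset.range (2 ^ t) with a ^ x % N = z,
    Complex.exp (2 * Real.pi * Complex.I * x * y / 2 ^ t)) / 2 ^ t‖ ^ 2

end QCirc

end

open QCirc

set_option linter.unusedSectionVars false

namespace QCirc

variable {W : Type} [DecidableEq W]
variable {C D : Circuit W} {S T : Set W} {ℓ d ℓ' d' : ℕ}

/-! ### Scheduling -/

/-! All gates permute basis states, so circuits are studied through `act` on bit strings. Costs are
tracked by `Cost`. A depth bound is certified by labelling gates with layers, since the greedy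
schedule is never worse than a labelled one.

Three devices avoid clean ancillas. A gate sequence `A B A B` that flips a dirty wire in between
computes a conjunction (`act_toggle`). Conjugating by a conditional negation turns "add if `g`,
subtract otherwise" into a plain addition, whatever `g` is (`IsAddBy.conj_sign`). Applying an
involution once under a dirty bit `r` and once under `r ⊕ κ` applies it exactly when `κ`
(`exists_step`).

Multiply controlled `X` (`exists_hasMCX`): overlapping binary heaps of AND gates, written over the
controls themselves, reduce `k` controls to about `log k`, and recursion does the rest.

Addition of a constant (`exists_addDigits`): the register is cut into base-8 digits, each with a
dirty carry wire and a spare dirty wire. The carries solve a recurrence `κ (i + 1) = α i ⊕ β i ∧ κ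
i`, which a ladder of logarithmic height evaluates in place on the carry wires (`exists_ladder`).
Each rung is a multiply controlled gate, so the depth is `log ^ 2`. A digit is incremented under its
carry by four involutions that keep the carries invariant. This needs the digits of the constant to
avoid 0 and 7, and every constant is a sum of two such numbers modulo the size of the register
(`exists_digits`).

That adder borrows nearly as many dirty wires as it has register wires. Splitting the register into
halves that lend wires to each other leaves only one external dirty wire, used to pass the carry
from the low half to the high half (`exists_add`). Controls come from a signed half addition
(`exists_controlled_add`). Lower bounds on the resources are met by padding with pairs of `X`.

For Shor's circuit, modular addition is done with an overflow bit that is erased afterwards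
(`exists_modAdd`). Multiplication adds `a * x` into the second register, swaps, and uncomputes with
the inverse of `a` (`exists_controlledModMul`). The output law follows by induction on rounds: after
`j` rounds a branch is a sum over the `j` exponent bits used so far, and a round appends one bit
(`foldl_step_shor`). -/

/-- The list of operations, given by their supports, has a schedule in at most `d` layers. -/
def Sched (L : List (Finset W)) (d : ℕ) : Prop :=
  ∃ T : List (Finset W × ℕ), T.map Prod.fst = L ∧
    T.Pairwise (fun a b => Disjoint a.1 b.1 ∨ a.2 < b.2) ∧ ∀ a ∈ T, a.2 < d

theorem finishTime_concat (L : List (Finset W)) (S : Finset W) (q : W) :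
    finishTime (L ++ [S]) q =
      if q ∈ S then S.sup (finishTime L) + 1 else finishTime L q := by
  simp [finishTime, List.foldl_append]

/-- Greedy scheduling is optimal. The bound is stated wire by wire so that induction on the last
operation applies: an earlier operation sharing a wire with the last one has a smaller label. -/
theorem finishTime_le_of_labels (T : List (Finset W × ℕ))
    (hT : T.Pairwise (fun a b => Disjoint a.1 b.1 ∨ a.2 < b.2)) :
    ∀ q b, (∀ a ∈ T, q ∈ a.1 → a.2 < b) → finishTime (T.map Prod.fst) q ≤ b := by
  induction T using List.reverseRecOn with
  | nil => intro q b _; simp [finishTime]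
  | append_singleton T a ih =>
    intro q b hb
    rw [List.pairwise_append] at hT
    obtain ⟨h1, -, h3⟩ := hT
    rw [List.map_append, List.map_singleton, finishTime_concat]
    split_ifs with hq
    · have hab : a.2 < b := hb a (by simp) hq
      refine Nat.succ_le_of_lt (lt_of_le_of_lt ?_ hab)
      refine Finset.sup_le fun q' hq' => ih h1 q' a.2 fun x hx hxq => ?_
      rcases h3 x hx a (by simp) with h | h
      · exact absurd hq' (Finset.disjoint_left.1 h hxq)
      · exact h
    · exact ih h1 q b fun x hx => hb x (by simp [hx])

theorem Sched.finishTime_le {L : List (Finset W)} {d : ℕ} (h : Sched L d) (q : W) :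
    finishTime L q ≤ d := by
  obtain ⟨T, rfl, h2, h3⟩ := h
  exact finishTime_le_of_labels T h2 q d fun a ha _ => h3 a ha

theorem Sched.schedDepth_le [Fintype W] {L : List (Finset W)} {d : ℕ} (h : Sched L d) :
    schedDepth L ≤ d :=
  Finset.sup_le fun q _ => h.finishTime_le q

theorem Sched.nil (d : ℕ) : Sched ([] : List (Finset W)) d :=
  ⟨[], rfl, List.Pairwise.nil, by simp⟩

theorem Sched.mono {L : List (Finset W)} {d e : ℕ} (h : Sched L d) (hde : d ≤ e) : Sched L e := by
  obtain ⟨T, h1, h2, h3⟩ := h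
  exact ⟨T, h1, h2, fun a ha => (h3 a ha).trans_le hde⟩

theorem Sched.append {L M : List (Finset W)} {d e : ℕ} (h : Sched L d) (h' : Sched M e) :
    Sched (L ++ M) (d + e) := by
  obtain ⟨T, rfl, h2, h3⟩ := h
  obtain ⟨T', rfl, h2', h3'⟩ := h'
  refine ⟨T ++ T'.map fun a => (a.1, d + a.2), ?_, ?_, ?_⟩
  · simp [Function.comp_def]
  · refine List.pairwise_append.2 ⟨h2, ?_, ?_⟩
    · rw [List.pairwise_map]
      exact h2'.imp fun h => h.imp id (by intro h; simpa using h)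
    · intro a ha b hb
      obtain ⟨c, -, rfl⟩ := List.mem_map.1 hb
      exact Or.inr ((h3 a ha).trans_le (Nat.le_add_right _ _))
  · intro a ha
    rcases List.mem_append.1 ha with ha | ha
    · exact (h3 a ha).trans_le (Nat.le_add_right _ _)
    · obtain ⟨c, hc, rfl⟩ := List.mem_map.1 ha
      simpa using h3' c hc

theorem Sched.singleton (S : Finset W) : Sched [S] 1 :=
  ⟨[(S, 0)], rfl, List.pairwise_singleton _ _, by simp⟩

theorem Sched.of_length (L : List (Finset W)) : Sched L L.length := by
  induction L with
  | nil => exact Sched.nil _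
  | cons S L ih =>
    have := (Sched.singleton S).append ih
    rw [List.length_cons, add_comm]
    exact this

/-- Reading the layers backwards, that is, replacing the label `i` by `d - 1 - i`, gives a schedule
of the reversed list. -/
theorem Sched.reverse {L : List (Finset W)} {d : ℕ} (h : Sched L d) : Sched L.reverse d := by
  obtain ⟨T, rfl, h2, h3⟩ := h
  refine ⟨(T.map fun a => (a.1, d - 1 - a.2)).reverse, by simp [Function.comp_def], ?_, ?_⟩
  · rw [List.pairwise_reverse, List.pairwise_map]
    refine h2.imp_of_mem fun {a b} ha hb h => ?_
    refine h.imp (fun h => h.symm) fun h => ?_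
    have := h3 b hb
    simp only
    omega
  · intro a ha
    obtain ⟨c, hc, rfl⟩ := List.mem_map.1 (List.mem_reverse.1 ha)
    have := h3 c hc
    simp only
    omega

theorem Sched.map {V : Type} [DecidableEq V] {L : List (Finset W)} {d : ℕ} (h : Sched L d)
    {f : W → V} (hf : Function.Injective f) : Sched (L.map (Finset.image f)) d := by
  obtain ⟨T, rfl, h2, h3⟩ := h
  refine ⟨T.map fun a => (a.1.image f, a.2), by simp [Function.comp_def], ?_, ?_⟩
  · rw [List.pairwise_map]
    refine h2.imp fun h => h.imp (fun h => ?_) id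
    exact (Finset.disjoint_image hf).2 h
  · intro a ha
    obtain ⟨c, hc, rfl⟩ := List.mem_map.1 ha
    exact h3 c hc

/-- Pieces `F i` acting on `S i`, each scheduled in `δ` layers and started at time `τ i`. -/
theorem Sched.flatMap {ι : Type*} (I : List ι) (F : ι → List (Finset W)) (S : ι → Set W)
    (τ : ι → ℕ) (δ D : ℕ) (hS : ∀ i ∈ I, ∀ X ∈ F i, (X : Set W) ⊆ S i)
    (hδ : ∀ i ∈ I, Sched (F i) δ)
    (hτ : I.Pairwise fun i j => Disjoint (S i) (S j) ∨ τ i + δ ≤ τ j)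
    (hD : ∀ i ∈ I, τ i + δ ≤ D) : Sched (I.flatMap F) D := by
  -- Each label keeps track of the piece it comes from, hence of its time window; the induction
  -- needs this to compare a new piece with all the later ones.
  suffices h : ∃ T : List (Finset W × ℕ), T.map Prod.fst = I.flatMap F ∧
      T.Pairwise (fun a b => Disjoint a.1 b.1 ∨ a.2 < b.2) ∧
      ∀ a ∈ T, ∃ i ∈ I, (a.1 : Set W) ⊆ S i ∧ τ i ≤ a.2 ∧ a.2 < τ i + δ by
    obtain ⟨T, h1, h2, h3⟩ := h
    refine ⟨T, h1, h2, fun a ha => ?_⟩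
    obtain ⟨i, hi, -, -, h⟩ := h3 a ha
    exact h.trans_le (hD i hi)
  clear hD
  induction I with
  | nil => exact ⟨[], rfl, List.Pairwise.nil, by simp⟩
  | cons i I ih =>
    rw [List.pairwise_cons] at hτ
    obtain ⟨T, h1, h2, h3⟩ := ih (fun j hj => hS j (by simp [hj]))
      (fun j hj => hδ j (by simp [hj])) hτ.2
    obtain ⟨T', h1', h2', h3'⟩ := hδ i (by simp)
    refine ⟨T'.map (fun a => (a.1, τ i + a.2)) ++ T, ?_, ?_, ?_⟩
    · simp [Function.comp_def, h1, ← h1']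
    · refine List.pairwise_append.2 ⟨?_, h2, ?_⟩
      · rw [List.pairwise_map]
        exact h2'.imp fun h => h.imp id (by intro h; simpa using h)
      · intro a ha b hb
        obtain ⟨c, hc, rfl⟩ := List.mem_map.1 ha
        obtain ⟨j, hj, hbS, hb1, hb2⟩ := h3 b hb
        have hcS : (c.1 : Set W) ⊆ S i := hS i (by simp) c.1 (h1' ▸ List.mem_map_of_mem hc)
        rcases hτ.1 j hj with h | h
        · left
          rw [← Finset.disjoint_coe]
          exact h.mono hcS hbS
        · right
          have := h3' c hc
          simp only
          omega
    · intro a ha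
      rcases List.mem_append.1 ha with ha | ha
      · obtain ⟨c, hc, rfl⟩ := List.mem_map.1 ha
        refine ⟨i, by simp, hS i (by simp) c.1 (h1' ▸ List.mem_map_of_mem hc), by simp, ?_⟩
        have := h3' c hc
        simp only
        omega
      · obtain ⟨j, hj, h⟩ := h3 a ha
        exact ⟨j, by simp [hj], h⟩

/-! ### Action on bit strings -/

/-- The action of a circuit on bit strings. -/
def act (C : Circuit W) (s : W → Bool) : W → Bool := C.foldl (fun s g => g.act s) s

@[simp] theorem act_nil (s : W → Bool) : act ([] : Circuit W) s = s := rfl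

theorem act_cons (g : Gate W) (C : Circuit W) (s : W → Bool) :
    act (g :: C) s = act C (g.act s) := rfl

@[simp] theorem act_append (C D : Circuit W) (s : W → Bool) :
    act (C ++ D) s = act D (act C s) := by
  simp [act, List.foldl_append]

theorem apply_ket [Fintype W] (C : Circuit W) (s : W → Bool) :
    Circuit.apply C (ket s) = ket (act C s) := by
  induction C generalizing s with
  | nil => rfl
  | cons g C ih =>
    have : Circuit.apply (g :: C) (ket s) = Circuit.apply C (g.apply (ket s)) := rfl
    rw [this, Gate.apply_ket, ih, act_cons]

theorem act_reverse_act (C : Circuit W) (s : W → Bool) : act C.reverse (act C s) = s := by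
  induction C generalizing s with
  | nil => rfl
  | cons g C ih =>
    rw [List.reverse_cons, act_append, act_cons g C, ih, act_cons, Gate.act_act, act_nil]

theorem act_act_reverse (C : Circuit W) (s : W → Bool) : act C (act C.reverse s) = s := by
  simpa using act_reverse_act C.reverse s

theorem act_reverse_eq {C : Circuit W} {s s' : W → Bool} (h : act C s' = s) :
    act C.reverse s = s' := by
  rw [← h, act_reverse_act]

theorem Gate.act_of_ne (g : Gate W) (s : W → Bool) {w : W} (h : w ∉ g.support) :
    g.act s w = s w := by
  have : w ≠ g.target := fun e => h (by simp [Gate.support, e])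
  simp [Gate.act, this]

/-! ### Circuits with resource bounds -/

/-- Resource bounds of a circuit: wires, gate count, depth. -/
structure Cost (C : Circuit W) (S : Set W) (ℓ d : ℕ) : Prop where
  sub : ∀ g ∈ C, (g.support : Set W) ⊆ S
  len : C.length ≤ ℓ
  sched : Sched (C.map Gate.support) d

theorem Cost.mono (h : Cost C S ℓ d) (hS : S ⊆ T) (hℓ : ℓ ≤ ℓ') (hd : d ≤ d') :
    Cost C T ℓ' d' :=
  ⟨fun g hg => (h.sub g hg).trans hS, h.len.trans hℓ, h.sched.mono hd⟩

theorem Cost.nil (S : Set W) (ℓ d : ℕ) : Cost ([] : Circuit W) S ℓ d :=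
  ⟨by simp, by simp, Sched.nil d⟩

theorem Cost.append (h : Cost C S ℓ d) (h' : Cost D S ℓ' d') :
    Cost (C ++ D) S (ℓ + ℓ') (d + d') := by
  refine ⟨fun g hg => ?_, ?_, ?_⟩
  · rcases List.mem_append.1 hg with hg | hg
    exacts [h.sub g hg, h'.sub g hg]
  · simpa using add_le_add h.len h'.len
  · simpa using h.sched.append h'.sched

theorem Cost.reverse (h : Cost C S ℓ d) : Cost C.reverse S ℓ d :=
  ⟨fun g hg => h.sub g (by simpa using hg), by simpa using h.len,
    by simpa using h.sched.reverse⟩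

theorem Cost.act_off (h : Cost C S ℓ d) (s : W → Bool) {w : W} (hw : w ∉ S) :
    act C s w = s w := by
  have h1 := h.sub
  clear h
  induction C generalizing s with
  | nil => rfl
  | cons g C ih =>
    rw [act_cons, ih _ fun g' hg' => h1 g' (by simp [hg'])]
    exact g.act_of_ne s fun hg => hw (h1 g (by simp) hg)

theorem Cost.act_congr (h : Cost C S ℓ d) {s s' : W → Bool} (hs : ∀ w ∈ S, s w = s' w) :
    ∀ w ∈ S, act C s w = act C s' w := by
  have h1 := h.sub
  clear h
  induction C generalizing s s' with
  | nil => exact hs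
  | cons g C ih =>
    refine ih (fun w hw => ?_) fun g' hg' => h1 g' (by simp [hg'])
    have hg := h1 g (by simp)
    have hc : (∀ q ∈ g.controls, s q = true) ↔ (∀ q ∈ g.controls, s' q = true) :=
      forall₂_congr fun q hq => by rw [hs q (hg (by simp [Gate.support, hq]))]
    by_cases hwt : w = g.target
    · subst hwt
      simp [Gate.act, hc, hs g.target hw]
    · simp [Gate.act, hwt, hs w hw]

/-- Pieces on disjoint wires, or started at different times. -/
theorem Cost.flatMap {ι : Type*} (I : List ι) (F : ι → Circuit W) (S : ι → Set W)
    (τ : ι → ℕ) (ℓ δ D : ℕ) (h : ∀ i ∈ I, Cost (F i) (S i) ℓ δ)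
    (hτ : I.Pairwise fun i j => Disjoint (S i) (S j) ∨ τ i + δ ≤ τ j)
    (hD : ∀ i ∈ I, τ i + δ ≤ D) (hT : ∀ i ∈ I, S i ⊆ T) :
    Cost (I.flatMap F) T (I.length * ℓ) D := by
  refine ⟨fun g hg => ?_, ?_, ?_⟩
  · obtain ⟨i, hi, hg⟩ := List.mem_flatMap.1 hg
    exact ((h i hi).sub g hg).trans (hT i hi)
  · rw [List.length_flatMap]
    have : ∀ x ∈ I.map (fun i => (F i).length), x ≤ ℓ := by
      intro x hx
      obtain ⟨i, hi, rfl⟩ := List.mem_map.1 hx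
      exact (h i hi).len
    simpa using List.sum_le_card_nsmul _ ℓ this
  · rw [List.map_flatMap]
    refine Sched.flatMap I _ S τ δ D ?_ (fun i hi => (h i hi).sched) hτ hD
    intro i hi X hX
    obtain ⟨g, hg, rfl⟩ := List.mem_map.1 hX
    exact (h i hi).sub g hg

theorem Cost.parallel {ι : Type*} (I : List ι) (F : ι → Circuit W) (S : ι → Set W)
    (ℓ δ : ℕ) (h : ∀ i ∈ I, Cost (F i) (S i) ℓ δ)
    (hS : I.Pairwise fun i j => Disjoint (S i) (S j)) (hT : ∀ i ∈ I, S i ⊆ T) :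
    Cost (I.flatMap F) T (I.length * ℓ) δ :=
  Cost.flatMap I F S (fun _ => 0) ℓ δ δ h (hS.imp Or.inl) (by simp) hT

theorem act_flatMap_off {ι : Type*} (I : List ι) (F : ι → Circuit W) (S : ι → Set W)
    (h : ∀ i ∈ I, Cost (F i) (S i) ℓ d) (s : W → Bool) {w : W} (hw : ∀ i ∈ I, w ∉ S i) :
    act (I.flatMap F) s w = s w := by
  induction I generalizing s with
  | nil => rfl
  | cons i I ih =>
    rw [List.flatMap_cons, act_append, ih (fun j hj => h j (by simp [hj])) _
      fun j hj => hw j (by simp [hj])]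
    exact (h i (by simp)).act_off s (hw i (by simp))

/-- Pieces on disjoint wires do not see each other, so on its own wires a piece acts as if it were
alone. -/
theorem act_flatMap_on {ι : Type*} (I : List ι) (F : ι → Circuit W) (S : ι → Set W)
    (h : ∀ i ∈ I, Cost (F i) (S i) ℓ d) (hS : I.Pairwise fun i j => Disjoint (S i) (S j))
    (s : W → Bool) {i : ι} (hi : i ∈ I) {w : W} (hw : w ∈ S i) :
    act (I.flatMap F) s w = act (F i) s w := by
  induction I generalizing s with
  | nil => simp at hi
  | cons j I ih =>
    rw [List.pairwise_cons] at hS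
    rw [List.flatMap_cons, act_append]
    by_cases hiI : i ∈ I
    · rw [ih (fun j hj => h j (by simp [hj])) hS.2 _ hiI]
      refine (h i hi).act_congr (fun w' hw' => ?_) w hw
      exact (h j (by simp)).act_off s fun hj => Set.disjoint_left.1 (hS.1 i hiI) hj hw'
    · obtain rfl : i = j := by simpa [hiI] using hi
      exact act_flatMap_off I F S (fun j hj => h j (by simp [hj])) _
        fun j hj hj' => Set.disjoint_left.1 (hS.1 j hj) hw hj'

/-! ### Single gates -/

/-- Flip the bit at `t` if `b`. -/
def xorAt (t : W) (b : Bool) (s : W → Bool) : W → Bool := Function.update s t (s t ^^ b)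

@[simp] theorem xorAt_same (t : W) (b : Bool) (s : W → Bool) : xorAt t b s t = (s t ^^ b) := by
  simp [xorAt]

@[simp] theorem xorAt_of_ne {t w : W} (h : w ≠ t) (b : Bool) (s : W → Bool) :
    xorAt t b s w = s w := by
  simp [xorAt, h]

theorem xorAt_apply (t : W) (b : Bool) (s : W → Bool) (w : W) :
    xorAt t b s w = (s w ^^ (decide (w = t) && b)) := by
  by_cases h : w = t
  · subst h; simp
  · simp [h]

@[simp] theorem xorAt_false (t : W) (s : W → Bool) : xorAt t false s = s := by
  simp [xorAt]

@[simp] theorem xorAt_xorAt (t : W) (b c : Bool) (s : W → Bool) :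
    xorAt t b (xorAt t c s) = xorAt t (c ^^ b) s := by
  ext w
  simp only [xorAt_apply]
  cases decide (w = t) <;> simp

/-- The gate `CCX`, as a circuit (empty if the wires are not admissible). -/
def ccx (a b t : W) : Circuit W :=
  if h : t ≠ a ∧ t ≠ b then
    [⟨{a, b}, t, by simp [h.1, h.2], Finset.card_le_two⟩] else []

/-- The gate `CX`, as a circuit (empty if the wires are not admissible). -/
def cx (a t : W) : Circuit W := ccx a a t

/-- The gate `X`, as a circuit. -/
def xg (t : W) : Circuit W := [⟨∅, t, by simp, by simp⟩]

theorem act_ccx {a b t : W} (ha : t ≠ a) (hb : t ≠ b) (s : W → Bool) :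
    act (ccx a b t) s = xorAt t (s a && s b) s := by
  rw [ccx, dif_pos ⟨ha, hb⟩, act_cons, act_nil]
  simp [Gate.act, xorAt]

theorem act_cx {a t : W} (ha : t ≠ a) (s : W → Bool) :
    act (cx a t) s = xorAt t (s a) s := by
  rw [cx, act_ccx ha ha, Bool.and_self]

theorem act_xg (t : W) (s : W → Bool) : act (xg t) s = xorAt t true s := by
  rw [xg, act_cons, act_nil]
  simp [Gate.act, xorAt]

theorem Cost.ccx (a b t : W) : Cost (ccx a b t) {a, b, t} 1 1 := by
  rw [QCirc.ccx]
  split_ifs with h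
  · refine ⟨?_, by simp, by simpa using Sched.singleton _⟩
    intro g hg
    obtain rfl := List.mem_singleton.1 hg
    intro x hx
    simp only [Gate.support, Finset.coe_insert, Finset.coe_singleton] at hx
    simp only [Set.mem_insert_iff, Set.mem_singleton_iff] at hx ⊢
    tauto
  · exact Cost.nil _ _ _

theorem Cost.cx (a t : W) : Cost (cx a t) {a, t} 1 1 :=
  (Cost.ccx a a t).mono (by simp) le_rfl le_rfl

theorem Cost.xg (t : W) : Cost (xg t) {t} 1 1 := by
  refine ⟨?_, by simp [QCirc.xg], by simpa [QCirc.xg] using Sched.singleton _⟩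
  intro g hg
  obtain rfl := List.mem_singleton.1 hg
  simp [Gate.support]

/-! ### Renaming wires -/

variable {V : Type} [DecidableEq V]

/-- Rename the wires of a circuit along an injection. -/
def mapCirc (f : V ↪ W) (C : Circuit V) : Circuit W :=
  List.map (fun g => ⟨g.controls.map f, f g.target, by simpa using g.target_notMem,
    by simpa using g.card_le⟩) C

theorem act_mapCirc (f : V ↪ W) (C : Circuit V) (s : W → Bool) (v : V) :
    act (mapCirc f C) s (f v) = act C (s ∘ f) v := by
  induction C generalizing s with
  | nil => rfl
  | cons g C ih =>
    rw [mapCirc, List.map_cons, act_cons, act_cons]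
    refine (ih _).trans ?_
    congr 1
    ext w
    by_cases h : w = g.target
    · subst h; simp [Gate.act]
    · simp [Gate.act, h]

theorem Cost.mapCirc (f : V ↪ W) {C : Circuit V} {S : Set V} (h : Cost C S ℓ d) :
    Cost (mapCirc f C) (f '' S) ℓ d := by
  have hsupp : ∀ g : Gate V, Gate.support (⟨g.controls.map f, f g.target,
      by simpa using g.target_notMem, by simpa using g.card_le⟩ : Gate W) =
      g.support.image f := by
    intro g
    simp [Gate.support, Finset.map_eq_image, Finset.image_insert]
  refine ⟨?_, by simpa [QCirc.mapCirc] using h.len, ?_⟩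
  · intro g hg
    obtain ⟨g', hg', rfl⟩ := List.mem_map.1 hg
    rw [hsupp, Finset.coe_image]
    exact Set.image_mono (h.sub g' hg')
  · have := h.sched.map f.injective
    rw [List.map_map] at this
    rw [QCirc.mapCirc, List.map_map]
    convert this using 2
    ext g
    simp [hsupp]

/-! ### Multiply controlled gates -/

theorem Cost.act_xorAt (h : Cost C S ℓ d) {t : W} (ht : t ∉ S) (b : Bool) (s : W → Bool) :
    act C (xorAt t b s) = xorAt t b (act C s) := by
  have hne : ∀ w ∈ S, w ≠ t := fun w hw e => ht (e ▸ hw)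
  ext w
  by_cases hw : w ∈ S
  · rw [xorAt_of_ne (hne w hw)]
    exact h.act_congr (fun w hw => xorAt_of_ne (hne w hw) b s) w hw
  · rw [h.act_off _ hw, xorAt_apply, xorAt_apply, h.act_off _ hw]

/-- Compute, use, uncompute: `R` does not touch the target, so `R.reverse` commutes with the flip
and restores everything else. -/
theorem Cost.act_conj_xorAt {R A : Circuit W} (h : Cost R S ℓ d) {t : W} (ht : t ∉ S)
    {P : (W → Bool) → Bool} (hA : ∀ s, act A s = xorAt t (P s) s) (s : W → Bool) :
    act (R ++ A ++ R.reverse) s = xorAt t (P (act R s)) s := by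
  rw [act_append, act_append, hA, h.reverse.act_xorAt ht, act_reverse_act]

/-- The circuit flips `t` iff all the wires in `S` are `1`. -/
def IsMCX (C : Circuit W) (S : Finset W) (t : W) : Prop :=
  ∀ s, act C s = xorAt t (decide (∀ q ∈ S, s q = true)) s

theorem xorAt_of_notMem {S : Finset W} {t : W} (ht : t ∉ S) (b : Bool) (s : W → Bool) :
    (∀ q ∈ S, xorAt t b s q = true) ↔ ∀ q ∈ S, s q = true :=
  forall₂_congr fun q hq => by rw [xorAt_of_ne (t := t) (w := q) fun e => ht (e ▸ hq)]

/-- Computing a conjunction `φ ∧ χ` into `t` with a dirty wire `g`. -/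
theorem act_toggle {A B : Circuit W} {t g : W} {φ χ : (W → Bool) → Bool} (hgt : g ≠ t)
    (hA : ∀ s, act A s = xorAt t (s g && φ s) s) (hB : ∀ s, act B s = xorAt g (χ s) s)
    (hφg : ∀ b s, φ (xorAt g b s) = φ s) (hφt : ∀ b s, φ (xorAt t b s) = φ s)
    (hχg : ∀ b s, χ (xorAt g b s) = χ s) (hχt : ∀ b s, χ (xorAt t b s) = χ s) (s : W → Bool) :
    act (A ++ B ++ A ++ B) s = xorAt t (φ s && χ s) s := by
  simp only [act_append, hA, hB, hφg, hφt, hχg, hχt, xorAt_same, xorAt_of_ne hgt]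
  ext w
  simp only [xorAt_apply]
  by_cases h1 : w = t
  · subst h1
    simp only [decide_true, Bool.true_and, Ne.symm hgt, decide_false, Bool.false_and]
    cases s w <;> cases s g <;> cases φ s <;> cases χ s <;> rfl
  · by_cases h2 : w = g
    · subst h2
      simp [h1]
    · simp [h1, h2]

/-- The case of `act_toggle` where both conditions are conjunctions. The two sets of controls may
overlap. -/
theorem IsMCX.split {A B : Circuit W} {S₁ S₂ : Finset W} {t g : W} (hA : IsMCX A (insert g S₁) t)
    (hB : IsMCX B S₂ g) (h1t : t ∉ S₁) (h2t : t ∉ S₂) (h1g : g ∉ S₁) (h2g : g ∉ S₂)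
    (hgt : g ≠ t) : IsMCX (A ++ B ++ A ++ B) (S₁ ∪ S₂) t := by
  intro s
  rw [act_toggle (φ := fun s => decide (∀ q ∈ S₁, s q = true))
    (χ := fun s => decide (∀ q ∈ S₂, s q = true)) hgt (fun s => ?_) hB]
  · congr 1
    rw [← Bool.decide_and]
    congr 1
    simp only [Finset.mem_union, or_imp, forall_and]
  · intro b s; simp only [xorAt_of_notMem h1g]
  · intro b s; simp only [xorAt_of_notMem h1t]
  · intro b s; simp only [xorAt_of_notMem h2g]
  · intro b s; simp only [xorAt_of_notMem h2t]
  · rw [hA]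
    congr 1
    simp [Bool.decide_and]

/-- A `C^k X` gate with one dirty ancilla can be built within the given bounds. -/
def HasMCX (k ℓ d : ℕ) : Prop :=
  ∀ (W : Type) [DecidableEq W] (S : Finset W) (t g : W), S.card = k → t ∉ S → g ∉ S → g ≠ t →
    ∃ C : Circuit W, Cost C (S ∪ {t, g}) ℓ d ∧ IsMCX C S t

theorem HasMCX.mono {k ℓ d ℓ' d' : ℕ} (h : HasMCX k ℓ d) (hℓ : ℓ ≤ ℓ') (hd : d ≤ d') :
    HasMCX k ℓ' d' := by
  intro W _ S t g h1 h2 h3 h4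
  obtain ⟨C, hC, h⟩ := h W S t g h1 h2 h3 h4
  exact ⟨C, hC.mono le_rfl hℓ hd, h⟩

theorem hasMCX_zero : HasMCX 0 1 1 := by
  intro W _ S t g h1 _ _ _
  obtain rfl := Finset.card_eq_zero.1 h1
  exact ⟨xg t, (Cost.xg t).mono (by simp) le_rfl le_rfl, fun s => by simp [act_xg]⟩

/-- Splits off a single control. The cost doubles each time, so this serves only for a bounded
number of controls. -/
theorem HasMCX.succ {k ℓ d : ℕ} (h : HasMCX k ℓ d) : HasMCX (k + 1) (2 * ℓ + 2) (2 * d + 2) := by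
  intro W _ S t g h1 h2 h3 h4
  obtain ⟨q, S, hq, rfl, hk⟩ := Finset.card_eq_succ.1 h1
  have hqt : t ≠ q := by rintro rfl; simp at h2
  have hqg : g ≠ q := by rintro rfl; simp at h3
  have h2' : t ∉ S := fun h => h2 (by simp [h])
  have h3' : g ∉ S := fun h => h3 (by simp [h])
  obtain ⟨B, hB, hB'⟩ := h W S g t hk h3' h2' h4.symm
  refine ⟨ccx g q t ++ B ++ ccx g q t ++ B, ?_, ?_⟩
  · have hA : Cost (ccx g q t) ((insert q S : Finset W) ∪ {t, g}) 1 1 := by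
      refine (Cost.ccx g q t).mono ?_ le_rfl le_rfl
      intro x hx
      simp only [Set.mem_insert_iff, Set.mem_singleton_iff] at hx
      simp; tauto
    have hB2 : Cost B ((insert q S : Finset W) ∪ {t, g}) ℓ d := by
      refine hB.mono ?_ le_rfl le_rfl
      intro x hx
      simp at hx ⊢; tauto
    exact (((hA.append hB2).append hA).append hB2).mono le_rfl (by omega) (by omega)
  · have := IsMCX.split (A := ccx g q t) (B := B) (S₁ := {q}) (S₂ := S) (t := t) (g := g)
      (fun s => ?_) hB' (by simpa using hqt) h2' (by simpa using hqg) h3' h4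
    · simpa using this
    · rw [act_ccx h4.symm hqt]
      congr 1
      simp [Bool.decide_and]

theorem exists_hasMCX_of_lt (N : ℕ) : ∃ B, ∀ k < N, HasMCX k B B := by
  have key : ∀ k, ∃ B, HasMCX k B B := by
    intro k
    induction k with
    | zero => exact ⟨1, hasMCX_zero⟩
    | succ k ih => obtain ⟨B, hB⟩ := ih; exact ⟨2 * B + 2, hB.succ⟩
  choose f hf using key
  refine ⟨(Finset.range N).sup f, fun k hk => ?_⟩
  have := Finset.le_sup (f := f) (Finset.mem_range.2 hk)
  exact (hf k).mono this this

/-! ### Conjunctions along a binary heap -/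

/-- `v := v ∧ children`, for a node `v` promised to be `1`. -/
def heapNode (w : ℕ → W) (v : ℕ) : Circuit W := ccx (w (2 * v)) (w (2 * v + 1)) (w v) ++ xg (w v)

theorem heapNode_cost (w : ℕ → W) (v : ℕ) :
    Cost (heapNode w v) {w (2 * v), w (2 * v + 1), w v} 2 2 :=
  (Cost.ccx _ _ _).append ((Cost.xg _).mono (by simp) le_rfl le_rfl)

theorem act_heapNode {w : ℕ → W} {v : ℕ} (h0 : w v ≠ w (2 * v)) (h1 : w v ≠ w (2 * v + 1))
    (s : W → Bool) :
    act (heapNode w v) s = xorAt (w v) (!(s (w (2 * v)) && s (w (2 * v + 1)))) s := by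
  rw [heapNode, act_append, act_ccx h0 h1, act_xg, xorAt_xorAt, Bool.xor_true]

/-- The nodes `n, n - 1, …, 1` of a heap. -/
def heapPass (w : ℕ → W) (n : ℕ) : Circuit W :=
  (List.range n).reverse.flatMap fun v => heapNode w (v + 1)

theorem heapPass_succ (w : ℕ → W) (n : ℕ) :
    heapPass w (n + 1) = heapNode w (n + 1) ++ heapPass w n := by
  simp [heapPass, List.range_succ]

/-- When all wires are `1`, every node is replaced by `1 ∧ 1`, so nothing changes. -/
theorem act_heapPass_of_forall {w : ℕ → W} {n : ℕ} (hw : Set.InjOn w (Set.Icc 1 (2 * n + 1)))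
    {s : W → Bool} (h : ∀ v, 1 ≤ v → v ≤ 2 * n + 1 → s (w v) = true) :
    act (heapPass w n) s = s := by
  induction n with
  | zero => rfl
  | succ n ih =>
    rw [heapPass_succ, act_append, act_heapNode]
    · rw [h _ (by omega) (by omega), h _ (by omega) (by omega)]
      simp only [Bool.and_self, Bool.not_true, xorAt_false]
      exact ih (hw.mono (Set.Icc_subset_Icc le_rfl (by omega)))
        fun v h1 h2 => h v h1 (by omega)
    · exact fun e => absurd (hw ⟨by omega, by omega⟩ ⟨by omega, by omega⟩ e) (by omega)
    · exact fun e => absurd (hw ⟨by omega, by omega⟩ ⟨by omega, by omega⟩ e) (by omega)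

/-- A zero leaf propagates to the root. Processing the last internal node turns it into a leaf of a
smaller heap, and it is `0` if one of its children was. -/
theorem act_heapPass_of_exists {w : ℕ → W} {n : ℕ} (hw : Set.InjOn w (Set.Icc 1 (2 * n + 1)))
    {s : W → Bool} (h : ∀ v, 1 ≤ v → v ≤ n → s (w v) = true)
    (h' : ∃ u, n + 1 ≤ u ∧ u ≤ 2 * n + 1 ∧ s (w u) = false) :
    act (heapPass w n) s (w 1) = false := by
  induction n generalizing s with
  | zero =>
    obtain ⟨u, h1, h2, h3⟩ := h'
    obtain rfl : u = 1 := by omega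
    exact h3
  | succ n ih =>
    have hne : ∀ a b, 1 ≤ a → 1 ≤ b → a ≤ 2 * (n + 1) + 1 → b ≤ 2 * (n + 1) + 1 → a ≠ b →
        w a ≠ w b := fun a b h1 h2 h3 h4 h5 e => h5 (hw ⟨h1, h3⟩ ⟨h2, h4⟩ e)
    rw [heapPass_succ, act_append, act_heapNode (hne _ _ (by omega) (by omega) (by omega)
      (by omega) (by omega)) (hne _ _ (by omega) (by omega) (by omega) (by omega) (by omega))]
    refine ih (hw.mono (Set.Icc_subset_Icc le_rfl (by omega))) (fun v h1 h2 => ?_) ?_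
    · rw [xorAt_of_ne (hne _ _ h1 (by omega) (by omega) (by omega) (by omega))]
      exact h v h1 (by omega)
    · obtain ⟨u, h1, h2, h3⟩ := h'
      by_cases hu : u ≤ 2 * n + 1
      · exact ⟨u, by omega, hu, by
          rw [xorAt_of_ne (hne _ _ (by omega) (by omega) (by omega) (by omega) (by omega)), h3]⟩
      · refine ⟨n + 1, le_rfl, by omega, ?_⟩
        rw [xorAt_same, h _ (by omega) le_rfl]
        rcases (by omega : u = 2 * (n + 1) ∨ u = 2 * (n + 1) + 1) with rfl | rfl <;> simp [h3]

/-- Heaps of depths `1, …, J` that share their nodes except for the roots `e 0, …, e (J - 1)`. -/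
def heapWire (e : ℕ → W) (J j v : ℕ) : W := e (if v = 1 then j else J + v - 2)

/-- The nodes of all the heaps. -/
def heapIndex (J : ℕ) : List (ℕ × ℕ) :=
  (List.range J).flatMap fun j => (List.range (2 ^ (j + 1) - 1)).reverse.map fun v => (j, v + 1)

/-- One pass over each of the heaps. -/
def heapCirc (e : ℕ → W) (J : ℕ) : Circuit W :=
  (heapIndex J).flatMap fun p => heapNode (heapWire e J p.1) p.2

theorem heapIndex_length (J : ℕ) : (heapIndex J).length ≤ 2 ^ (J + 1) := by
  induction J with
  | zero => simp [heapIndex]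
  | succ J ih =>
    rw [heapIndex, List.range_succ, List.flatMap_append, List.length_append]
    have : ((heapIndex J).length = _) := congrArg List.length rfl
    simp only [heapIndex] at ih
    simp only [List.flatMap_cons, List.flatMap_nil, List.append_nil, List.length_map,
      List.length_reverse, List.length_range]
    have h2 : 2 ^ (J + 1 + 1) = 2 * 2 ^ (J + 1) := by ring
    omega

theorem mem_heapIndex {J : ℕ} {p : ℕ × ℕ} (h : p ∈ heapIndex J) :
    p.1 < J ∧ 1 ≤ p.2 ∧ p.2 < 2 ^ (p.1 + 1) := by
  simp only [heapIndex, List.mem_flatMap, List.mem_range, List.mem_map, List.mem_reverse] at h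
  obtain ⟨j, hj, v, hv, rfl⟩ := h
  exact ⟨hj, by simp, by simp only; omega⟩

theorem heapIndex_pairwise (J : ℕ) :
    (heapIndex J).Pairwise fun p q => p.1 < q.1 ∨ (p.1 = q.1 ∧ q.2 < p.2) := by
  rw [heapIndex, List.pairwise_flatMap]
  constructor
  · intro j _
    rw [List.pairwise_map, List.pairwise_reverse]
    exact List.pairwise_lt_range.imp fun h => Or.inr ⟨rfl, by simpa using h⟩
  · refine List.pairwise_lt_range.imp fun h p hp q hq => Or.inl ?_
    obtain ⟨a, -, rfl⟩ := List.mem_map.1 hp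
    obtain ⟨b, -, rfl⟩ := List.mem_map.1 hq
    exact h

/-- The passes are pipelined. A node only touches its own level and the next one, so two levels of
delay between successive heaps suffice, and `J` heaps of height at most `J` take `O(J)` layers
instead of `O(J ^ 2)`. -/
theorem heapCirc_cost {e : ℕ → W} {J : ℕ} (he : Set.InjOn e (Set.Iio (J + 2 ^ (J + 1) - 2))) :
    Cost (heapCirc e J) (e '' Set.Iio (J + 2 ^ (J + 1) - 2)) (2 ^ (J + 1) * 2) (6 * J) := by
  have hpow : ∀ p : ℕ × ℕ, p ∈ heapIndex J → 2 * p.2 + 1 < 2 ^ (J + 1) := by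
    intro p hp
    obtain ⟨h1, h2, h3⟩ := mem_heapIndex hp
    have : 2 ^ (p.1 + 1) ≤ 2 ^ J := Nat.pow_le_pow_right (by norm_num) h1
    have h2 : 2 ^ (J + 1) = 2 * 2 ^ J := by ring
    omega
  refine (Cost.flatMap (heapIndex J) (fun p => heapNode (heapWire e J p.1) p.2)
    (fun p => {heapWire e J p.1 (2 * p.2), heapWire e J p.1 (2 * p.2 + 1), heapWire e J p.1 p.2})
    -- Start times: two layers per node, deeper levels first, and a delay of two levels per heap.
    (fun p => 2 * (2 * p.1 + J - Nat.log 2 p.2)) 2 2 (6 * J)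
    (fun p _ => heapNode_cost _ _) ?_ ?_ ?_).mono le_rfl
    (Nat.mul_le_mul_right _ (heapIndex_length J)) le_rfl
  · refine (heapIndex_pairwise J).imp_of_mem fun {p q} hp hq h => ?_
    obtain ⟨hp1, hp2, hp3⟩ := mem_heapIndex hp
    obtain ⟨hq1, hq2, hq3⟩ := mem_heapIndex hq
    have hp4 := hpow p hp
    have hq4 := hpow q hq
    have lp : Nat.log 2 p.2 < p.1 + 1 := Nat.log_lt_of_lt_pow (by omega) hp3
    have lq : Nat.log 2 q.2 < q.1 + 1 := Nat.log_lt_of_lt_pow (by omega) hq3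
    by_cases hlt : 2 * (2 * p.1 + J - Nat.log 2 p.2) + 2 ≤ 2 * (2 * q.1 + J - Nat.log 2 q.2)
    · exact Or.inr hlt
    left
    -- If the second node does not start after the first has finished, it lies at least two levels
    -- deeper in a later heap, or on the same level of the same heap. In both cases the wires are
    -- disjoint.
    have hcase : 2 * p.2 + 1 < q.2 ∨ (p.1 = q.1 ∧ q.2 < p.2 ∧ p.2 < 2 * q.2) := by
      rcases h with h | ⟨h, h'⟩
      · left
        have hl : Nat.log 2 p.2 + 2 ≤ Nat.log 2 q.2 := by omega
        have := Nat.lt_pow_succ_log_self (b := 2) (by norm_num) p.2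
        have h5 : 2 ^ (Nat.log 2 p.2 + 2) ≤ 2 ^ Nat.log 2 q.2 :=
          Nat.pow_le_pow_right (by norm_num) hl
        have h6 := Nat.pow_log_le_self 2 (x := q.2) (by omega)
        rw [pow_succ] at h5
        simp only [Nat.succ_eq_add_one] at this
        omega
      · right
        refine ⟨h, h', ?_⟩
        have hl : Nat.log 2 p.2 ≤ Nat.log 2 q.2 := by omega
        have := Nat.lt_pow_succ_log_self (b := 2) (by norm_num) p.2
        have h5 : 2 ^ (Nat.log 2 p.2 + 1) ≤ 2 ^ (Nat.log 2 q.2 + 1) :=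
          Nat.pow_le_pow_right (by norm_num) (by omega)
        have h6 := Nat.pow_log_le_self 2 (x := q.2) (by omega)
        rw [pow_succ 2 (Nat.log 2 q.2)] at h5
        simp only [Nat.succ_eq_add_one] at this
        omega
    have key : ∀ a b, 1 ≤ a → 1 ≤ b → a < 2 ^ (J + 1) → b < 2 ^ (J + 1) → a ≠ b →
        (p.1 = q.1 ∨ 2 ≤ b) → heapWire e J p.1 a ≠ heapWire e J q.1 b := by
      intro a b ha hb ha' hb' hab hpq heq
      have := he (by rw [Set.mem_Iio]; split_ifs <;> omega) (by rw [Set.mem_Iio]; split_ifs <;> omega) heq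
      split_ifs at this <;> omega
    rw [Set.disjoint_left]
    intro x hx hx'
    simp only [Set.mem_insert_iff, Set.mem_singleton_iff] at hx hx'
    rcases hx with rfl | rfl | rfl <;> rcases hx' with hx' | hx' | hx' <;>
      exact key _ _ (by omega) (by omega) (by omega) (by omega) (by omega) (by omega) hx'
  · intro p hp
    obtain ⟨hp1, hp2, hp3⟩ := mem_heapIndex hp
    omega
  · intro p hp
    obtain ⟨hp1, hp2, hp3⟩ := mem_heapIndex hp
    have hp4 := hpow p hp
    intro x hx
    simp only [Set.mem_insert_iff, Set.mem_singleton_iff] at hx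
    rcases hx with rfl | rfl | rfl <;>
      exact ⟨_, by rw [Set.mem_Iio]; split_ifs <;> omega, rfl⟩

/-- Heap `j` works only under the promise that its internal nodes are `1`. These were tested by the
earlier heaps: if their roots are still `1`, the promise holds and, by the second clause, nothing
has been altered, so the pass tests the next level. If some root is already `0`, the promise may
fail, but later heaps never touch that root, and the conjunction of the roots stays false. -/
theorem act_heapIndex_range {e : ℕ → W} {J : ℕ} (he : Set.InjOn e (Set.Iio (J + 2 ^ (J + 1) - 2)))
    {s : W → Bool} (hs : ∀ i < J, s (e i) = true) (j : ℕ) (hj : j ≤ J) :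
    let C := (List.range j).flatMap fun i => heapPass (heapWire e J i) (2 ^ (i + 1) - 1)
    ((∀ i < J, act C s (e i) = true) ↔ ∀ v, 2 ≤ v → v < 2 ^ (j + 1) → s (e (J + v - 2)) = true) ∧
    ((∀ i < J, act C s (e i) = true) → act C s = s) := by
  induction j with
  | zero =>
    refine ⟨⟨fun _ v h1 h2 => absurd h2 (by simp; omega), fun _ => hs⟩, fun _ => rfl⟩
  | succ j ih =>
    intro C
    obtain ⟨ih1, ih2⟩ := ih (by omega)
    set C' := (List.range j).flatMap fun i => heapPass (heapWire e J i) (2 ^ (i + 1) - 1)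
    have hC : C = C' ++ heapPass (heapWire e J j) (2 ^ (j + 1) - 1) := by
      simp [C, C', List.range_succ, List.flatMap_append]
    have h0 : 2 ^ (j + 1) ≤ 2 ^ J := Nat.pow_le_pow_right (by norm_num) hj
    have h1 : 2 ^ (J + 1) = 2 * 2 ^ J := by ring
    have h2 : 2 ^ (j + 1 + 1) = 2 * 2 ^ (j + 1) := by ring
    have h3 : 2 ≤ 2 ^ (j + 1) := by rw [pow_succ]; have := Nat.one_le_two_pow (n := j); omega
    have hinj : Set.InjOn (heapWire e J j) (Set.Icc 1 (2 * (2 ^ (j + 1) - 1) + 1)) := by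
      intro a ha b hb hab
      obtain ⟨ha1, ha2⟩ := ha
      obtain ⟨hb1, hb2⟩ := hb
      have := he (by rw [Set.mem_Iio]; split_ifs <;> omega) (by rw [Set.mem_Iio]; split_ifs <;> omega) hab
      split_ifs at this <;> omega
    have hoff : ∀ s' i, i < J → i ≠ j →
        act (heapPass (heapWire e J j) (2 ^ (j + 1) - 1)) s' (e i) = s' (e i) := by
      intro s' i hi hij
      refine act_flatMap_off _ _ _ (fun v _ => heapNode_cost _ _) _ fun v hv hmem => ?_
      simp only [List.mem_reverse, List.mem_range] at hv
      simp only [Set.mem_insert_iff, Set.mem_singleton_iff] at hmem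
      rcases hmem with h | h | h <;>
      · have := he (by rw [Set.mem_Iio]; omega) (by rw [Set.mem_Iio]; split_ifs <;> omega) h
        split_ifs at this <;> omega
    by_cases hall : ∀ i < J, act C' s (e i) = true
    · have hs' := ih2 hall
      have hw := ih1.1 hall
      have hroot : ∀ v, 1 ≤ v → v ≤ 2 ^ (j + 1) - 1 → s (heapWire e J j v) = true := by
        intro v hv1 hv2
        by_cases hv : v = 1
        · subst hv; exact hs j (by omega)
        · simp only [heapWire, if_neg hv]
          exact hw v (by omega) (by omega)
      by_cases hleaf : ∀ v, 2 ≤ v → v < 2 ^ (j + 1 + 1) → s (e (J + v - 2)) = true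
      · have hact : act C s = s := by
          rw [hC, act_append, hs']
          refine act_heapPass_of_forall hinj fun v hv1 hv2 => ?_
          by_cases hv : v = 1
          · subst hv; exact hs j (by omega)
          · simp only [heapWire, if_neg hv]
            exact hleaf v (by omega) (by omega)
        rw [hact]
        exact ⟨⟨fun _ => hleaf, fun _ => hs⟩, fun _ => rfl⟩
      · have hact : act C s (e j) = false := by
          rw [hC, act_append, hs']
          refine act_heapPass_of_exists hinj hroot ?_
          push Not at hleaf
          obtain ⟨v, hv1, hv2, hv3⟩ := hleaf
          by_cases hv : v < 2 ^ (j + 1)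
          · exact absurd (hw v hv1 hv) hv3
          · refine ⟨v, by omega, by omega, ?_⟩
            simp only [heapWire, if_neg (show v ≠ 1 by omega)]
            simpa using hv3
        have hno : ¬ ∀ i < J, act C s (e i) = true := fun h => by
          simpa [hact] using h j (by omega)
        exact ⟨⟨fun h => absurd h hno, fun h => absurd h hleaf⟩, fun h => absurd h hno⟩
    · have hno : ¬ ∀ i < J, act C s (e i) = true := by
        intro h
        refine hall (ih1.2 fun v hv1 hv2 => ?_)
        by_contra hcon
        push Not at hall
        obtain ⟨i, hi, hi'⟩ := hall
        -- The earlier heaps do not touch root `j`, so it still has its initial value `1`. Any other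
        -- root that is `0` is untouched by heap `j` and remains `0`.
        by_cases hij : i = j
        · subst hij
          have : act C' s (e i) = s (e i) := by
            -- Only the set of wires matters here; the size and depth bounds are crude.
            refine act_flatMap_off (d := 2 * 2 ^ J) (ℓ := 2 * 2 ^ J) (List.range i) _
              (fun i' => e '' {x | x ≠ i ∧ x < J + 2 ^ (J + 1) - 2}) (fun i' hi' => ?_) s ?_
            · simp only [List.mem_range] at hi'
              have h0' : 2 ^ (i' + 1) ≤ 2 ^ J := Nat.pow_le_pow_right (by norm_num) (by omega)
              have hlen : ((List.range (2 ^ (i' + 1) - 1)).reverse.length) * 2 ≤ 2 * 2 ^ J := by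
                simp; omega
              have := Cost.flatMap (T := e '' {x | x ≠ i ∧ x < J + 2 ^ (J + 1) - 2})
                (List.range (2 ^ (i' + 1) - 1)).reverse
                (fun v => heapNode (heapWire e J i') (v + 1)) _
                (fun v => 2 * (2 ^ (i' + 1) - 1 - 1 - v)) 2 2 (2 * 2 ^ J)
                (fun v _ => heapNode_cost _ _) ?_ ?_ ?_
              · exact this.mono le_rfl hlen le_rfl
              · rw [List.pairwise_reverse]
                refine List.pairwise_lt_range.imp_of_mem fun {a b} ha hb hab => Or.inr ?_
                simp only [List.mem_range] at ha hb
                omega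
              · intro v hv
                simp only [List.mem_reverse, List.mem_range] at hv
                omega
              · intro v hv x hx
                simp only [List.mem_reverse, List.mem_range] at hv
                simp only [Set.mem_insert_iff, Set.mem_singleton_iff] at hx
                rcases hx with rfl | rfl | rfl <;>
                · refine ⟨_, ⟨?_, ?_⟩, rfl⟩ <;> split_ifs <;> omega
            · rintro i' - ⟨x, ⟨hx1, hx2⟩, hx3⟩
              exact hx1 (he hx2 (by rw [Set.mem_Iio]; omega) hx3)
          rw [this, hs i hi] at hi'
          exact hi' rfl
        · have := h i hi
          rw [hC, act_append, hoff _ i hi hij] at this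
          exact hi' this
      refine ⟨⟨fun h => absurd h hno, fun h => absurd (ih1.2 fun v hv1 hv2 => h v hv1 (by omega))
        hall⟩, fun h => absurd h hno⟩

theorem act_heapCirc {e : ℕ → W} {J : ℕ} (he : Set.InjOn e (Set.Iio (J + 2 ^ (J + 1) - 2)))
    {s : W → Bool} (hs : ∀ i < J, s (e i) = true) :
    (∀ i < J, act (heapCirc e J) s (e i) = true) ↔
      ∀ i < J + 2 ^ (J + 1) - 2, s (e i) = true := by
  have h : heapCirc e J =
      (List.range J).flatMap fun i => heapPass (heapWire e J i) (2 ^ (i + 1) - 1) := by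
    simp only [heapCirc, heapIndex, heapPass, List.flatMap_assoc, List.flatMap_map]
  rw [h, (act_heapIndex_range he hs J le_rfl).1]
  have h3 : 2 ≤ 2 ^ (J + 1) := by rw [pow_succ]; have := Nat.one_le_two_pow (n := J); omega
  constructor
  · intro h i hi
    by_cases hij : i < J
    · exact hs i hij
    · have := h (i + 2 - J) (by omega) (by omega)
      rwa [show J + (i + 2 - J) - 2 = i by omega] at this
  · intro h v hv1 hv2
    exact h _ (by omega)

/-! ### Multiply controlled `X` in linear size and logarithmic depth -/

theorem exists_enum (S : Finset W) (t : W) : ∃ e : ℕ → W, Set.InjOn e (Set.Iio S.card) ∧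
    ∀ q, q ∈ S ↔ ∃ i < S.card, e i = q := by
  refine ⟨fun i => if h : i < S.card then (S.equivFin.symm ⟨i, h⟩ : W) else t, ?_, ?_⟩
  · intro a ha b hb hab
    simp only [Set.mem_Iio] at ha hb
    simp only [dif_pos ha, dif_pos hb] at hab
    simpa using S.equivFin.symm.injective (Subtype.ext hab)
  · intro q
    constructor
    · intro hq
      refine ⟨S.equivFin ⟨q, hq⟩, (S.equivFin ⟨q, hq⟩).2, ?_⟩
      simp
    · rintro ⟨i, hi, rfl⟩
      simp [dif_pos hi]

/-- The heaps reduce the conjunction of all controls to that of the `J` roots, provided that the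
roots are `1` to begin with. The proviso is itself a conjunction of `J` wires, and `act_toggle`
combines "roots are `1` after the heaps" with "roots are `1` before". -/
theorem HasMCX.heap {J ℓ d : ℕ} (hJ : 1 ≤ J) (h0 : HasMCX J ℓ d) (h1 : HasMCX (J + 1) ℓ d) :
    HasMCX (J + 2 ^ (J + 1) - 2) (4 * (2 ^ (J + 1) * 2) + 4 * ℓ) (4 * (6 * J) + 4 * d) := by
  intro W _ S t g hS ht hg hgt
  obtain ⟨e, he, heS⟩ := exists_enum S t
  rw [hS] at he heS
  have h4 : 4 ≤ 2 ^ (J + 1) := by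
    calc 4 = 2 ^ 2 := rfl
      _ ≤ _ := Nat.pow_le_pow_right (by norm_num) (by omega)
  have hR := heapCirc_cost he
  have hRS : e '' Set.Iio (J + 2 ^ (J + 1) - 2) = S := by
    ext q
    simp only [Set.mem_image, Set.mem_Iio, Finset.mem_coe, heS]
  rw [hRS] at hR
  set R := heapCirc e J
  set F : Finset W := (Finset.range J).image e with hF
  have hFS : F ⊆ S := by
    intro q hq
    obtain ⟨i, hi, rfl⟩ := Finset.mem_image.1 hq
    exact (heS _).2 ⟨i, by have := Finset.mem_range.1 hi; omega, rfl⟩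
  have hFc : F.card = J := by
    rw [hF, Finset.card_image_of_injOn, Finset.card_range]
    refine he.mono fun i hi => ?_
    have := Finset.mem_range.1 (Finset.mem_coe.1 hi)
    simp only [Set.mem_Iio]
    omega
  have htF : t ∉ F := fun h => ht (hFS h)
  have hgF : g ∉ F := fun h => hg (hFS h)
  have hqS : e J ∈ S := (heS _).2 ⟨J, by omega, rfl⟩
  have hqF : e J ∉ F := by
    intro h
    obtain ⟨i, hi, h⟩ := Finset.mem_image.1 h
    have hi := Finset.mem_range.1 hi
    have := he (by rw [Set.mem_Iio]; omega) (by rw [Set.mem_Iio]; omega) h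
    omega
  have hqt : e J ≠ t := fun h => ht (h ▸ hqS)
  have hqg : e J ≠ g := fun h => hg (h ▸ hqS)
  -- The control `e J` is not a root, so it can be lent as the dirty wire of `A`; the target `t` is
  -- lent to `B`.
  obtain ⟨A, hA, hA'⟩ := h1 W (insert g F) t (e J) (by rw [Finset.card_insert_of_notMem hgF, hFc])
    (by simp [hgt.symm, htF]) (by simp [hqg, hqF]) hqt
  obtain ⟨B, hB, hB'⟩ := h0 W F g t hFc hgF htF hgt.symm
  have hsub : (S : Set W) ⊆ S ∪ {t, g} := Set.subset_union_left
  have hAc : Cost A (S ∪ {t, g}) ℓ d := by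
    refine hA.mono ?_ le_rfl le_rfl
    intro x hx
    simp only [Set.mem_union, Finset.coe_insert, Set.mem_insert_iff, Set.mem_singleton_iff,
      Finset.mem_coe] at hx ⊢
    rcases hx with (rfl | hx) | rfl | rfl
    · simp
    · exact Or.inl (hFS hx)
    · simp
    · exact Or.inl hqS
  have hBc : Cost B (S ∪ {t, g}) ℓ d := by
    refine hB.mono ?_ le_rfl le_rfl
    intro x hx
    simp only [Set.mem_union, Set.mem_insert_iff, Set.mem_singleton_iff, Finset.mem_coe] at hx ⊢
    rcases hx with hx | rfl | rfl
    · exact Or.inl (hFS hx)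
    · simp
    · simp
  have hRc := hR.mono hsub le_rfl le_rfl
  have hX := (hRc.append hAc).append hRc.reverse
  refine ⟨(R ++ A ++ R.reverse) ++ B ++ (R ++ A ++ R.reverse) ++ B,
    (((hX.append hBc).append hX).append hBc).mono le_rfl (by omega) (by omega), ?_⟩
  intro s
  have hX' : ∀ s, act (R ++ A ++ R.reverse) s =
      xorAt t (s g && decide (∀ q ∈ F, act R s q = true)) s := by
    intro s
    rw [hR.act_conj_xorAt (by simpa using ht) hA']
    congr 1
    simp only [Finset.forall_mem_insert, Bool.decide_and]
    rw [hR.act_off s (by simpa using hg)]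
    simp
  rw [act_toggle (φ := fun s => decide (∀ q ∈ F, act R s q = true))
    (χ := fun s => decide (∀ q ∈ F, s q = true)) hgt hX' hB']
  · congr 1
    rw [← Bool.decide_and, decide_eq_decide]
    have hFall : ∀ s' : W → Bool, (∀ q ∈ F, s' q = true) ↔ ∀ i < J, s' (e i) = true := by
      intro s'
      simp [hF]
    have hSall : (∀ q ∈ S, s q = true) ↔ ∀ i < J + 2 ^ (J + 1) - 2, s (e i) = true := by
      simp only [heS]
      exact ⟨fun h i hi => h _ ⟨i, hi, rfl⟩, by rintro h q ⟨i, hi, rfl⟩; exact h i hi⟩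
    rw [hFall, hFall, hSall]
    constructor
    · rintro ⟨h1, h2⟩
      exact (act_heapCirc he h2).1 h1
    · intro h
      have h2 : ∀ i < J, s (e i) = true := fun i hi => h i (by omega)
      exact ⟨(act_heapCirc he h2).2 h, h2⟩
  · intro b s
    simp only [hR.act_xorAt (show g ∉ (S : Set W) by simpa using hg), xorAt_of_notMem hgF]
  · intro b s
    simp only [hR.act_xorAt (show t ∉ (S : Set W) by simpa using ht), xorAt_of_notMem htF]
  · intro b s; simp only [xorAt_of_notMem hgF]
  · intro b s; simp only [xorAt_of_notMem htF]

/-- Heaps give only special numbers of controls. For the numbers in between, the controls are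
covered by sets of `m` and `m - 1` elements; the second one gets `g` as an additional control. -/
theorem HasMCX.double {m k ℓ d : ℕ} (hm : HasMCX m ℓ d) (h1 : m ≤ k) (h2 : k < 2 * m) :
    HasMCX k (4 * ℓ) (4 * d) := by
  intro W _ S t g hS ht hg hgt
  obtain ⟨S₂, hS₂, hc₂⟩ := Finset.exists_subset_card_eq (s := S) (n := m) (by omega)
  obtain ⟨S₁, h1a, h1b, hc₁⟩ := Finset.exists_subsuperset_card_eq (s := S \ S₂) (t := S)
    (n := m - 1) Finset.sdiff_subset (by rw [Finset.card_sdiff_of_subset hS₂]; omega) (by omega)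
  -- A dirty wire for `A`; it exists because `S₁` has fewer elements than `S₂`.
  obtain ⟨q, hq, hq'⟩ : ∃ q ∈ S₂, q ∉ S₁ := by
    by_contra hcon
    push Not at hcon
    have := Finset.card_le_card (show S₂ ⊆ S₁ from hcon)
    omega
  have hU : S₁ ∪ S₂ = S := by
    apply subset_antisymm (Finset.union_subset h1b hS₂)
    intro x hx
    by_cases hx2 : x ∈ S₂
    · simp [hx2]
    · simp [h1a (show x ∈ S \ S₂ by simp [hx, hx2])]
  have hg1 : g ∉ S₁ := fun h => hg (h1b h)
  have ht1 : t ∉ S₁ := fun h => ht (h1b h)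
  have hg2 : g ∉ S₂ := fun h => hg (hS₂ h)
  have ht2 : t ∉ S₂ := fun h => ht (hS₂ h)
  obtain ⟨A, hA, hA'⟩ := hm W (insert g S₁) t q
    (by rw [Finset.card_insert_of_notMem hg1]; omega) (by simp [hgt.symm, ht1])
    (by simp only [Finset.mem_insert, not_or]; exact ⟨fun h => hg2 (h ▸ hq), hq'⟩)
    (fun h => ht2 (h ▸ hq))
  obtain ⟨B, hB, hB'⟩ := hm W S₂ g t hc₂ hg2 ht2 hgt.symm
  have hAc : Cost A (S ∪ {t, g}) ℓ d := by
    refine hA.mono ?_ le_rfl le_rfl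
    intro x hx
    simp only [Set.mem_union, Finset.coe_insert, Set.mem_insert_iff, Set.mem_singleton_iff,
      Finset.mem_coe] at hx ⊢
    rcases hx with (rfl | hx) | rfl | rfl
    · simp
    · exact Or.inl (h1b hx)
    · simp
    · exact Or.inl (hS₂ hq)
  have hBc : Cost B (S ∪ {t, g}) ℓ d := by
    refine hB.mono ?_ le_rfl le_rfl
    intro x hx
    simp only [Set.mem_union, Set.mem_insert_iff, Set.mem_singleton_iff, Finset.mem_coe] at hx ⊢
    rcases hx with hx | rfl | rfl
    · exact Or.inl (hS₂ hx)
    · simp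
    · simp
  refine ⟨A ++ B ++ A ++ B, (((hAc.append hBc).append hAc).append hBc).mono le_rfl
    (by omega) (by omega), ?_⟩
  rw [← hU]
  exact hA'.split hB' ht1 ht2 hg1 hg2 hgt

/-- With `J` of order `log k`, `HasMCX.heap` and `HasMCX.double` give the recursions `64 * 2 ^ J +
16 * ℓ (J + 1)` for the size and `96 * J + 16 * d (J + 1)` for the depth. The factor 16 is harmless
because the recursive terms are exponentially smaller once `J ≥ 512`. -/
theorem exists_hasMCX : ∃ A : ℕ, ∀ k, HasMCX k (A * (k + 1)) (A * (Nat.log 2 k + 1)) := by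
  have hlog : ∀ J, 512 ≤ J → 32 * (Nat.log 2 (J + 1) + 1) ≤ J := by
    intro J hJ
    have h1 := Nat.pow_log_le_self 2 (x := J + 1) (by omega)
    have h2 : 9 ≤ Nat.log 2 (J + 1) := Nat.le_log_of_pow_le (by norm_num) (by omega)
    have h3 : ∀ m, 9 ≤ m → 32 * (m + 1) + 1 ≤ 2 ^ m := by
      intro m hm
      induction m, hm using Nat.le_induction with
      | base => norm_num
      | succ m hm ih => rw [pow_succ]; omega
    have := h3 _ h2
    omega
  have hpow : ∀ J, 8 ≤ J → 16 * (J + 2) ≤ 2 ^ J := by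
    intro J hJ
    induction J, hJ using Nat.le_induction with
    | base => norm_num
    | succ m hm ih => rw [pow_succ]; omega
  obtain ⟨N, hN⟩ : ∃ N : ℕ, N = 512 + 2 ^ (512 + 1) - 2 := ⟨_, rfl⟩
  obtain ⟨B, hB⟩ := exists_hasMCX_of_lt N
  -- `B` covers the finitely many small `k`, and 192 pays for the nonrecursive terms.
  refine ⟨B + 192, fun k => ?_⟩
  set A := B + 192 with hA
  induction k using Nat.strong_induction_on with
  | _ k ih =>
  by_cases hk : k < N
  · exact (hB k hk).mono (by nlinarith) (by nlinarith [Nat.zero_le (Nat.log 2 k)])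
  have hex : ∃ J, 512 ≤ J ∧ J + 2 ^ (J + 1) - 2 ≤ k ∧ k < (J + 1) + 2 ^ (J + 1 + 1) - 2 := by
    have hmono : ∀ m, ∀ J, 512 ≤ J → J + 2 ^ (J + 1) - 2 ≤ k → k ≤ J + m →
        ∃ J, 512 ≤ J ∧ J + 2 ^ (J + 1) - 2 ≤ k ∧ k < (J + 1) + 2 ^ (J + 1 + 1) - 2 := by
      intro m
      induction m with
      | zero =>
        intro J h1 h2 h3
        have := Nat.pow_le_pow_right (n := 2) (by norm_num) (show 2 ≤ J + 1 by omega)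
        omega
      | succ m ihm =>
        intro J h1 h2 h3
        by_cases h : k < (J + 1) + 2 ^ (J + 1 + 1) - 2
        · exact ⟨J, h1, h2, h⟩
        · exact ihm (J + 1) (by omega) (by omega) (by omega)
    exact hmono k 512 le_rfl (by omega) (by omega)
  clear hN
  obtain ⟨J, hJ, h1, h2⟩ := hex
  have hp := hpow J (by omega)
  have hl := hlog J hJ
  have e1 : 2 ^ (J + 1) = 2 * 2 ^ J := by ring
  have e2 : 2 ^ (J + 1 + 1) = 4 * 2 ^ J := by ring
  have hlk : J + 1 ≤ Nat.log 2 k := Nat.le_log_of_pow_le (by norm_num) (by omega)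
  have hll : Nat.log 2 J ≤ Nat.log 2 (J + 1) := Nat.log_mono_right (by omega)
  have ih0 := ih J (by omega)
  have ih1 := ih (J + 1) (by omega)
  have := HasMCX.heap (by omega) (ih0.mono (ℓ' := A * (J + 2)) (d' := A * (Nat.log 2 (J + 1) + 1))
    (by nlinarith) (by nlinarith)) (ih1.mono (by nlinarith) le_rfl)
  refine (this.double h1 (by omega)).mono ?_ ?_
  · rw [e1]
    have : A * (16 * (J + 2)) ≤ A * 2 ^ J := Nat.mul_le_mul_left _ hp
    have h3 : A * (2 * 2 ^ J) ≤ A * (k + 1) := Nat.mul_le_mul_left _ (by omega)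
    have h4 : 64 * 2 ^ J ≤ A * 2 ^ J := Nat.mul_le_mul_right _ (by omega)
    nlinarith
  · have : A * (32 * (Nat.log 2 (J + 1) + 1)) ≤ A * J := Nat.mul_le_mul_left _ hl
    have h3 : A * J ≤ A * (Nat.log 2 k + 1) := Nat.mul_le_mul_left _ (by omega)
    have h4 : 192 * J ≤ A * J := Nat.mul_le_mul_right _ (by omega)
    nlinarith

/-! ### Permutations of a bounded number of bits -/

/-- The circuit permutes the strings on the wires `x` by `f` and preserves all other wires. -/
def Realizes {ι : Type*} (C : Circuit W) (x : ι → W) (f : (ι → Bool) → (ι → Bool)) : Prop :=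
  ∀ s, (∀ i, act C s (x i) = f (s ∘ x) i) ∧ ∀ w, w ∉ Set.range x → act C s w = s w

theorem Realizes.append {ι : Type*} {x : ι → W} {f f' : (ι → Bool) → (ι → Bool)}
    (h : Realizes C x f) (h' : Realizes D x f') : Realizes (C ++ D) x (f' ∘ f) := by
  intro s
  have : act C s ∘ x = f (s ∘ x) := funext fun i => (h s).1 i
  refine ⟨fun i => ?_, fun w hw => ?_⟩
  · rw [act_append, (h' _).1, this]; rfl
  · rw [act_append, (h' _).2 w hw, (h s).2 w hw]

/-- The two strings differ only at `i`. Negating the other positions where `a` is `0` turns the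
condition "agrees with `a` off `i`" into a conjunction, which controls the flip of `i`. The wire
`none` is the dirty wire. -/
theorem exists_realizes_swap_update (n : ℕ) (a : Fin n → Bool) (i : Fin n) :
    ∃ C : Circuit (Option (Fin n)),
      Realizes C some (Equiv.swap a (Function.update a i (!a i))) := by
  let I := (Finset.univ.filter fun j => j ≠ i ∧ a j = false).toList
  let R : Circuit (Option (Fin n)) := I.flatMap fun j => xg (some j)
  have hmem : ∀ j, j ∈ I ↔ j ≠ i ∧ a j = false := by intro j; simp [I]
  have hR : Cost R {w | w ≠ some i} (I.length * 1) 1 := by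
    refine Cost.parallel I _ (fun j => {some j}) 1 1 (fun j _ => Cost.xg _) ?_ ?_
    · refine (Finset.nodup_toList _).imp fun h => ?_
      simpa using h
    · intro j hj
      simpa using ((hmem j).1 hj).1
  have hRj : ∀ s j, j ≠ i → act R s (some j) = (s (some j) ^^ !a j) := by
    intro s j hj
    by_cases hjI : j ∈ I
    · rw [act_flatMap_on (d := 1) (ℓ := 1) I _ (fun j => {some j}) (fun j _ => Cost.xg _) ?_ s hjI
        (by simp)]
      · rw [act_xg, xorAt_same, ((hmem j).1 hjI).2, Bool.not_false]
      · refine (Finset.nodup_toList _).imp fun h => ?_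
        simpa using h
    · rw [act_flatMap_off (d := 1) (ℓ := 1) I _ (fun j => {some j}) (fun j _ => Cost.xg _)]
      · have : a j ≠ false := fun h => hjI ((hmem j).2 ⟨hj, h⟩)
        simp [Bool.eq_true_of_not_eq_false this]
      · intro k hk
        simp only [Set.mem_singleton_iff, Option.some.injEq]
        rintro rfl
        exact hjI hk
  obtain ⟨A, hA⟩ := exists_hasMCX
  obtain ⟨M, -, hM⟩ := hA _ _ ((Finset.univ.erase i).image some) (some i) none rfl
    (by simp) (by simp) (by simp)
  refine ⟨R ++ M ++ R.reverse, fun s => ?_⟩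
  rw [hR.act_conj_xorAt (by simp) hM]
  have hiff : (∀ q ∈ (Finset.univ.erase i).image some, act R s q = true) ↔
      ∀ j, j ≠ i → s (some j) = a j := by
    simp only [Finset.forall_mem_image, Finset.mem_erase, Finset.mem_univ, and_true]
    refine forall_congr' fun j => forall_congr' fun hj => ?_
    rw [hRj s j hj]
    cases s (some j) <;> cases a j <;> simp
  rw [decide_eq_decide.2 hiff]
  constructor
  · intro j
    by_cases hcond : ∀ j, j ≠ i → s (some j) = a j
    · have hs : s ∘ some = Function.update a i (s (some i)) := by
        ext j
        by_cases hj : j = i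
        · subst hj; simp
        · simp [hj, hcond j hj]
      rw [hs, decide_eq_true hcond]
      by_cases hsi : s (some i) = a i
      · rw [hsi, Function.update_eq_self, Equiv.swap_apply_left]
        by_cases hj : j = i
        · subst hj; simp [hsi]
        · simp [hj, hcond j hj]
      · have : s (some i) = !a i := by cases h : s (some i) <;> cases h' : a i <;> simp_all
        rw [this, Equiv.swap_apply_right]
        by_cases hj : j = i
        · subst hj; simp [this]
        · simp [hj, hcond j hj]
    · rw [decide_eq_false hcond, Equiv.swap_apply_of_ne_of_ne]
      · simp
      · intro h
        exact hcond fun j _ => congrFun h j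
      · intro h
        refine hcond fun j hj => ?_
        have := congrFun h j
        simpa [hj] using this
  · intro w hw
    cases w with
    | none => simp
    | some j => exact absurd ⟨j, rfl⟩ hw

/-- Induction on the Hamming distance: for `c` one step from `a` towards `b`, conjugating the swap
of `c` and `b` by that of `a` and `c` gives the swap of `a` and `b`. -/
theorem exists_realizes_swap (n : ℕ) (a b : Fin n → Bool) :
    ∃ C : Circuit (Option (Fin n)), Realizes C some (Equiv.swap a b) := by
  induction hd : hammingDist a b using Nat.strong_induction_on generalizing a b with
  | _ k ih =>
  by_cases hab : a = b
  · subst hab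
    exact ⟨[], fun s => ⟨fun i => by simp, fun w _ => rfl⟩⟩
  obtain ⟨i, hi⟩ := Function.ne_iff.1 hab
  set c := Function.update a i (!a i) with hc
  have hci : c i = b i := by
    rw [hc, Function.update_self]
    cases h : a i <;> cases h' : b i <;> simp_all
  obtain ⟨C, hC⟩ := exists_realizes_swap_update n a i
  rw [← hc] at hC
  by_cases hcb : c = b
  · exact ⟨C, by rw [← hcb]; exact hC⟩
  have hlt : hammingDist c b < k := by
    rw [← hd]
    refine Finset.card_lt_card ⟨fun j hj => ?_, fun h => ?_⟩
    · simp only [Finset.mem_filter, Finset.mem_univ, true_and] at hj ⊢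
      by_cases hji : j = i
      · subst hji; exact absurd hci hj
      · rwa [hc, Function.update_of_ne hji] at hj
    · have := h (show i ∈ _ by simpa using hi)
      simp [hci] at this
  obtain ⟨D, hD⟩ := ih _ hlt c b rfl
  have hac : c ≠ a := by
    intro h
    have := congrFun h i
    simp [hc] at this
  refine ⟨C ++ D ++ C, ?_⟩
  have := (hC.append hD).append hC
  rw [← Equiv.Perm.coe_mul, ← Equiv.Perm.coe_mul] at this
  rwa [← mul_assoc, Equiv.swap_comm a c, Equiv.swap_comm c b,
    Equiv.swap_mul_swap_mul_swap (Ne.symm hcb) (Ne.symm hab)] at this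

/-- Transpositions generate. The extra wire is essential: on `n ≥ 4` wires alone, all gates are even
permutations. -/
theorem exists_realizes_perm (n : ℕ) (σ : Equiv.Perm (Fin n → Bool)) :
    ∃ C : Circuit (Option (Fin n)), Realizes C some σ := by
  induction σ using Equiv.Perm.swap_induction_on with
  | one => exact ⟨[], fun s => ⟨fun i => rfl, fun w _ => rfl⟩⟩
  | swap_mul f a b _ ih =>
    obtain ⟨C, hC⟩ := ih
    obtain ⟨D, hD⟩ := exists_realizes_swap n a b
    exact ⟨C ++ D, by rw [Equiv.Perm.coe_mul]; exact hC.append hD⟩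

/-- Every permutation of `n`-bit strings, for fixed `n`, has constant cost with a dirty wire. -/
theorem exists_perm_circuit (n : ℕ) : ∃ A, ∀ (W : Type) [DecidableEq W] (x : Fin n → W) (g : W)
    (σ : Equiv.Perm (Fin n → Bool)), Function.Injective x → g ∉ Set.range x →
    ∃ C : Circuit W, Cost C (Set.range x ∪ {g}) A A ∧ Realizes C x σ := by
  choose F hF using exists_realizes_perm n
  refine ⟨Finset.univ.sup fun σ => (F σ).length, fun W _ x g σ hx hg => ?_⟩
  let f : Option (Fin n) ↪ W := ⟨fun o => o.elim g x, by
    rintro (_ | i) (_ | j) h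
    · rfl
    · exact absurd ⟨j, h.symm⟩ hg
    · exact absurd ⟨i, h⟩ hg
    · exact congrArg some (hx h)⟩
  have hle := Finset.le_sup (f := fun σ => (F σ).length) (Finset.mem_univ σ)
  have hc : Cost (F σ) Set.univ (F σ).length (F σ).length :=
    ⟨fun _ _ => Set.subset_univ _, le_rfl, by simpa using Sched.of_length ((F σ).map Gate.support)⟩
  refine ⟨mapCirc f (F σ), (hc.mapCirc f).mono ?_ hle hle, fun s => ⟨fun i => ?_, fun w hw => ?_⟩⟩
  · rintro _ ⟨_ | i, -, rfl⟩
    · exact Or.inr rfl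
    · exact Or.inl ⟨i, rfl⟩
  · have := act_mapCirc f (F σ) s (some i)
    refine this.trans ?_
    exact (hF σ (s ∘ f)).1 i
  · by_cases hwg : w = g
    · subst hwg
      have := act_mapCirc f (F σ) s none
      refine this.trans ?_
      exact (hF σ (s ∘ f)).2 none (by simp)
    · refine (hc.mapCirc f).act_off s ?_
      rintro ⟨_ | i, -, h⟩
      · exact hwg h.symm
      · exact hw ⟨i, h⟩

/-! ### Ladders: linear recurrences in logarithmic depth -/

/-- The solution of the recurrence `y (j + 1) = a (j + 1) ⊕ b j ∧ y j`, `y 0 = a 0`. -/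
def ladVal (b a : ℕ → Bool) : ℕ → Bool
  | 0 => a 0
  | j + 1 => a (j + 1) ^^ (b j && ladVal b a j)

theorem ladVal_congr {b a b' a' : ℕ → Bool} {j : ℕ} (hb : ∀ i < j, b i = b' i)
    (ha : ∀ i ≤ j, a i = a' i) : ladVal b a j = ladVal b' a' j := by
  induction j with
  | zero => exact ha 0 le_rfl
  | succ j ih =>
    rw [ladVal, ladVal, ha _ le_rfl, hb j (by omega),
      ih (fun i hi => hb i (by omega)) (fun i hi => ha i (by omega))]

/-- Composing consecutive pairs of steps gives a recurrence of the same shape, of half the length,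
for the values at odd indices. -/
theorem ladVal_odd (b a : ℕ → Bool) (t : ℕ) :
    ladVal (fun t => b (2 * t + 1) && b (2 * t + 2))
      (fun t => a (2 * t + 1) ^^ (b (2 * t) && a (2 * t))) t = ladVal b a (2 * t + 1) := by
  induction t with
  | zero => rfl
  | succ t ih =>
    have h : ladVal b a (2 * (t + 1) + 1) = (a (2 * t + 3) ^^ (b (2 * t + 2) &&
      (a (2 * t + 2) ^^ (b (2 * t + 1) && ladVal b a (2 * t + 1))))) := rfl
    rw [h, ladVal, ih, show 2 * (t + 1) + 1 = 2 * t + 3 by ring,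
      show 2 * (t + 1) = 2 * t + 2 by ring]
    cases a (2 * t + 3) <;> cases b (2 * t + 2) <;> cases b (2 * t + 1) <;>
      cases a (2 * t + 2) <;> cases ladVal b a (2 * t + 1) <;> rfl

section Ladder

variable {K A δ : ℕ} {r : ℕ → W} {Z : ℕ → Set W} {P : ℕ → ℕ → (W → Bool) → Bool}

/-- The interval operations of a ladder, on the disjoint pieces `[m (2t + c), m (2t + c + 1)]`. -/
theorem exists_ladder_stage (hr : ∀ i < K, r i ∈ Z i)
    (hZ : ∀ i < K, ∀ j < K, i ≠ j → Disjoint (Z i) (Z j))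
    (hop : ∀ u v, u < v → v < K → ∃ C : Circuit W,
      Cost C (⋃ i ∈ Set.Icc u v, Z i) (A * (v - u + 1)) δ ∧
        ∀ s, act C s = xorAt (r v) (s (r u) && P u v s) s)
    (p : ℕ → ℕ) (m N c : ℕ) (hp : ∀ j, p (j + 1) = p j + m) (hm : 1 ≤ m)
    (hN : ∀ t < N, p (2 * t + c + 1) < K) :
    ∃ C : Circuit W, Cost C (⋃ i ∈ Set.Iio K, Z i) (N * (A * (m + 1))) δ ∧ ∀ s,
      (∀ t < N, act C s (r (p (2 * t + c + 1))) = (s (r (p (2 * t + c + 1))) ^^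
        (s (r (p (2 * t + c))) && P (p (2 * t + c)) (p (2 * t + c + 1)) s))) ∧
      ∀ w, (∀ t < N, w ≠ r (p (2 * t + c + 1))) → act C s w = s w := by
  have hpmono : StrictMono p := strictMono_nat_of_lt_succ fun j => by rw [hp]; omega
  have hex : ∀ t, ∃ C : Circuit W, t < N →
      Cost C (⋃ i ∈ Set.Icc (p (2 * t + c)) (p (2 * t + c + 1)), Z i) (A * (m + 1)) δ ∧
        ∀ s, act C s = xorAt (r (p (2 * t + c + 1)))
          (s (r (p (2 * t + c))) && P (p (2 * t + c)) (p (2 * t + c + 1)) s) s := by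
    intro t
    by_cases ht : t < N
    · obtain ⟨C, h1, h2⟩ := hop _ _ (hpmono (Nat.lt_succ_self (2 * t + c))) (hN t ht)
      refine ⟨C, fun _ => ⟨h1.mono le_rfl (le_of_eq ?_) le_rfl, h2⟩⟩
      rw [Nat.succ_eq_add_one, hp]
      congr 2
      omega
    · exact ⟨[], fun h => absurd h ht⟩
  choose F hF using hex
  have hdisj : (List.range N).Pairwise fun t t' =>
      Disjoint (⋃ i ∈ Set.Icc (p (2 * t + c)) (p (2 * t + c + 1)), Z i)
        (⋃ i ∈ Set.Icc (p (2 * t' + c)) (p (2 * t' + c + 1)), Z i) := by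
    refine List.pairwise_lt_range.imp_of_mem fun {t t'} ht ht' htt => ?_
    rw [List.mem_range] at ht ht'
    simp only [Set.disjoint_iUnion_left, Set.disjoint_iUnion_right]
    intro j hj i hi
    have h1 : p (2 * t + c + 1) < p (2 * t' + c) := hpmono (by omega)
    have h2 := hN t' ht'
    obtain ⟨-, hi⟩ := hi
    obtain ⟨hj, hj'⟩ := hj
    exact hZ i (by omega) j (by omega) (by omega)
  have hcost : ∀ t ∈ List.range N, Cost (F t)
      (⋃ i ∈ Set.Icc (p (2 * t + c)) (p (2 * t + c + 1)), Z i) (A * (m + 1)) δ :=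
    fun t ht => (hF t (List.mem_range.1 ht)).1
  refine ⟨(List.range N).flatMap F, ?_, fun s => ⟨fun t ht => ?_, fun w hw => ?_⟩⟩
  · have := Cost.parallel (T := ⋃ i ∈ Set.Iio K, Z i) _ F _ _ _ hcost hdisj ?_
    · rwa [List.length_range] at this
    · intro t ht x hx
      have := hN t (List.mem_range.1 ht)
      simp only [Set.mem_iUnion] at hx ⊢
      obtain ⟨i, hi, hx⟩ := hx
      exact ⟨i, by have := hi.2; simp only [Set.mem_Iio]; omega, hx⟩
  · rw [act_flatMap_on _ F _ hcost hdisj s (List.mem_range.2 ht), (hF t ht).2, xorAt_same]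
    simp only [Set.mem_iUnion]
    exact ⟨_, ⟨(hpmono (Nat.lt_succ_self _)).le, le_rfl⟩, hr _ (hN t ht)⟩
  · by_cases hwt : ∃ t < N, w ∈ ⋃ i ∈ Set.Icc (p (2 * t + c)) (p (2 * t + c + 1)), Z i
    · obtain ⟨t, ht, hwt⟩ := hwt
      rw [act_flatMap_on _ F _ hcost hdisj s (List.mem_range.2 ht) hwt, (hF t ht).2,
        xorAt_of_ne (hw t ht)]
    · push Not at hwt
      exact act_flatMap_off _ F _ hcost s fun t ht => hwt t (List.mem_range.1 ht)

/-- Cyclic reduction in place. A first stage adds to each odd position the contribution of its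
predecessor, recursion on the odd positions (with twice the stride) makes them final, and a last
stage completes the even positions. Each stage acts on disjoint intervals, hence in parallel. -/
theorem exists_ladder_stride (hr : ∀ i < K, r i ∈ Z i)
    (hZ : ∀ i < K, ∀ j < K, i ≠ j → Disjoint (Z i) (Z j))
    (hmul : ∀ u v x s, u < v → v < x → P u x s = (P u v s && P v x s))
    (hP : ∀ u v s s', v < K → (∀ w, (∀ j < K, w ≠ r j) → s w = s' w) → P u v s = P u v s')
    (hop : ∀ u v, u < v → v < K → ∃ C : Circuit W,
      Cost C (⋃ i ∈ Set.Icc u v, Z i) (A * (v - u + 1)) δ ∧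
        ∀ s, act C s = xorAt (r v) (s (r u) && P u v s) s)
    (M : ℕ) : ∀ (p : ℕ → ℕ) (m : ℕ), (∀ j, p (j + 1) = p j + m) → 1 ≤ m → (∀ j < M, p j < K) →
      m * M ≤ K →
    ∃ C : Circuit W, Cost C (⋃ i ∈ Set.Iio K, Z i) (2 * A * K * Nat.log 2 M)
        (2 * δ * Nat.log 2 M) ∧ ∀ s,
      (∀ j < M, act C s (r (p j)) =
        ladVal (fun j => P (p j) (p (j + 1)) s) (fun j => s (r (p j))) j) ∧
      ∀ w, (∀ j < M, w ≠ r (p j)) → act C s w = s w := by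
  have hrinj : ∀ i < K, ∀ j < K, r i = r j → i = j := by
    intro i hi j hj h
    by_contra hij
    exact Set.disjoint_left.1 (hZ i hi j hj hij) (hr i hi) (h ▸ hr j hj)
  induction M using Nat.strong_induction_on with
  | _ M ih =>
  intro p m hp hm hM hmM
  by_cases hM1 : M ≤ 1
  · refine ⟨[], Cost.nil _ _ _, fun s => ⟨fun j hj => ?_, fun w _ => rfl⟩⟩
    obtain rfl : j = 0 := by omega
    rfl
  have hpmono : StrictMono p := strictMono_nat_of_lt_succ fun j => by rw [hp]; omega
  obtain ⟨C₁, hC₁, h1⟩ := exists_ladder_stage hr hZ hop p m (M / 2) 0 hp hm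
    fun t ht => hM _ (by omega)
  obtain ⟨C₃, hC₃, h3⟩ := exists_ladder_stage hr hZ hop p m ((M - 1) / 2) 1 hp hm
    fun t ht => hM _ (by omega)
  obtain ⟨C₂, hC₂, h2⟩ := ih (M / 2) (by omega) (fun t => p (2 * t + 1)) (2 * m)
    (fun t => by rw [show 2 * (t + 1) + 1 = 2 * t + 1 + 1 + 1 by ring, hp, hp]; ring) (by omega)
    (fun t ht => hM _ (by omega)) (by
      have h2 : 2 * (M / 2) ≤ M := Nat.mul_div_le M 2
      nlinarith)
  have hlog : Nat.log 2 M = Nat.log 2 (M / 2) + 1 := Nat.log_of_one_lt_of_le (by norm_num) (by omega)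
  -- As `m ≥ 1`, `N` intervals of `m + 1` cells count at most `2 * N * m ≤ M * m ≤ K` cells.
  have hc : ∀ N, 2 * N ≤ M → N * (A * (m + 1)) ≤ A * K := by
    intro N hN
    have h1 : N * (m + 1) ≤ K := by nlinarith
    calc N * (A * (m + 1)) = A * (N * (m + 1)) := by ring
      _ ≤ _ := Nat.mul_le_mul_left _ h1
  refine ⟨C₁ ++ C₂ ++ C₃, ((hC₁.append hC₂).append hC₃).mono le_rfl ?_ ?_, fun s => ?_⟩
  · rw [hlog]
    have e1 := hc (M / 2) (by omega)
    have e2 := hc ((M - 1) / 2) (by omega)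
    calc _ ≤ A * K + 2 * A * K * Nat.log 2 (M / 2) + A * K := by gcongr
      _ = _ := by ring
  · rw [hlog]
    apply le_of_eq
    ring
  obtain ⟨h1a, h1b⟩ := h1 s
  obtain ⟨h2a, h2b⟩ := h2 (act C₁ s)
  obtain ⟨h3a, h3b⟩ := h3 (act C₂ (act C₁ s))
  have o1 : ∀ w, (∀ j < M, w ≠ r (p j)) → act C₁ s w = s w :=
    fun w hw => h1b w fun t ht => hw _ (by omega)
  have o2 : ∀ w, (∀ j < M, w ≠ r (p j)) → act C₂ (act C₁ s) w = s w :=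
    fun w hw => (h2b w fun t ht => hw _ (by omega)).trans (o1 w hw)
  have hP1 : ∀ u v, v < K → P u v (act C₁ s) = P u v s := fun u v hv =>
    hP u v _ _ hv fun w hw => o1 w fun j hj => hw _ (hM j hj)
  have hP2 : ∀ u v, v < K → P u v (act C₂ (act C₁ s)) = P u v s := fun u v hv =>
    hP u v _ _ hv fun w hw => o2 w fun j hj => hw _ (hM j hj)
  have rne : ∀ i j, i < M → j < M → i ≠ j → r (p i) ≠ r (p j) := fun i j hi hj hij h =>
    hij (hpmono.injective (hrinj _ (hM i hi) _ (hM j hj) h))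
  simp only [act_append]
  -- The recursive call runs on the state left by the first stage, whose odd entries are the
  -- coefficients of the reduced recurrence of `ladVal_odd`.
  have hodd : ∀ t, 2 * t + 1 < M → act C₂ (act C₁ s) (r (p (2 * t + 1))) =
      ladVal (fun j => P (p j) (p (j + 1)) s) (fun j => s (r (p j))) (2 * t + 1) := by
    intro t ht
    rw [h2a t (by omega), ← ladVal_odd]
    refine ladVal_congr (fun i hi => ?_) fun i hi => ?_
    · rw [hP1 _ _ (hM _ (by omega))]
      exact hmul _ _ _ _ (hpmono (by omega)) (hpmono (by omega))
    · have := h1a i (by omega)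
      simp only [Nat.add_zero] at this
      rw [this, Bool.and_comm]
  have heven : ∀ t, 2 * t < M → act C₂ (act C₁ s) (r (p (2 * t))) = s (r (p (2 * t))) := by
    intro t ht
    rw [h2b _ fun t' ht' => rne _ _ ht (by omega) (by omega),
      h1b _ fun t' ht' => rne _ _ ht (by omega) (by omega)]
  refine ⟨fun j hj => ?_, fun w hw => ?_⟩
  · rcases Nat.even_or_odd' j with ⟨t, rfl | rfl⟩
    · rcases t with _ | t
      · rw [h3b _ fun t' ht' => rne _ _ hj (by omega) (by omega), heven 0 hj]
        rfl
      · have := h3a t (by omega)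
        rw [show 2 * (t + 1) = 2 * t + 1 + 1 by ring] at hj ⊢
        have he := heven (t + 1) (by omega)
        rw [show 2 * (t + 1) = 2 * t + 1 + 1 by ring] at he
        rw [this, hodd t (by omega), hP2 _ _ (hM _ hj), he]
        exact congrArg _ (Bool.and_comm _ _)
    · rw [h3b _ fun t' ht' => rne _ _ hj (by omega) (by omega), hodd t hj]
  · rw [h3b _ fun t ht => hw _ (by omega), o2 w hw]

theorem exists_ladder (hr : ∀ i < K, r i ∈ Z i)
    (hZ : ∀ i < K, ∀ j < K, i ≠ j → Disjoint (Z i) (Z j))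
    (hmul : ∀ u v x s, u < v → v < x → P u x s = (P u v s && P v x s))
    (hP : ∀ u v s s', v < K → (∀ w, (∀ j < K, w ≠ r j) → s w = s' w) → P u v s = P u v s')
    (hop : ∀ u v, u < v → v < K → ∃ C : Circuit W,
      Cost C (⋃ i ∈ Set.Icc u v, Z i) (A * (v - u + 1)) δ ∧
        ∀ s, act C s = xorAt (r v) (s (r u) && P u v s) s) :
    ∃ C : Circuit W, Cost C (⋃ i ∈ Set.Iio K, Z i) (2 * A * K * Nat.log 2 K)
        (2 * δ * Nat.log 2 K) ∧ ∀ s,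
      (∀ j < K, act C s (r j) = ladVal (fun j => P j (j + 1) s) (fun j => s (r j)) j) ∧
      ∀ w, (∀ j < K, w ≠ r j) → act C s w = s w :=
  exists_ladder_stride hr hZ hmul hP hop K id 1 (fun _ => rfl) le_rfl (fun _ h => h) (by simp)

end Ladder

/-! ### Cells: a base-8 digit and two dirty wires -/

/-- The bits of a base-8 digit, and a carry bit. -/
def digitEquiv : (Fin 4 → Bool) ≃ Fin 8 × Bool where
  toFun f := (⟨(f 0).toNat + 2 * (f 1).toNat + 4 * (f 2).toNat, by
    cases f 0 <;> cases f 1 <;> cases f 2 <;> decide⟩, f 3)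
  invFun p := ![p.1.val.testBit 0, p.1.val.testBit 1, p.1.val.testBit 2, p.2]
  left_inv := by decide
  right_inv := by decide

theorem digitEquiv_two (f : Fin 4 → Bool) : f 2 = decide (4 ≤ (digitEquiv f).1) := by
  revert f; decide

/-- Wires of `K` cells: three digit wires, a carry wire and a spare wire each. -/
def Cells (w : ℕ → Fin 5 → W) (K : ℕ) : Prop :=
  ∀ i < K, ∀ j < K, ∀ a b, w i a = w j b → i = j ∧ a = b

/-- The digit and the carry bit of a cell. -/
def view (w : ℕ → Fin 5 → W) (s : W → Bool) (i : ℕ) : Fin 8 × Bool :=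
  digitEquiv fun a => s (w i a.castSucc)

theorem view_two (w : ℕ → Fin 5 → W) (s : W → Bool) (i : ℕ) :
    s (w i 2) = decide (4 ≤ (view w s i).1) :=
  digitEquiv_two fun a => s (w i a.castSucc)

theorem view_three (w : ℕ → Fin 5 → W) (s : W → Bool) (i : ℕ) : s (w i 3) = (view w s i).2 := rfl

theorem view_congr {w : ℕ → Fin 5 → W} {s s' : W → Bool} {i : ℕ}
    (h : ∀ a : Fin 4, s (w i a.castSucc) = s' (w i a.castSucc)) : view w s i = view w s' i := by
  rw [view, view, funext h]

theorem view_fst_congr {w : ℕ → Fin 5 → W} {s s' : W → Bool} {i : ℕ}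
    (h : ∀ a : Fin 5, a < 3 → s (w i a) = s' (w i a)) : (view w s i).1 = (view w s' i).1 := by
  have h0 := h 0 (by decide)
  have h1 := h 1 (by decide)
  have h2 := h 2 (by decide)
  have e0 : (0 : Fin 4).castSucc = (0 : Fin 5) := rfl
  have e1 : (1 : Fin 4).castSucc = (1 : Fin 5) := rfl
  have e2 : (2 : Fin 4).castSucc = (2 : Fin 5) := rfl
  simp only [view, digitEquiv, Equiv.coe_fn_mk, e0, e1, e2, h0, h1, h2]

theorem Cells.disjoint {w : ℕ → Fin 5 → W} {K : ℕ} (hw : Cells w K) :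
    ∀ i < K, ∀ j < K, i ≠ j → Disjoint (Set.range (w i)) (Set.range (w j)) := by
  intro i hi j hj hij
  rw [Set.disjoint_left]
  rintro _ ⟨a, rfl⟩ ⟨b, h⟩
  exact hij (hw _ hi _ hj _ _ h.symm).1

theorem Cells.ne {w : ℕ → Fin 5 → W} {K : ℕ} (hw : Cells w K) {i j : ℕ} (hi : i < K) (hj : j < K)
    {a b : Fin 5} (h : i ≠ j ∨ a ≠ b) : w i a ≠ w j b := by
  intro he
  have := hw i hi j hj a b he
  tauto

/-- The wires of the cells in a set. -/
def cellWires (w : ℕ → Fin 5 → W) (I : Set ℕ) : Set W := ⋃ i ∈ I, Set.range (w i)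

theorem mem_cellWires {w : ℕ → Fin 5 → W} {I : Set ℕ} {x : W} :
    x ∈ cellWires w I ↔ ∃ i ∈ I, ∃ a, w i a = x := by
  simp [cellWires]

theorem cellWires_mono {w : ℕ → Fin 5 → W} {I J : Set ℕ} (h : I ⊆ J) :
    cellWires w I ⊆ cellWires w J := Set.biUnion_mono h fun _ _ => le_rfl

/-- Constant-size permutations of disjoint groups of four wires. -/
theorem exists_parallel_perm : ∃ A : ℕ, ∀ (W : Type) [DecidableEq W] (I : List ℕ)
    (x : ℕ → Fin 4 → W) (g : ℕ → W) (T : Set W) (φ : ℕ → Equiv.Perm (Fin 8 × Bool)),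
    (∀ i ∈ I, Function.Injective (x i)) → (∀ i ∈ I, g i ∉ Set.range (x i)) →
    (I.Pairwise fun i j =>
      Disjoint (Set.range (x i) ∪ {g i}) (Set.range (x j) ∪ {g j})) →
    (∀ i ∈ I, Set.range (x i) ∪ {g i} ⊆ T) →
    ∃ C : Circuit W, Cost C T (I.length * A) A ∧ ∀ s,
      (∀ i ∈ I, digitEquiv (act C s ∘ x i) = φ i (digitEquiv (s ∘ x i))) ∧
      ∀ w, (∀ i ∈ I, ∀ a, w ≠ x i a) → act C s w = s w := by
  obtain ⟨A, hA⟩ := exists_perm_circuit 4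
  refine ⟨A, fun W _ I x g T φ hx hg hd hT => ?_⟩
  have hex : ∀ i, ∃ C : Circuit W, i ∈ I → Cost C (Set.range (x i) ∪ {g i}) A A ∧
      Realizes C (x i) ((digitEquiv.trans (φ i)).trans digitEquiv.symm) := by
    intro i
    by_cases hi : i ∈ I
    · obtain ⟨C, h⟩ := hA W (x i) (g i) ((digitEquiv.trans (φ i)).trans digitEquiv.symm)
        (hx i hi) (hg i hi)
      exact ⟨C, fun _ => h⟩
    · exact ⟨[], fun h => absurd h hi⟩
  choose F hF using hex
  refine ⟨I.flatMap F, Cost.parallel I F _ A A (fun i hi => (hF i hi).1) hd hT,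
    fun s => ⟨fun i hi => ?_, fun w hw => ?_⟩⟩
  · have : act (I.flatMap F) s ∘ x i = digitEquiv.symm (φ i (digitEquiv (s ∘ x i))) := by
      ext a
      rw [Function.comp_apply, act_flatMap_on I F _ (fun i hi => (hF i hi).1) hd s hi
        (Or.inl ⟨a, rfl⟩), ((hF i hi).2 s).1]
      rfl
    rw [this, Equiv.apply_symm_apply]
  · by_cases h : ∃ i ∈ I, w ∈ Set.range (x i) ∪ {g i}
    · obtain ⟨i, hi, hwi⟩ := h
      rw [act_flatMap_on I F _ (fun i hi => (hF i hi).1) hd s hi hwi]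
      refine ((hF i hi).2 s).2 w ?_
      rintro ⟨a, rfl⟩
      exact hw i hi a rfl
    · push Not at h
      exact act_flatMap_off I F _ (fun i hi => (hF i hi).1) s h

/-- The spare wire of each cell is the dirty wire for the permutation of the other four. -/
theorem exists_cellOp : ∃ A : ℕ, ∀ (W : Type) [DecidableEq W] (w : ℕ → Fin 5 → W) (K : ℕ),
    Cells w K → ∀ (φ : ℕ → Equiv.Perm (Fin 8 × Bool)) (u v : ℕ), v ≤ K →
    ∃ C : Circuit W, Cost C (cellWires w (Set.Ico u v)) (A * (v - u)) A ∧ ∀ s,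
      (∀ i, u ≤ i → i < v → view w (act C s) i = φ i (view w s i)) ∧
      ∀ x, (∀ i, u ≤ i → i < v → ∀ a : Fin 4, x ≠ w i a.castSucc) → act C s x = s x := by
  obtain ⟨A, hA⟩ := exists_parallel_perm
  refine ⟨A, fun W _ w K hw φ u v hv => ?_⟩
  have hsub : ∀ i, Set.range (fun a : Fin 4 => w i a.castSucc) ∪ {w i 4} ⊆ Set.range (w i) := by
    rintro i x (⟨a, rfl⟩ | rfl)
    exacts [⟨_, rfl⟩, ⟨_, rfl⟩]
  have hmem : ∀ i, i ∈ List.range' u (v - u) ↔ u ≤ i ∧ i < v := by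
    intro i
    rw [List.mem_range'_1]
    omega
  have hinj : ∀ i ∈ List.range' u (v - u), Function.Injective fun a : Fin 4 => w i a.castSucc := by
    intro i hi a b hab
    have := (hmem i).1 hi
    exact Fin.castSucc_injective _ (hw i (by omega) i (by omega) _ _ hab).2
  have hg : ∀ i ∈ List.range' u (v - u), w i 4 ∉ Set.range fun a : Fin 4 => w i a.castSucc := by
    rintro i hi ⟨a, h⟩
    have := (hmem i).1 hi
    have := (hw i (by omega) i (by omega) _ _ h).2
    exact absurd this (Fin.castSucc_lt_last a).ne
  obtain ⟨C, h1, h2⟩ := hA W (List.range' u (v - u)) (fun i a => w i a.castSucc) (fun i => w i 4)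
    (cellWires w (Set.Ico u v)) φ hinj hg
    ((List.nodup_range' (s := u) (n := v - u)).imp_of_mem fun {i j} hi hj hij => by
      have := (hmem i).1 hi
      have := (hmem j).1 hj
      exact (hw.disjoint i (by omega) j (by omega) hij).mono (hsub i) (hsub j))
    (by
      intro i hi x hx
      obtain ⟨a, rfl⟩ := hsub i hx
      exact mem_cellWires.2 ⟨i, (hmem i).1 hi, a, rfl⟩)
  refine ⟨C, h1.mono le_rfl (by rw [List.length_range', mul_comm]) le_rfl, fun s => ⟨?_, ?_⟩⟩
  · exact fun i hi1 hi2 => (h2 s).1 i ((hmem i).2 ⟨hi1, hi2⟩)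
  · exact fun x hx => (h2 s).2 x fun i hi => hx i ((hmem i).1 hi).1 ((hmem i).1 hi).2

/-- A set of digits of the form `ν⁻¹ {4, …, 7} ∩ ν'⁻¹ {4, …, 7}`. -/
def pairInd (ν ν' : Equiv.Perm (Fin 8)) (X : Fin 8) : Bool := decide (4 ≤ ν X) && decide (4 ≤ ν' X)

/-- A set of exactly four digits can be tested without workspace: permute the digit so that the set
becomes `{4, …, 7}` and read the top bit. A smaller set is the intersection of two sets of four: one
superset `E`, and another one chosen inside the union of the set with the complement of `E`. -/
theorem exists_pairInd (β : Fin 8 → Bool) (h : (Finset.univ.filter fun X => β X = true).card ≤ 4) :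
    ∃ ν ν', β = pairInd ν ν' := by
  set E₀ := Finset.univ.filter fun X => β X = true with hE₀
  have hperm : ∀ E : Finset (Fin 8), E.card = 4 → ∃ ν : Equiv.Perm (Fin 8), ∀ X, X ∈ E ↔ 4 ≤ ν X := by
    intro E hE
    have hc : Fintype.card {X // X ∈ E} = Fintype.card {X : Fin 8 // 4 ≤ X} := by
      rw [Fintype.card_coe, hE]; rfl
    let e := Fintype.equivOfCardEq hc
    refine ⟨e.extendSubtype, fun X => ⟨e.extendSubtype_mem X, fun hX => ?_⟩⟩
    by_contra hcon
    exact e.extendSubtype_not_mem X hcon hX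
  obtain ⟨E, hE1, hE2⟩ := Finset.exists_superset_card_eq (n := 4) h (by simp)
  have hcard : (E₀ ∪ Eᶜ).card = E₀.card + 4 := by
    rw [Finset.card_union_of_disjoint, Finset.card_compl, hE2]
    · rfl
    · exact disjoint_compl_right.mono_left hE1
  obtain ⟨E', hE1', hE3', hE2'⟩ := Finset.exists_subsuperset_card_eq (s := E₀) (t := E₀ ∪ Eᶜ)
    (n := 4) Finset.subset_union_left h (by omega)
  obtain ⟨ν, hν⟩ := hperm E hE2
  obtain ⟨ν', hν'⟩ := hperm E' hE2'
  refine ⟨ν, ν', funext fun X => ?_⟩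
  rw [pairInd, ← Bool.decide_and, Bool.eq_iff_iff, decide_eq_true_iff, ← hν, ← hν']
  constructor
  · intro hX
    have : X ∈ E₀ := by simp [hE₀, hX]
    exact ⟨hE1 this, hE1' this⟩
  · rintro ⟨h1, h2⟩
    have := hE3' h2
    simp only [Finset.mem_union, Finset.mem_compl, h1, not_true_eq_false, or_false] at this
    simpa [hE₀] using this

theorem log_mul_two_le (K : ℕ) : Nat.log 2 (2 * K) ≤ Nat.log 2 K + 1 := by
  rcases Nat.eq_zero_or_pos K with rfl | hK
  · simp
  · rw [mul_comm, Nat.log_mul_base (by norm_num) (by omega)]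

/-- The interval operation of the ladder of carries. -/
theorem exists_intervalOp : ∃ A : ℕ, ∀ (W : Type) [DecidableEq W] (w : ℕ → Fin 5 → W) (K : ℕ),
    Cells w K → ∀ (ν ν' : ℕ → Equiv.Perm (Fin 8)) (u v : ℕ), u < v → v < K →
    ∃ C : Circuit W, Cost C (cellWires w (Set.Icc u v)) (A * (v - u + 1)) (A * (Nat.log 2 K + 1)) ∧
      ∀ s, act C s = xorAt (w v 3) (s (w u 3) && decide (∀ i, u ≤ i → i < v →
        pairInd (ν i) (ν' i) (view w s i).1 = true)) s := by
  obtain ⟨A₁, hA₁⟩ := exists_cellOp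
  obtain ⟨A₂, hA₂⟩ := exists_hasMCX
  refine ⟨8 * A₁ + 8 * A₂, fun W _ w K hw ν ν' u v huv hv => ?_⟩
  have hne : ∀ {i j : ℕ}, i < K → j < K → ∀ {a b : Fin 5}, i ≠ j ∨ a ≠ b → w i a ≠ w j b :=
    fun hi hj _ _ h => hw.ne hi hj h
  -- After `N` (or `N'`) the first (or second) half of the test of each digit sits on wire 2 of its
  -- cell, so each half is a multiply controlled gate conjugated by cell permutations.
  obtain ⟨N, hN, hNs⟩ := hA₁ W w K hw (fun i => (ν i).prodCongr (Equiv.refl _)) u v hv.le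
  obtain ⟨N', hN', hNs'⟩ := hA₁ W w K hw (fun i => (ν' i).prodCongr (Equiv.refl _)) u v hv.le
  set Q : Finset W := (Finset.Ico u v).image fun i => w i 2 with hQ
  have hQc : Q.card ≤ v - u := Finset.card_image_le.trans (by simp)
  have hnotQ : ∀ j < K, ∀ a, a ≠ 2 → w j a ∉ Q := by
    intro j hj a ha h
    obtain ⟨i, hi, h⟩ := Finset.mem_image.1 h
    have := Finset.mem_Ico.1 hi
    exact hne (by omega) hj (Or.inr (Ne.symm ha)) h
  -- The spare wire `w v 4` is the one toggled between the two halves, and the digit wire `w u 0` is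
  -- the dirty wire of this gate.
  obtain ⟨M₁, hM₁, hMs₁⟩ := hA₂ _ W (insert (w u 3) (insert (w v 4) Q)) (w v 3) (w u 0) rfl
    (by
      simp only [Finset.mem_insert, not_or]
      exact ⟨hne hv (by omega) (Or.inl (by omega)), hne hv hv (Or.inr (by decide)),
        hnotQ v hv 3 (by decide)⟩)
    (by
      simp only [Finset.mem_insert, not_or]
      exact ⟨hne (by omega) (by omega) (Or.inr (by decide)),
        hne (by omega) hv (Or.inr (by decide)), hnotQ u (by omega) 0 (by decide)⟩)
    (hne (by omega) hv (Or.inr (by decide)))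
  obtain ⟨M₂, hM₂, hMs₂⟩ := hA₂ _ W Q (w v 4) (w v 3) rfl (hnotQ v hv 4 (by decide))
    (hnotQ v hv 3 (by decide)) (hne hv hv (Or.inr (by decide)))
  have hvnot : ∀ a, w v a ∉ cellWires w (Set.Ico u v) := by
    intro a h
    obtain ⟨i, hi, b, h⟩ := mem_cellWires.1 h
    have := hi.2
    exact hne (by omega) hv (Or.inl (by omega)) h
  have hsub : cellWires w (Set.Ico u v) ⊆ cellWires w (Set.Icc u v) :=
    cellWires_mono Set.Ico_subset_Icc_self
  have hQsub : ∀ x ∈ Q, x ∈ cellWires w (Set.Icc u v) := by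
    intro x hx
    obtain ⟨i, hi, rfl⟩ := Finset.mem_image.1 hx
    have := Finset.mem_Ico.1 hi
    exact mem_cellWires.2 ⟨i, ⟨this.1, this.2.le⟩, 2, rfl⟩
  have hu : ∀ a, w u a ∈ cellWires w (Set.Icc u v) := fun a =>
    mem_cellWires.2 ⟨u, ⟨le_rfl, huv.le⟩, a, rfl⟩
  have hv' : ∀ a, w v a ∈ cellWires w (Set.Icc u v) := fun a =>
    mem_cellWires.2 ⟨v, ⟨huv.le, le_rfl⟩, a, rfl⟩
  have hlog : ∀ m, m ≤ v - u + 2 → Nat.log 2 m + 1 ≤ Nat.log 2 K + 2 := by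
    intro m hm
    have h1 : Nat.log 2 m ≤ Nat.log 2 (2 * K) := Nat.log_mono_right (by omega)
    have := log_mul_two_le K
    omega
  have hMc₁ : Cost M₁ (cellWires w (Set.Icc u v)) (A₂ * (v - u + 3)) (A₂ * (Nat.log 2 K + 2)) := by
    have hc : (insert (w u 3) (insert (w v 4) Q)).card ≤ v - u + 2 :=
      (Finset.card_insert_le _ _).trans
        (by have := Finset.card_insert_le (w v 4) Q; omega)
    refine hM₁.mono ?_ (Nat.mul_le_mul_left _ (by omega)) (Nat.mul_le_mul_left _ (hlog _ hc))
    intro x hx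
    simp only [Finset.coe_insert, Set.mem_union, Set.mem_insert_iff, Finset.mem_coe,
      Set.mem_singleton_iff] at hx
    rcases hx with (rfl | rfl | hx) | rfl | rfl
    exacts [hu _, hv' _, hQsub _ hx, hv' _, hu _]
  have hMc₂ : Cost M₂ (cellWires w (Set.Icc u v)) (A₂ * (v - u + 1)) (A₂ * (Nat.log 2 K + 2)) := by
    refine hM₂.mono ?_ (Nat.mul_le_mul_left _ (by omega))
      (Nat.mul_le_mul_left _ (hlog _ (by omega)))
    intro x hx
    simp only [Set.mem_union, Set.mem_insert_iff, Finset.mem_coe, Set.mem_singleton_iff] at hx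
    rcases hx with hx | rfl | rfl
    exacts [hQsub _ hx, hv' _, hv' _]
  have hNc := hN.mono hsub le_rfl le_rfl
  have hNc' := hN'.mono hsub le_rfl le_rfl
  have hA := (hNc.append hMc₁).append hNc.reverse
  have hB := (hNc'.append hMc₂).append hNc'.reverse
  refine ⟨(N ++ M₁ ++ N.reverse) ++ (N' ++ M₂ ++ N'.reverse) ++ (N ++ M₁ ++ N.reverse) ++
    (N' ++ M₂ ++ N'.reverse), (((hA.append hB).append hA).append hB).mono le_rfl ?_ ?_,
    fun s => ?_⟩
  · obtain ⟨m, hm⟩ : ∃ m, v - u = m := ⟨_, rfl⟩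
    rw [hm]
    nlinarith
  · nlinarith [Nat.zero_le (A₁ * Nat.log 2 K), Nat.zero_le (A₂ * Nat.log 2 K)]
  have hview : ∀ t, (∀ i < v, ∀ a, t ≠ w i a) → ∀ b s i, i < v →
      view w (xorAt t b s) i = view w s i := by
    intro t ht b s i hi
    exact view_congr fun a => xorAt_of_ne (ht i hi _).symm b s
  have hv3 : ∀ i < v, ∀ a, w v 3 ≠ w i a := fun i hi a => hne hv (by omega) (Or.inl (by omega))
  have hv4 : ∀ i < v, ∀ a, w v 4 ≠ w i a := fun i hi a => hne hv (by omega) (Or.inl (by omega))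
  rw [act_toggle (t := w v 3) (g := w v 4)
    (φ := fun s => s (w u 3) && decide (∀ i, u ≤ i → i < v → 4 ≤ ν i (view w s i).1))
    (χ := fun s => decide (∀ i, u ≤ i → i < v → 4 ≤ ν' i (view w s i).1))
    (hne hv hv (Or.inr (by decide)))]
  · congr 1
    rw [Bool.and_assoc, ← Bool.decide_and]
    congr 1
    rw [decide_eq_decide]
    simp only [pairInd, Bool.and_eq_true, decide_eq_true_iff]
    exact ⟨fun h i h1 h2 => ⟨h.1 i h1 h2, h.2 i h1 h2⟩,
      fun h => ⟨fun i h1 h2 => (h i h1 h2).1, fun i h1 h2 => (h i h1 h2).2⟩⟩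
  · intro s
    rw [hN.act_conj_xorAt (hvnot 3) hMs₁]
    congr 1
    simp only [Finset.forall_mem_insert, Bool.decide_and, Bool.decide_eq_true]
    rw [hN.act_off s (hvnot 4), view_three w (act N s), (hNs s).1 u le_rfl huv, view_three w s, ← Bool.and_assoc,
      ← Bool.and_assoc]
    congr 1
    · exact Bool.and_comm _ _
    · rw [decide_eq_decide, hQ]
      simp only [Finset.forall_mem_image, Finset.mem_Ico, and_imp]
      refine forall_congr' fun i => forall₂_congr fun h1 h2 => ?_
      rw [view_two w (act N s), (hNs s).1 i h1 h2, decide_eq_true_iff]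
      rfl
  · intro s
    rw [hN'.act_conj_xorAt (hvnot 4) hMs₂]
    congr 1
    rw [decide_eq_decide, hQ]
    simp only [Finset.forall_mem_image, Finset.mem_Ico, and_imp]
    refine forall_congr' fun i => forall₂_congr fun h1 h2 => ?_
    rw [view_two w (act N' s), (hNs' s).1 i h1 h2, decide_eq_true_iff]
    rfl
  · intro b s
    rw [xorAt_of_ne (hv4 u huv 3).symm]
    congr 1
    rw [decide_eq_decide]
    exact forall_congr' fun i => forall₂_congr fun _ h2 => by rw [hview _ hv4 b s i h2]
  · intro b s
    rw [xorAt_of_ne (hv3 u huv 3).symm]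
    congr 1
    rw [decide_eq_decide]
    exact forall_congr' fun i => forall₂_congr fun _ h2 => by rw [hview _ hv3 b s i h2]
  · intro b s
    rw [decide_eq_decide]
    exact forall_congr' fun i => forall₂_congr fun _ h2 => by rw [hview _ hv4 b s i h2]
  · intro b s
    rw [decide_eq_decide]
    exact forall_congr' fun i => forall₂_congr fun _ h2 => by rw [hview _ hv3 b s i h2]

/-! ### Circuits on the digits and carry bits of cells -/

/-- The circuit acts by `F` on the digits and carry bits of the first `K` cells. -/
def Sim (w : ℕ → Fin 5 → W) (K : ℕ) (C : Circuit W)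
    (F : (ℕ → Fin 8 × Bool) → (ℕ → Fin 8 × Bool)) : Prop :=
  ∀ s v, (∀ i < K, view w s i = v i) → (∀ i < K, view w (act C s) i = F v i) ∧
    ∀ x, (∀ i < K, ∀ a : Fin 4, x ≠ w i a.castSucc) → act C s x = s x

/-- `F` can be implemented on the first `K` cells within the given bounds. -/
def HasSim (w : ℕ → Fin 5 → W) (K : ℕ) (F : (ℕ → Fin 8 × Bool) → (ℕ → Fin 8 × Bool))
    (ℓ d : ℕ) : Prop :=
  ∃ C : Circuit W, Cost C (cellWires w (Set.Iio K)) ℓ d ∧ Sim w K C F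

section Sim

variable {w : ℕ → Fin 5 → W} {K : ℕ} {F G : (ℕ → Fin 8 × Bool) → (ℕ → Fin 8 × Bool)}

theorem HasSim.mono (h : HasSim w K F ℓ d) (hℓ : ℓ ≤ ℓ') (hd : d ≤ d') : HasSim w K F ℓ' d' := by
  obtain ⟨C, h1, h2⟩ := h
  exact ⟨C, h1.mono le_rfl hℓ hd, h2⟩

theorem HasSim.congr (h : HasSim w K F ℓ d) (hFG : ∀ v, F v = G v) : HasSim w K G ℓ d :=
  (funext hFG : F = G) ▸ h

theorem HasSim.comp (h : HasSim w K F ℓ d) (h' : HasSim w K G ℓ' d') :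
    HasSim w K (fun v => G (F v)) (ℓ + ℓ') (d + d') := by
  obtain ⟨C, h1, h2⟩ := h
  obtain ⟨D, h1', h2'⟩ := h'
  refine ⟨C ++ D, h1.append h1', fun s v hv => ?_⟩
  obtain ⟨e1, e2⟩ := h2 s v hv
  obtain ⟨e1', e2'⟩ := h2' _ _ e1
  rw [act_append]
  exact ⟨e1', fun x hx => (e2' x hx).trans (e2 x hx)⟩

theorem HasSim.reverse (h : HasSim w K F ℓ d) (hGF : ∀ v, G (F v) = v)
    (hG : ∀ v v' : ℕ → Fin 8 × Bool, (∀ i < K, v i = v' i) → ∀ i < K, G v i = G v' i) :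
    HasSim w K G ℓ d := by
  obtain ⟨C, h1, h2⟩ := h
  refine ⟨C.reverse, h1.reverse, fun s v hv => ?_⟩
  obtain ⟨e1, e2⟩ := h2 (act C.reverse s) (view w (act C.reverse s)) fun i _ => rfl
  rw [act_act_reverse] at e1 e2
  refine ⟨fun i hi => ?_, fun x hx => (e2 x hx).symm⟩
  have := hG _ _ (fun i hi => (e1 i hi).symm.trans (hv i hi)) i hi
  rw [hGF] at this
  exact this

/-- Permute each cell. -/
def cellF (φ : ℕ → Equiv.Perm (Fin 8 × Bool)) (v : ℕ → Fin 8 × Bool) : ℕ → Fin 8 × Bool :=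
  fun i => φ i (v i)

/-- Add to each carry bit a function of the previous cell. -/
def carryF (γ : ℕ → Fin 8 × Bool → Bool) (v : ℕ → Fin 8 × Bool) : ℕ → Fin 8 × Bool
  | 0 => v 0
  | i + 1 => ((v (i + 1)).1, (v (i + 1)).2 ^^ γ i (v i))

/-- Propagate the carry bits. -/
def ladF (β : ℕ → Fin 8 → Bool) (v : ℕ → Fin 8 × Bool) : ℕ → Fin 8 × Bool :=
  fun i => ((v i).1, ladVal (fun j => β j (v j).1) (fun j => (v j).2) i)

end Sim

theorem exists_hasSim_cellF : ∃ A : ℕ, ∀ (W : Type) [DecidableEq W] (w : ℕ → Fin 5 → W) (K : ℕ),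
    Cells w K → ∀ φ, HasSim w K (cellF φ) (A * K) A := by
  obtain ⟨A, hA⟩ := exists_cellOp
  refine ⟨A, fun W _ w K hw φ => ?_⟩
  obtain ⟨C, h1, h2⟩ := hA W w K hw φ 0 K le_rfl
  refine ⟨C, h1.mono (cellWires_mono Set.Ico_subset_Iio_self) le_rfl le_rfl, fun s v hv => ⟨?_, ?_⟩⟩
  · intro i hi
    rw [(h2 s).1 i (Nat.zero_le i) hi, hv i hi]
    rfl
  · exact fun x hx => (h2 s).2 x fun i _ hi => hx i hi

/-- Add a function of the digit to the carry bit. -/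
def xorPerm (γ : Fin 8 → Bool) : Equiv.Perm (Fin 8 × Bool) :=
  Function.Involutive.toPerm (fun p => (p.1, p.2 ^^ γ p.1)) fun p => by simp

/-- The digit of cell `i`, its spare wire and the carry wire of cell `i + 1` form a group. These
groups are disjoint, so all carries are updated at once in constant depth. -/
theorem exists_hasSim_carryF : ∃ A : ℕ, ∀ (W : Type) [DecidableEq W] (w : ℕ → Fin 5 → W) (K : ℕ),
    Cells w K → ∀ γ : ℕ → Fin 8 → Bool, HasSim w K (carryF fun i p => γ i p.1) (A * K) A := by
  obtain ⟨A, hA⟩ := exists_parallel_perm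
  refine ⟨A, fun W _ w K hw γ => ?_⟩
  let x : ℕ → Fin 4 → W := fun i => ![w i 0, w i 1, w i 2, w (i + 1) 3]
  have hx : ∀ i a, x i a = w (if a = 3 then i + 1 else i) a.castSucc := by
    intro i a
    fin_cases a <;> rfl
  have hne : ∀ {i j : ℕ}, i < K → j < K → ∀ {a b : Fin 5}, w i a = w j b → i = j ∧ a = b :=
    fun hi hj _ _ h => hw _ hi _ hj _ _ h
  have hI : ∀ i ∈ List.range (K - 1), i + 1 < K := fun i hi => by
    have := List.mem_range.1 hi; omega
  have h1 : ∀ i ∈ List.range (K - 1), Function.Injective (x i) := by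
    intro i hi a b hab
    have hi := hI i hi
    rw [hx, hx] at hab
    exact Fin.castSucc_injective _ (hne (by split_ifs <;> omega) (by split_ifs <;> omega) hab).2
  have h2 : ∀ i ∈ List.range (K - 1), w i 4 ∉ Set.range (x i) := by
    rintro i hi ⟨a, h⟩
    have hi := hI i hi
    rw [hx] at h
    exact absurd (hne (by split_ifs <;> omega) (by omega) h).2 (Fin.castSucc_lt_last a).ne
  have h3 : (List.range (K - 1)).Pairwise fun i j =>
      Disjoint (Set.range (x i) ∪ {w i 4}) (Set.range (x j) ∪ {w j 4}) := by
    refine List.nodup_range.imp_of_mem fun {i j} hi hj hij => ?_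
    have hi := hI i hi
    have hj := hI j hj
    rw [Set.disjoint_left]
    rintro _ (⟨a, rfl⟩ | rfl) (⟨b, h⟩ | h)
    · rw [hx, hx] at h
      obtain ⟨h1, h2⟩ := hne (by split_ifs <;> omega) (by split_ifs <;> omega) h
      obtain rfl := Fin.castSucc_injective _ h2
      split_ifs at h1 <;> omega
    · rw [Set.mem_singleton_iff, hx] at h
      exact absurd (hne (by split_ifs <;> omega) (by omega) h).2 (Fin.castSucc_lt_last a).ne
    · rw [hx] at h
      exact absurd (hne (by split_ifs <;> omega) (by omega) h).2 (Fin.castSucc_lt_last b).ne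
    · exact hij (hne (by omega) (by omega) h).1
  have h4 : ∀ i ∈ List.range (K - 1), Set.range (x i) ∪ {w i 4} ⊆ cellWires w (Set.Iio K) := by
    intro i hi y hy
    have hi := hI i hi
    rcases hy with ⟨a, rfl⟩ | rfl
    · rw [hx]
      exact mem_cellWires.2 ⟨_, by rw [Set.mem_Iio]; split_ifs <;> omega, _, rfl⟩
    · exact mem_cellWires.2 ⟨i, by rw [Set.mem_Iio]; omega, _, rfl⟩
  obtain ⟨C, hC, hs⟩ := hA W _ x (fun i => w i 4) _ (fun i => xorPerm (γ i)) h1 h2 h3 h4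
  refine ⟨C, hC.mono le_rfl ?_ le_rfl, fun s v hv => ⟨?_, ?_⟩⟩
  · rw [List.length_range, mul_comm]
    exact Nat.mul_le_mul_left _ (Nat.sub_le _ _)
  · have hfst : ∀ s i, (view w s i).1 = (digitEquiv (s ∘ x i)).1 := fun s i => rfl
    have hsnd : ∀ s i, (view w s (i + 1)).2 = (digitEquiv (s ∘ x i)).2 := fun s i => rfl
    have e1 : ∀ i < K, (view w (act C s) i).1 = (view w s i).1 := by
      intro i hi
      by_cases hi' : i < K - 1
      · rw [hfst, (hs s).1 i (List.mem_range.2 hi'), hfst]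
        rfl
      · refine view_fst_congr fun a ha => (hs s).2 _ fun j hj b h => ?_
        have hj := List.mem_range.1 hj
        rw [hx] at h
        obtain ⟨h1, h2⟩ := hne hi (by split_ifs <;> omega) h
        split_ifs at h1 with hb
        · subst hb
          rw [h2] at ha
          exact absurd ha (by decide)
        · omega
    intro i hi
    cases i with
    | zero =>
      refine Prod.ext (by rw [e1 0 hi, hv 0 hi]; rfl) ?_
      change _ = (v 0).2
      rw [← hv 0 hi, ← view_three w (act C s), ← view_three w s]
      refine (hs s).2 _ fun j hj b h => ?_
      have hj := List.mem_range.1 hj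
      rw [hx] at h
      obtain ⟨h1, h2⟩ := hne hi (by split_ifs <;> omega) h
      split_ifs at h1 with hb
      exact hb (Fin.castSucc_injective 4 (show (3 : Fin 4).castSucc = b.castSucc from h2)).symm
    | succ i =>
      refine Prod.ext (by rw [e1 _ hi, hv _ hi]; rfl) ?_
      rw [hsnd, (hs s).1 i (List.mem_range.2 (by omega))]
      change ((digitEquiv (s ∘ x i)).2 ^^ γ i (digitEquiv (s ∘ x i)).1) = _
      rw [← hfst, ← hsnd, hv _ hi, hv i (by omega)]
      rfl
  · intro y hy
    refine (hs s).2 y fun i hi a => ?_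
    have hi := hI i hi
    rw [hx]
    exact hy _ (by split_ifs <;> omega) a

/-- The ladder gives `ladF`. Its inverse is the one-step map `carryF` that removes the propagated
term, obtained by reversing the circuit; here the added function depends on the carry bit too, so
the disjoint groups used for digit functions are not available. -/
theorem exists_hasSim_ladF : ∃ A : ℕ, ∀ (W : Type) [DecidableEq W] (w : ℕ → Fin 5 → W) (K : ℕ),
    Cells w K → ∀ β : ℕ → Fin 8 → Bool,
    (∀ i, (Finset.univ.filter fun X => β i X = true).card ≤ 4) →
    HasSim w K (ladF β) (A * K * (Nat.log 2 K + 1)) (A * (Nat.log 2 K + 1) ^ 2) ∧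
    HasSim w K (carryF fun i p => β i p.1 && p.2) (A * K * (Nat.log 2 K + 1))
      (A * (Nat.log 2 K + 1) ^ 2) := by
  obtain ⟨A, hA⟩ := exists_intervalOp
  refine ⟨2 * A, fun W _ w K hw β hβ => ?_⟩
  have hlad : HasSim w K (ladF β) (2 * A * K * (Nat.log 2 K + 1))
      (2 * A * (Nat.log 2 K + 1) ^ 2) := by
    choose ν ν' hν using fun i => exists_pairInd (β i) (hβ i)
    have hne : ∀ {i j : ℕ}, i < K → j < K → ∀ {a b : Fin 5}, w i a = w j b → i = j ∧ a = b :=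
      fun hi hj _ _ h => hw _ hi _ hj _ _ h
    have hrange : ∀ {i j : ℕ}, i < K → ∀ {a : Fin 5}, a < 3 → j < K → w i a ≠ w j 3 := by
      intro i j hi a ha hj h
      rw [(hne hi hj h).2] at ha
      exact absurd ha (by decide)
    obtain ⟨C, hC, hs⟩ := exists_ladder (K := K) (A := A) (δ := A * (Nat.log 2 K + 1))
      (r := fun i => w i 3) (Z := fun i => Set.range (w i)) (P := fun u v s => decide (∀ i, u ≤ i →
        i < v → pairInd (ν i) (ν' i) (view w s i).1 = true)) (fun i _ => ⟨3, rfl⟩) hw.disjoint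
      (by
        intro u v x s huv hvx
        rw [← Bool.decide_and, decide_eq_decide]
        constructor
        · exact fun h => ⟨fun i h1 h2 => h i h1 (by omega), fun i h1 h2 => h i (by omega) h2⟩
        · rintro ⟨h1, h2⟩ i hi1 hi2
          by_cases hiv : i < v
          exacts [h1 i hi1 hiv, h2 i (by omega) hi2])
      (by
        intro u v s s' hv h
        rw [decide_eq_decide]
        refine forall_congr' fun i => forall₂_congr fun _ hi => ?_
        rw [view_fst_congr (s := s) (s' := s') fun a ha => h _ fun j hj =>
          hrange (by omega) ha hj])
      (fun u v huv hv => hA W w K hw ν ν' u v huv hv)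
    refine ⟨C, hC.mono le_rfl ?_ ?_, fun s v hv => ⟨fun i hi => Prod.ext ?_ ?_, fun x hx => ?_⟩⟩
    · exact Nat.mul_le_mul_left _ (Nat.le_succ _)
    · calc _ ≤ 2 * (A * (Nat.log 2 K + 1)) * (Nat.log 2 K + 1) :=
            Nat.mul_le_mul_left _ (Nat.le_succ _)
        _ = _ := by ring
    · change _ = (v i).1
      rw [← hv i hi]
      exact view_fst_congr fun a ha => (hs s).2 _ fun j hj => hrange hi ha hj
    · rw [← view_three w (act C s), (hs s).1 i hi]
      refine ladVal_congr (fun j hj => ?_) fun j hj => ?_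
      · rw [hν, ← hv j (by omega), Bool.eq_iff_iff, decide_eq_true_iff]
        exact ⟨fun h => h j le_rfl (by omega), fun h i h1 h2 => by
          obtain rfl : i = j := by omega
          exact h⟩
      · rw [view_three w s, hv j (by omega)]
    · exact (hs s).2 x fun j hj => hx j hj 3
  refine ⟨hlad, hlad.reverse (fun v => ?_) fun v v' h i hi => ?_⟩
  · funext i
    cases i with
    | zero => rfl
    | succ i =>
      refine Prod.ext rfl ?_
      simp [carryF, ladF, ladVal]
  · cases i with
    | zero => exact h 0 hi
    | succ i => simp only [carryF, h _ hi, h i (by omega)]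

/-! ### Propagating carries into the digits -/

/-- The carries: `κ 0 = 0` and `κ (i + 1) = α (X i) ⊕ β (X i) ∧ κ i`. -/
def carries (α β : ℕ → Fin 8 → Bool) (X : ℕ → Fin 8) : ℕ → Bool
  | 0 => false
  | i + 1 => α i (X i) ^^ (β i (X i) && carries α β X i)

/-- A permutation of a digit controlled by the carry bit. -/
def ctrlPerm (h : Fin 8 → Fin 8) (hh : ∀ X, h (h X) = X) : Equiv.Perm (Fin 8 × Bool) :=
  Function.Involutive.toPerm (fun p => (bif p.2 then h p.1 else p.1, p.2)) fun p => by
    rcases p with ⟨X, _ | _⟩ <;> simp [hh]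

/-- The conditions under which one can apply the involution `h` to the digits with an incoming
carry, if the carries are generated by `α` and propagated by `β` before and by `β'` after. -/
structure StepOK (h : Fin 8 → Fin 8) (α β β' : Fin 8 → Bool) : Prop where
  invol : ∀ X, h (h X) = X
  card : (Finset.univ.filter fun X => β X = true).card ≤ 4
  card' : (Finset.univ.filter fun X => β' X = true).card ≤ 4
  before : ∀ X r k, ((β' (bif r then h X else X) && r) ^^ α (bif r then h X else X) ^^
    (β (bif r then h X else X) && (r ^^ k))) = (α X ^^ (β X && k))
  after : ∀ X k, (α X ^^ (β X && k)) =
    (α (bif k then h X else X) ^^ (β' (bif k then h X else X) && k))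

/-- The digits after a step. -/
def stepDigits (h : ℕ → Fin 8 → Fin 8) (κ : ℕ → Bool) (X : ℕ → Fin 8) (i : ℕ) : Fin 8 :=
  bif κ i then h i (X i) else X i

/-- The carries are invariant under a step once propagation is read off with `β'` instead of `β`.
This allows steps to be chained. -/
theorem carries_stepDigits {h : ℕ → Fin 8 → Fin 8} {α β β' : ℕ → Fin 8 → Bool}
    (hs : ∀ i, StepOK (h i) (α i) (β i) (β' i)) (X : ℕ → Fin 8) (i : ℕ) :
    carries α β' (stepDigits h (carries α β X) X) i = carries α β X i := by
  induction i with
  | zero => rfl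
  | succ i ih =>
    rw [carries, ih, carries, (hs i).after]
    rfl

/-- The carry wires hold unknown bits `r`. Apply `h` under `r`, replace `r` by `r ⊕ κ`, apply `h`
again, and remove `κ`. Since `h` is an involution, the net effect on the digits is `h` under `κ`.
The difficulty is that the digits change meanwhile; `StepOK` says exactly that `κ` can still be
computed from the changed digits. -/
theorem exists_step : ∃ A : ℕ, ∀ (W : Type) [DecidableEq W] (w : ℕ → Fin 5 → W) (K : ℕ),
    Cells w K → ∀ (h : ℕ → Fin 8 → Fin 8) (α β β' : ℕ → Fin 8 → Bool),
    (∀ i, StepOK (h i) (α i) (β i) (β' i)) →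
    HasSim w K (fun v i => (stepDigits h (carries α β fun i => (v i).1) (fun i => (v i).1) i,
      (v i).2)) (A * K * (Nat.log 2 K + 1)) (A * (Nat.log 2 K + 1) ^ 2) := by
  obtain ⟨A₁, h1⟩ := exists_hasSim_cellF
  obtain ⟨A₂, h2⟩ := exists_hasSim_carryF
  obtain ⟨A₃, h3⟩ := exists_hasSim_ladF
  refine ⟨2 * A₁ + 2 * A₂ + 4 * A₃, fun W _ w K hw h α β β' hs => ?_⟩
  have hc := h1 W w K hw fun i => ctrlPerm (h i) (hs i).invol
  have ha := h2 W w K hw α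
  have hb := (h3 W w K hw β fun i => (hs i).card).1
  obtain ⟨hb', hbi⟩ := h3 W w K hw β' fun i => (hs i).card'
  -- The three maps `hbi`, `ha`, `hb` add `κ` to the carry wires: remove the propagation of `r` by
  -- `β'`, add the generated carries, propagate by `β`. The second time, propagation by `β'` takes
  -- `r ⊕ κ` back to `r`.
  have key := ((((((hc.comp hbi).comp ha).comp hb).comp hc).comp hbi).comp ha).comp hb'
  have hL : 1 ≤ Nat.log 2 K + 1 := by omega
  have hL2 : 1 ≤ (Nat.log 2 K + 1) ^ 2 := Nat.one_le_pow _ _ hL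
  refine (key.congr (G := fun v i => (stepDigits h (carries α β fun i => (v i).1)
    (fun i => (v i).1) i, (v i).2)) fun v => ?_).mono ?_ ?_
  · set κ := carries α β fun i => (v i).1 with hκ
    set v₁ := cellF (fun i => ctrlPerm (h i) (hs i).invol) v with hv₁
    set v₃ := carryF (fun i p => α i p.1) (carryF (fun i p => β' i p.1 && p.2) v₁) with hv₃
    set v₄ := ladF β v₃ with hv₄
    set v₅ := cellF (fun i => ctrlPerm (h i) (hs i).invol) v₄ with hv₅
    set v₇ := carryF (fun i p => α i p.1) (carryF (fun i p => β' i p.1 && p.2) v₅) with hv₇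
    have e1 : ∀ i, v₁ i = (bif (v i).2 then h i (v i).1 else (v i).1, (v i).2) := fun i => rfl
    have e3 : ∀ i, (v₃ i).1 = (v₁ i).1 := by
      intro i; cases i <;> rfl
    have e4 : ∀ i, v₄ i = ((v₁ i).1, (v i).2 ^^ κ i) := by
      intro i
      refine Prod.ext (e3 i) ?_
      change ladVal (fun j => β j (v₃ j).1) (fun j => (v₃ j).2) i = _
      induction i with
      | zero => exact (Bool.xor_false _).symm
      | succ i ih =>
        rw [ladVal, ih, e3]
        change (((v (i + 1)).2 ^^ (β' i (v₁ i).1 && (v i).2)) ^^ α i (carryF (fun i p =>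
          β' i p.1 && p.2) v₁ i).1 ^^ _) = ((v (i + 1)).2 ^^ (α i (v i).1 ^^ (β i (v i).1 && κ i)))
        have : (carryF (fun i p => β' i p.1 && p.2) v₁ i).1 = (v₁ i).1 := by cases i <;> rfl
        rw [this, ← (hs i).before (v i).1 (v i).2 (κ i), Bool.xor_assoc, Bool.xor_assoc]
        simp only [e1, Bool.xor_assoc]
    have e5 : ∀ i, v₅ i = (stepDigits h κ (fun i => (v i).1) i, (v i).2 ^^ κ i) := by
      intro i
      have : v₅ i = (bif (v₄ i).2 then h i (v₄ i).1 else (v₄ i).1, (v₄ i).2) := rfl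
      rw [this, e4, e1, stepDigits]
      refine Prod.ext ?_ rfl
      cases (v i).2 <;> cases κ i <;> simp [(hs i).invol]
    have e7 : ∀ i, (v₇ i).1 = (v₅ i).1 := by
      intro i; cases i <;> rfl
    change ladF β' v₇ = _
    funext i
    refine Prod.ext ((e7 i).trans (by rw [e5])) ?_
    change ladVal (fun j => β' j (v₇ j).1) (fun j => (v₇ j).2) i = (v i).2
    induction i with
    | zero =>
      change (v₅ 0).2 = _
      rw [e5]
      exact Bool.xor_false _
    | succ i ih =>
      rw [ladVal, ih, e7]
      change (((v₅ (i + 1)).2 ^^ (β' i (v₅ i).1 && (v₅ i).2)) ^^ α i (carryF (fun i p =>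
          β' i p.1 && p.2) v₅ i).1 ^^ _) = (v (i + 1)).2
      have : (carryF (fun i p => β' i p.1 && p.2) v₅ i).1 = (v₅ i).1 := by cases i <;> rfl
      rw [this, e5, e5]
      have hk : κ (i + 1) = (α i (stepDigits h κ (fun i => (v i).1) i) ^^
          (β' i (stepDigits h κ (fun i => (v i).1) i) && κ i)) := (hs i).after _ _
      simp only
      rw [hk]
      generalize stepDigits h κ (fun i => (v i).1) i = Y
      cases (v (i + 1)).2 <;> cases α i Y <;> cases β' i Y <;> cases κ i <;> cases (v i).2 <;> rfl
  · nlinarith [Nat.zero_le (A₁ * K * Nat.log 2 K), Nat.zero_le (A₂ * K * Nat.log 2 K)]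
  · nlinarith [Nat.mul_le_mul_left A₁ hL2, Nat.mul_le_mul_left A₂ hL2]

/-! ### Incrementing digits by products of involutions -/

/-- Involutions of the digits whose composition is the increment. -/
def incInvol (c : Fin 8) : Fin 4 → Fin 8 → Fin 8
  | 0, X => Equiv.swap (c - 1) c X
  | 1, X => Equiv.swap (c - 1) 7 X
  | 2, X => if X < c then c - 1 - X else if X = c then c else c - X
  | 3, X =>
    let Y : Fin 8 := if X < c then c - 1 - X else if X = c then c else c - X
    Equiv.swap (c - 1) c (Equiv.swap (c - 1) 7 Y) + 1

/-- The digits that generate a carry, after addition of `c`. -/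
def genDigit (c X : Fin 8) : Bool := decide (X < c)

/-- The digits that propagate a carry, before and after each of the involutions. -/
def propDigit (c : Fin 8) : Fin 5 → Fin 8 → Bool
  | 0, X => decide (X = 7)
  | 1, X => decide (X = 7 ∨ X = c - 1 ∨ X = c)
  | _, X => decide (X = c)

set_option maxRecDepth 100000 in
-- After adding `c` modulo 8, overflow means `X < c`; the digit 7 propagates before the increment
-- and the digit `c` after it. For `1 ≤ c ≤ 6` the digits `c - 1`, `c`, `7` are distinct, and the
-- first two swaps move the propagation from 7 to `c`. The other two involutions preserve `c` and
-- the blocks below and above it, on which they are reflections composing to rotations.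
theorem incInvol_isDigitStep : ∀ c : Fin 8, 1 ≤ c → c ≤ 6 → ∀ t : Fin 4,
    StepOK (incInvol c t) (genDigit c) (propDigit c t.castSucc) (propDigit c t.succ) := by
  intro c h1 h2 t
  constructor
  · revert c t; decide
  · revert c t; decide
  · revert c t; decide
  · revert c t; decide
  · revert c t; decide

theorem incInvol_comp : ∀ c : Fin 8, 1 ≤ c → c ≤ 6 → ∀ X,
    incInvol c 3 (incInvol c 2 (incInvol c 1 (incInvol c 0 X))) = X + 1 := by
  decide

/-! ### Adding a constant to a register of base-8 digits -/

/-- The sum of digits and of the incoming carries. -/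
def addDigits (c : ℕ → Fin 8) (X : ℕ → Fin 8) (i : ℕ) : Fin 8 :=
  bif carries (fun i => genDigit (c i)) (fun i => propDigit (c i) 0) (fun i => X i + c i) i then
    X i + c i + 1 else X i + c i

/-- Add digit by digit without carries, then apply the four involutions under the incoming carries.
The carries do not change along the way, so their product, the increment, is applied under one and
the same carry. -/
theorem exists_addDigits : ∃ A : ℕ, ∀ (W : Type) [DecidableEq W] (w : ℕ → Fin 5 → W) (K : ℕ),
    Cells w K → ∀ c : ℕ → Fin 8, (∀ i, 1 ≤ c i ∧ c i ≤ 6) →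
    HasSim w K (fun v i => (addDigits c (fun i => (v i).1) i, (v i).2))
      (A * K * (Nat.log 2 K + 1)) (A * (Nat.log 2 K + 1) ^ 2) := by
  obtain ⟨A₁, h1⟩ := exists_hasSim_cellF
  obtain ⟨A₂, h2⟩ := exists_step
  refine ⟨A₁ + 4 * A₂, fun W _ w K hw c hc => ?_⟩
  have h0 := h1 W w K hw fun i => (Equiv.addRight (c i)).prodCongr (Equiv.refl _)
  have hok : ∀ t i, _ := fun t i => incInvol_isDigitStep (c i) (hc i).1 (hc i).2 t
  have hs : ∀ t : Fin 4, _ := fun t => h2 W w K hw (fun i => incInvol (c i) t)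
    (fun i => genDigit (c i)) (fun i => propDigit (c i) t.castSucc)
    (fun i => propDigit (c i) t.succ) (hok t)
  have key := (((h0.comp (hs 0)).comp (hs 1)).comp (hs 2)).comp (hs 3)
  have hL2 : 1 ≤ (Nat.log 2 K + 1) ^ 2 := Nat.one_le_pow _ _ (by omega)
  refine (key.congr (G := fun v i => (addDigits c (fun i => (v i).1) i, (v i).2))
    fun v => ?_).mono ?_ ?_
  · funext i
    refine Prod.ext ?_ rfl
    let G : Fin 5 → (ℕ → Fin 8) → ℕ → Bool := fun t X =>
      carries (fun i => genDigit (c i)) (fun i => propDigit (c i) t) X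
    let F : Fin 4 → (ℕ → Fin 8) → ℕ → Fin 8 := fun t X =>
      stepDigits (fun i => incInvol (c i) t) (G t.castSucc X) X
    have hG : ∀ t X i, G t.succ (F t X) i = G t.castSucc X i := fun t X i =>
      carries_stepDigits (hok t) X i
    have hF : ∀ t X i, F t X i = bif G t.castSucc X i then incInvol (c i) t (X i) else X i :=
      fun _ _ _ => rfl
    let X₀ : ℕ → Fin 8 := fun i => (v i).1 + c i
    change F 3 (F 2 (F 1 (F 0 X₀))) i = _
    have g1 : G (Fin.castSucc 1) (F 0 X₀) i = G 0 X₀ i := hG 0 X₀ i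
    have g2 : G (Fin.castSucc 2) (F 1 (F 0 X₀)) i = G 0 X₀ i := (hG 1 _ i).trans g1
    have g3 : G (Fin.castSucc 3) (F 2 (F 1 (F 0 X₀))) i = G 0 X₀ i := (hG 2 _ i).trans g2
    have g0 : G (Fin.castSucc 0) X₀ i = G 0 X₀ i := rfl
    rw [hF 3, g3, hF 2, g2, hF 1, g1, hF 0, g0]
    change _ = bif G 0 X₀ i then X₀ i + 1 else X₀ i
    cases G 0 X₀ i
    · rfl
    · exact incInvol_comp (c i) (hc i).1 (hc i).2 _
  · nlinarith [Nat.zero_le (A₁ * K * Nat.log 2 K)]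
  · nlinarith [Nat.mul_le_mul_left A₁ hL2]

theorem digit_sum : ∀ (x c : Fin 8) (k : Bool),
    x.val + c.val + k.toNat = (bif k then x + c + 1 else x + c).val +
      8 * (genDigit c (x + c) ^^ (propDigit c 0 (x + c) && k)).toNat := by
  decide

/-- Correctness of schoolbook addition: `digit_sum` at each digit, with the outgoing carry weighted
by `8 ^ j`. -/
theorem addDigits_sum (c X : ℕ → Fin 8) (j : ℕ) :
    ∑ i ∈ Finset.range j, (addDigits c X i).val * 8 ^ i + 8 ^ j *
      (carries (fun i => genDigit (c i)) (fun i => propDigit (c i) 0) (fun i => X i + c i) j).toNat =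
    ∑ i ∈ Finset.range j, (X i).val * 8 ^ i + ∑ i ∈ Finset.range j, (c i).val * 8 ^ i := by
  induction j with
  | zero => rfl
  | succ j ih =>
    have h := digit_sum (X j) (c j)
      (carries (fun i => genDigit (c i)) (fun i => propDigit (c i) 0) (fun i => X i + c i) j)
    rw [Finset.sum_range_succ, Finset.sum_range_succ, Finset.sum_range_succ, carries]
    rw [← addDigits] at h
    generalize (genDigit (c j) (X j + c j) ^^ (propDigit (c j) 0 (X j + c j) &&
      carries (fun i => genDigit (c i)) (fun i => propDigit (c i) 0)
        (fun i => X i + c i) j)).toNat = κ' at h ⊢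
    generalize (carries (fun i => genDigit (c i)) (fun i => propDigit (c i) 0)
        (fun i => X i + c i) j).toNat = κ at h ih
    rw [pow_succ]
    have h2 : 8 ^ j * ((X j).val + (c j).val + κ) = 8 ^ j * ((addDigits c X j).val + 8 * κ') := by
      rw [h]
    linarith

/-- Two digits from 1 to 6 can have any sum from 2 to 9, hence any residue modulo 8; what remains is
divided by 8 and passed on. -/
theorem exists_digits (K : ℕ) (c : ℤ) : ∃ a b : ℕ → Fin 8, (∀ i, 1 ≤ a i ∧ a i ≤ 6) ∧
    (∀ i, 1 ≤ b i ∧ b i ≤ 6) ∧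
    ((∑ i ∈ Finset.range K, (a i).val * 8 ^ i + ∑ i ∈ Finset.range K, (b i).val * 8 ^ i : ℕ) : ℤ)
      ≡ c [ZMOD 8 ^ K] := by
  induction K generalizing c with
  | zero =>
    have h : (1 : Fin 8) ≤ 1 ∧ (1 : Fin 8) ≤ 6 := by decide
    exact ⟨fun _ => 1, fun _ => 1, fun _ => h, fun _ => h, by simp [Int.modEq_one]⟩
  | succ K ih =>
    have hdig : ∃ a b : Fin 8, (1 ≤ a ∧ a ≤ 6) ∧ (1 ≤ b ∧ b ≤ 6) ∧
        ∃ q : ℤ, c = (a.val : ℤ) + b.val + 8 * q := by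
      have h : c = (c - 2) % 8 + 2 + 8 * ((c - 2) / 8) := by omega
      have h0 : 0 ≤ (c - 2) % 8 := by omega
      have h8 : (c - 2) % 8 < 8 := by omega
      generalize (c - 2) % 8 = r at h h0 h8
      interval_cases r
      · exact ⟨1, 1, by decide, by decide, _, h⟩
      · exact ⟨1, 2, by decide, by decide, _, h⟩
      · exact ⟨2, 2, by decide, by decide, _, h⟩
      · exact ⟨2, 3, by decide, by decide, _, h⟩
      · exact ⟨3, 3, by decide, by decide, _, h⟩
      · exact ⟨3, 4, by decide, by decide, _, h⟩
      · exact ⟨4, 4, by decide, by decide, _, h⟩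
      · exact ⟨4, 5, by decide, by decide, _, h⟩
    obtain ⟨a₀, b₀, ha₀, hb₀, q, hq⟩ := hdig
    obtain ⟨a, b, ha, hb, h⟩ := ih q
    refine ⟨fun i => Nat.casesOn i a₀ a, fun i => Nat.casesOn i b₀ b, ?_, ?_, ?_⟩
    · rintro (_ | i)
      exacts [ha₀, ha i]
    · rintro (_ | i)
      exacts [hb₀, hb i]
    · rw [Finset.sum_range_succ', Finset.sum_range_succ']
      have h8 := (h.mul_left' (c := 8)).add_right ((a₀.val : ℤ) + b₀.val)
      rw [hq]
      have e1 : (8 : ℤ) ^ (K + 1) = 8 * 8 ^ K := by ring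
      rw [e1]
      convert h8 using 1
      · push_cast
        rw [mul_add, Finset.mul_sum, Finset.mul_sum]
        have : ∀ f : ℕ → Fin 8, ∑ i ∈ Finset.range K, ((f i).val : ℤ) * 8 ^ (i + 1) =
            ∑ i ∈ Finset.range K, 8 * (((f i).val : ℤ) * 8 ^ i) :=
          fun f => Finset.sum_congr rfl fun i _ => by ring
        simp only [this, Nat.rec_zero]
        ring
      · ring

/-! ### Registers -/

/-- The number in the register of `m` wires. -/
def bval (m : ℕ) (x : ℕ → W) (s : W → Bool) : ℕ := ∑ i ∈ Finset.range m, (s (x i)).toNat * 2 ^ i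

/-- The circuit adds `φ` to the register and preserves all other wires. -/
def IsAddBy (C : Circuit W) (m : ℕ) (x : ℕ → W) (φ : (W → Bool) → ℤ) : Prop :=
  ∀ s, (bval m x (act C s) : ℤ) ≡ bval m x s + φ s [ZMOD 2 ^ m] ∧
    ∀ w, (∀ i < m, w ≠ x i) → act C s w = s w

theorem bval_lt (m : ℕ) (x : ℕ → W) (s : W → Bool) : bval m x s < 2 ^ m := by
  induction m with
  | zero => simp [bval]
  | succ m ih =>
    rw [bval, Finset.sum_range_succ, pow_succ, mul_two, ← bval]
    have : (s (x m)).toNat * 2 ^ m ≤ 1 * 2 ^ m := Nat.mul_le_mul_right _ (Bool.toNat_le _)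
    omega

theorem bval_succ' (m : ℕ) (x : ℕ → W) (s : W → Bool) :
    bval (m + 1) x s = (s (x 0)).toNat + 2 * bval m (fun i => x (i + 1)) s := by
  rw [bval, Finset.sum_range_succ', bval, Finset.mul_sum, pow_zero, mul_one, add_comm]
  congr 1
  exact Finset.sum_congr rfl fun i _ => by ring

theorem bval_add (m k : ℕ) (x : ℕ → W) (s : W → Bool) :
    bval (m + k) x s = bval m x s + 2 ^ m * bval k (fun i => x (m + i)) s := by
  rw [bval, Finset.sum_range_add, bval, bval, Finset.mul_sum]
  congr 1
  exact Finset.sum_congr rfl fun i _ => by ring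

theorem bval_congr {α β : Type} {m : ℕ} {x : ℕ → α} {x' : ℕ → β} {s : α → Bool} {s' : β → Bool}
    (h : ∀ i < m, s (x i) = s' (x' i)) :
    bval m x s = bval m x' s' :=
  Finset.sum_congr rfl fun i hi => by rw [h i (Finset.mem_range.1 hi)]

theorem bits_eq_of_bval_eq {m : ℕ} {x x' : ℕ → W} {s s' : W → Bool}
    (h : bval m x s = bval m x' s') : ∀ i < m, s (x i) = s' (x' i) := by
  induction m generalizing x x' with
  | zero => exact fun i hi => absurd hi (Nat.not_lt_zero i)
  | succ m ih =>
    rw [bval_succ', bval_succ'] at h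
    have h0 : s (x 0) = s' (x' 0) := by
      cases h1 : s (x 0) <;> cases h2 : s' (x' 0) <;> simp [h1, h2] at h ⊢ <;> omega
    rw [h0] at h
    have := ih (x := fun i => x (i + 1)) (x' := fun i => x' (i + 1)) (by omega)
    rintro (_ | i) hi
    · exact h0
    · exact this i (by omega)

theorem bval_three_mul (K : ℕ) (x : ℕ → W) (w : ℕ → Fin 5 → W) (s : W → Bool)
    (h : ∀ i < K, x (3 * i) = w i 0 ∧ x (3 * i + 1) = w i 1 ∧ x (3 * i + 2) = w i 2) :
    bval (3 * K) x s = ∑ i ∈ Finset.range K, (view w s i).1.val * 8 ^ i := by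
  induction K with
  | zero => rfl
  | succ K ih =>
    obtain ⟨h0, h1, h2⟩ := h K (by omega)
    have hv : (view w s K).1.val =
        (s (w K 0)).toNat + 2 * (s (w K 1)).toNat + 4 * (s (w K 2)).toNat := rfl
    rw [Finset.sum_range_succ, ← ih fun i hi => h i (by omega), hv, ← h0, ← h1, ← h2, bval, bval,
      show 3 * (K + 1) = 3 * K + 1 + 1 + 1 by ring, Finset.sum_range_succ, Finset.sum_range_succ,
      Finset.sum_range_succ, show (8 : ℕ) ^ K = 2 ^ (3 * K) by rw [pow_mul]; norm_num]
    ring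

/-- Adding a constant to a register whose length is a multiple of three. -/
theorem exists_add_three_mul : ∃ A : ℕ, ∀ (W : Type) [DecidableEq W] (K : ℕ) (x y : ℕ → W) (c : ℤ),
    Set.InjOn x (Set.Iio (3 * K)) → Set.InjOn y (Set.Iio (2 * K)) →
    (∀ i < 3 * K, ∀ j < 2 * K, x i ≠ y j) →
    ∃ C : Circuit W, Cost C (x '' Set.Iio (3 * K) ∪ y '' Set.Iio (2 * K))
      (A * K * (Nat.log 2 K + 1)) (A * (Nat.log 2 K + 1) ^ 2) ∧ IsAddBy C (3 * K) x fun _ => c := by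
  obtain ⟨A, hA⟩ := exists_addDigits
  refine ⟨2 * A, fun W _ K x y c hx hy hxy => ?_⟩
  let w : ℕ → Fin 5 → W := fun i =>
    ![x (3 * i), x (3 * i + 1), x (3 * i + 2), y (2 * i), y (2 * i + 1)]
  have hwx : ∀ i a, w i a = if a.val < 3 then x (3 * i + a) else y (2 * i + (a - 3)) := by
    intro i a
    fin_cases a <;> rfl
  have hw : Cells w K := by
    intro i hi j hj a b h
    rw [hwx, hwx] at h
    have ha := a.2
    have hb := b.2
    split_ifs at h with h1 h2 h2
    · have := hx (by rw [Set.mem_Iio]; omega) (by rw [Set.mem_Iio]; omega) h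
      exact ⟨by omega, Fin.ext (by omega)⟩
    · exact absurd h (hxy _ (by omega) _ (by omega))
    · exact absurd h.symm (hxy _ (by omega) _ (by omega))
    · have := hy (by rw [Set.mem_Iio]; omega) (by rw [Set.mem_Iio]; omega) h
      exact ⟨by omega, Fin.ext (by omega)⟩
  obtain ⟨a, b, ha, hb, hab⟩ := exists_digits K c
  obtain ⟨C, hC, hs⟩ := (hA W w K hw a ha).comp (hA W w K hw b hb)
  have hval : ∀ s, bval (3 * K) x s = ∑ i ∈ Finset.range K, (view w s i).1.val * 8 ^ i :=
    fun s => bval_three_mul K x w s fun i _ => ⟨rfl, rfl, rfl⟩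
  refine ⟨C, hC.mono ?_ (le_of_eq (by ring)) (le_of_eq (by ring)), fun s => ⟨?_, fun z hz => ?_⟩⟩
  · intro z hz
    obtain ⟨i, hi, a, rfl⟩ := mem_cellWires.1 hz
    rw [Set.mem_Iio] at hi
    have ha := a.2
    rw [hwx]
    split_ifs
    · exact Or.inl ⟨_, by rw [Set.mem_Iio]; omega, rfl⟩
    · exact Or.inr ⟨_, by rw [Set.mem_Iio]; omega, rfl⟩
  · have h1 := (hs s (view w s) fun _ _ => rfl).1
    set X := fun i => (view w s i).1 with hX
    have e : ∑ i ∈ Finset.range K, (view w (act C s) i).1.val * 8 ^ i =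
        ∑ i ∈ Finset.range K, (addDigits b (addDigits a X) i).val * 8 ^ i :=
      Finset.sum_congr rfl fun i hi => by rw [h1 i (Finset.mem_range.1 hi)]
    have e1 := addDigits_sum a X K
    have e2 := addDigits_sum b (addDigits a X) K
    rw [hval, hval, e, show (2 : ℤ) ^ (3 * K) = 8 ^ K by rw [pow_mul]; norm_num]
    have e3 : ((∑ i ∈ Finset.range K, (addDigits b (addDigits a X) i).val * 8 ^ i : ℕ) : ℤ) ≡
        (∑ i ∈ Finset.range K, (X i).val * 8 ^ i : ℕ) +
        (∑ i ∈ Finset.range K, (a i).val * 8 ^ i + ∑ i ∈ Finset.range K, (b i).val * 8 ^ i : ℕ)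
        [ZMOD 8 ^ K] := by
      rw [← Nat.cast_add, ← add_assoc, ← e1, add_right_comm, ← e2]
      rw [add_assoc, ← mul_add, Nat.cast_add, Nat.cast_mul]
      refine Int.ModEq.symm ?_
      push_cast
      exact Int.modEq_add_fac_self
    exact e3.trans (hab.add_left _)
  · obtain ⟨h1, h2⟩ := hs s (view w s) fun _ _ => rfl
    by_cases hz' : ∃ i < K, ∃ a : Fin 4, z = w i a.castSucc
    · obtain ⟨i, hi, a, rfl⟩ := hz'
      have ha : a = 3 := by
        by_contra hne
        have h3 : a.val < 3 := by
          have := a.2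
          have : a.val ≠ 3 := fun h => hne (Fin.ext h)
          omega
        have := hwx i a.castSucc
        rw [if_pos (by simpa using h3)] at this
        exact hz _ (by simp only [Fin.val_castSucc]; omega) this
      subst ha
      have := congrArg Prod.snd (h1 i hi)
      exact this
    · push Not at hz'
      exact h2 z hz'

/-! ### Adding a constant with many dirty wires -/

theorem IsAddBy.reverse {m : ℕ} {x : ℕ → W} {φ : (W → Bool) → ℤ} (h : IsAddBy C m x φ)
    (hφ : ∀ s, φ (act C s) = φ s) : IsAddBy C.reverse m x fun s => -φ s := by
  intro s
  obtain ⟨h1, h2⟩ := h (act C.reverse s)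
  have h3 := hφ (act C.reverse s)
  rw [act_act_reverse] at h1 h2 h3
  refine ⟨?_, fun w hw => (h2 w hw).symm⟩
  rw [← h3] at h1
  have := (h1.add_right (-φ s)).symm
  rwa [add_neg_cancel_right] at this

theorem IsAddBy.append {m : ℕ} {x : ℕ → W} {φ ψ : (W → Bool) → ℤ} (h : IsAddBy C m x φ)
    (h' : IsAddBy D m x ψ) (hψ : ∀ s, ψ (act C s) = ψ s) :
    IsAddBy (C ++ D) m x fun s => φ s + ψ s := by
  intro s
  obtain ⟨h1, h2⟩ := h s
  obtain ⟨h1', h2'⟩ := h' (act C s)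
  rw [act_append]
  refine ⟨?_, fun w hw => (h2' w hw).trans (h2 w hw)⟩
  rw [hψ] at h1'
  rw [← add_assoc]
  exact h1'.trans (h1.add_right _)

theorem IsAddBy.congr {m : ℕ} {x : ℕ → W} {φ ψ : (W → Bool) → ℤ} (h : IsAddBy C m x φ)
    (hφ : ∀ s, φ s = ψ s) : IsAddBy C m x ψ :=
  (funext hφ : φ = ψ) ▸ h

theorem eq_of_modEq_of_lt {a b M : ℕ} (h : (a : ℤ) ≡ b [ZMOD (M : ℤ)]) (ha : a < M) (hb : b < M) :
    a = b := by
  rw [Int.natCast_modEq_iff] at h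
  exact Nat.ModEq.eq_of_lt_of_lt h ha hb

/-- The register is extended to a multiple of three by `p ≤ 2` dirty wires at its low end, and `c *
2 ^ p` is added, which leaves these wires alone. The bound `16 ≤ m` ensures that the `2 * K + p`
borrowed wires are at most `m - 2`, which is what the two halves of a register can lend each other.
-/
theorem exists_add_dirty : ∃ A : ℕ, ∀ (W : Type) [DecidableEq W] (m : ℕ) (x y : ℕ → W) (c : ℤ),
    16 ≤ m → Set.InjOn x (Set.Iio m) → Set.InjOn y (Set.Iio (m - 2)) →
    (∀ i < m, ∀ j < m - 2, x i ≠ y j) →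
    ∃ C : Circuit W, Cost C (x '' Set.Iio m ∪ y '' Set.Iio (m - 2))
      (A * m * (Nat.log 2 m + 1)) (A * (Nat.log 2 m + 1) ^ 2) ∧ IsAddBy C m x fun _ => c := by
  obtain ⟨A, hA⟩ := exists_add_three_mul
  refine ⟨A, fun W _ m x y c hm hx hy hxy => ?_⟩
  obtain ⟨K, hK⟩ : ∃ K, K = (m + 2) / 3 := ⟨_, rfl⟩
  obtain ⟨p, hp⟩ : ∃ p, p = 3 * K - m := ⟨_, rfl⟩
  have hpm : 3 * K = p + m := by omega
  let x' : ℕ → W := fun j => if j < p then y (2 * K + j) else x (j - p)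
  obtain ⟨C, hC, hs⟩ := hA W K x' y (c * 2 ^ p)
    (by
      intro i hi j hj h
      rw [Set.mem_Iio] at hi hj
      simp only [x'] at h
      split_ifs at h with h1 h2 h2
      · have := hy (by rw [Set.mem_Iio]; omega) (by rw [Set.mem_Iio]; omega) h
        omega
      · exact absurd h.symm (hxy _ (by omega) _ (by omega))
      · exact absurd h (hxy _ (by omega) _ (by omega))
      · have := hx (by rw [Set.mem_Iio]; omega) (by rw [Set.mem_Iio]; omega) h
        omega)
    (hy.mono fun i hi => by rw [Set.mem_Iio] at hi ⊢; omega)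
    (by
      intro i hi j hj h
      simp only [x'] at h
      split_ifs at h with h1
      · have := hy (by rw [Set.mem_Iio]; omega) (by rw [Set.mem_Iio]; omega) h
        omega
      · exact hxy _ (by omega) _ (by omega) h)
  have hlog : Nat.log 2 K ≤ Nat.log 2 m := Nat.log_mono_right (by omega)
  refine ⟨C, hC.mono ?_ ?_ ?_, fun s => ?_⟩
  · rintro _ (⟨i, hi, rfl⟩ | ⟨i, hi, rfl⟩)
    · rw [Set.mem_Iio] at hi
      simp only [x']
      split_ifs
      · exact Or.inr ⟨_, by rw [Set.mem_Iio]; omega, rfl⟩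
      · exact Or.inl ⟨_, by rw [Set.mem_Iio]; omega, rfl⟩
    · rw [Set.mem_Iio] at hi
      exact Or.inr ⟨_, by rw [Set.mem_Iio]; omega, rfl⟩
  · have : K ≤ m := by omega
    gcongr
  · gcongr
  obtain ⟨h1, h2⟩ := hs s
  have hval : ∀ s, bval (3 * K) x' s = bval p x' s + 2 ^ p * bval m x s := by
    intro s
    rw [hpm, bval_add]
    congr 2
    refine bval_congr fun i hi => ?_
    simp [x']
  rw [hval, hval, hpm, pow_add] at h1
  have hlow : bval p x' (act C s) = bval p x' s := by
    refine eq_of_modEq_of_lt (M := 2 ^ p) ?_ (bval_lt _ _ _) (bval_lt _ _ _)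
    have h3 := h1.of_mul_right (2 ^ m)
    push_cast at h3 ⊢
    have e1 : ((bval p x' (act C s) : ℤ) + 2 ^ p * bval m x (act C s)) ≡
        bval p x' (act C s) [ZMOD 2 ^ p] := Int.modEq_add_fac_self
    have e2 : ((bval p x' s : ℤ) + 2 ^ p * bval m x s + c * 2 ^ p) ≡
        bval p x' s [ZMOD 2 ^ p] := by
      rw [add_assoc, mul_comm c, ← mul_add]
      exact Int.modEq_add_fac_self
    exact e1.symm.trans (h3.trans e2)
  refine ⟨?_, fun w hw => ?_⟩
  · rw [hlow] at h1
    push_cast at h1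
    rw [add_assoc] at h1
    have h4 := h1.add_left_cancel' _
    rw [mul_comm c, ← mul_add] at h4
    exact Int.ModEq.mul_left_cancel' (by positivity) h4
  · by_cases hwp : ∃ i < p, w = x' i
    · obtain ⟨i, hi, rfl⟩ := hwp
      exact bits_eq_of_bval_eq hlow i hi
    · push Not at hwp
      refine h2 w fun i hi => ?_
      by_cases hip : i < p
      · exact hwp i hip
      · simp only [x', if_neg hip]
        exact hw _ (by omega)

/-! ### Adding a constant to a short register -/

/-- Reading bits identifies the strings with `ZMod (2 ^ m)`, where adding `c` is a translation. -/
theorem exists_add_perm (m : ℕ) (c : ℤ) : ∃ σ : Equiv.Perm (Fin m → Bool),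
    ∀ (W : Type) (x : ℕ → W) (s s' : W → Bool),
      (∀ i : Fin m, s' (x i) = σ (fun i => s (x i)) i) →
      (bval m x s' : ℤ) ≡ bval m x s + c [ZMOD 2 ^ m] := by
  have : NeZero (2 ^ m) := ⟨by positivity⟩
  let e : (Fin m → Bool) → ℕ → Bool := fun f i => if h : i < m then f ⟨i, h⟩ else false
  let v : (Fin m → Bool) → ZMod (2 ^ m) := fun f => (bval m id (e f) : ZMod (2 ^ m))
  have hinj : Function.Injective v := by
    intro f f' h
    rw [ZMod.natCast_eq_natCast_iff] at h
    have := Nat.ModEq.eq_of_lt_of_lt h (bval_lt _ _ _) (bval_lt _ _ _)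
    funext i
    simpa [e] using bits_eq_of_bval_eq this i i.2
  have hbij : Function.Bijective v := by
    rw [Fintype.bijective_iff_injective_and_card]
    exact ⟨hinj, by simp [ZMod.card]⟩
  let E := Equiv.ofBijective v hbij
  refine ⟨(E.trans (Equiv.addRight (c : ZMod (2 ^ m)))).trans E.symm, fun W x s s' h => ?_⟩
  have hb : ∀ s : W → Bool, ((bval m x s : ℤ) : ZMod (2 ^ m)) = v fun i => s (x i) := by
    intro s
    have : bval m x s = bval m id (e fun i => s (x i)) :=
      bval_congr fun i hi => by simp [e, hi]
    rw [this, Int.cast_natCast]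
  have h2 := (ZMod.intCast_eq_intCast_iff (bval m x s') (bval m x s + c) (2 ^ m)).1 (by
    rw [Int.cast_add, hb, hb, show (fun i : Fin m => s' (x i)) =
      ((E.trans (Equiv.addRight (c : ZMod (2 ^ m)))).trans E.symm) fun i => s (x i) from funext h]
    exact E.apply_symm_apply _)
  exact_mod_cast h2

theorem exists_add_short (N : ℕ) : ∃ A : ℕ, ∀ (W : Type) [DecidableEq W] (m : ℕ) (x : ℕ → W)
    (g : W) (c : ℤ), m < N → Set.InjOn x (Set.Iio m) → (∀ i < m, x i ≠ g) →
    ∃ C : Circuit W, Cost C (x '' Set.Iio m ∪ {g}) A A ∧ IsAddBy C m x fun _ => c := by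
  choose A hA using exists_perm_circuit
  refine ⟨(Finset.range N).sup A, fun W _ m x g c hm hx hg => ?_⟩
  have hle := Finset.le_sup (f := A) (Finset.mem_range.2 hm)
  obtain ⟨σ, hσ⟩ := exists_add_perm m c
  obtain ⟨C, hC, hs⟩ := hA m W (fun i => x i) g σ
    (fun i j h => Fin.ext (hx (by exact i.2) (by exact j.2) h))
    (by rintro ⟨i, hi⟩; exact hg _ i.2 hi)
  refine ⟨C, hC.mono ?_ hle hle, fun s => ⟨?_, fun w hw => ?_⟩⟩
  · rintro _ (⟨i, rfl⟩ | h)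
    · exact Or.inl ⟨i, i.2, rfl⟩
    · exact Or.inr h
  · exact hσ W x s _ fun i => (hs s).1 i
  · refine (hs s).2 w ?_
    rintro ⟨i, rfl⟩
    exact hw i i.2 rfl

/-! ### Fan-out and conditional negation -/

/-- The circuit flips the wires of the register iff `φ`. -/
def IsFan (C : Circuit W) (m : ℕ) (x : ℕ → W) (φ : (W → Bool) → Bool) : Prop :=
  ∀ s, (∀ i < m, act C s (x i) = (s (x i) ^^ φ s)) ∧ ∀ w, (∀ i < m, w ≠ x i) → act C s w = s w

theorem exists_fan (W : Type) [DecidableEq W] (m : ℕ) (x : ℕ → W) (g : W)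
    (hx : Set.InjOn x (Set.Iio m)) (hg : ∀ i < m, x i ≠ g) :
    ∃ C : Circuit W, Cost C (x '' Set.Iio m ∪ {g}) (4 * m * (Nat.log 2 m + 1) + 1)
      (4 * (Nat.log 2 m + 1) + 1) ∧ IsFan C m x fun s => s g := by
  obtain ⟨L, hL, hs⟩ := exists_ladder (K := m) (A := 1) (δ := 1) (r := x) (Z := fun i => {x i})
    (P := fun _ _ _ => true) (fun _ _ => rfl)
    (fun i hi j hj hij => by simpa using fun h => hij (hx hi hj h)) (fun _ _ _ _ _ _ => rfl)
    (fun _ _ _ _ _ _ => rfl) (fun u v huv hv => ⟨cx (x u) (x v), (Cost.cx _ _).mono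
      (by
        rintro _ (rfl | rfl)
        · exact Set.mem_biUnion (show u ∈ Set.Icc u v from ⟨le_rfl, huv.le⟩) rfl
        · exact Set.mem_biUnion (show v ∈ Set.Icc u v from ⟨huv.le, le_rfl⟩) rfl)
      (by omega) le_rfl, fun s => by
        rw [act_cx fun h => by have := hx hv (show u < m by omega) h; omega, Bool.and_true]⟩)
  rcases Nat.eq_zero_or_pos m with rfl | hm
  · exact ⟨[], Cost.nil _ _ _, fun s => ⟨fun i hi => absurd hi (Nat.not_lt_zero i), fun _ _ => rfl⟩⟩
  have hLc : Cost L (x '' Set.Iio m ∪ {g}) (2 * 1 * m * Nat.log 2 m) (2 * 1 * Nat.log 2 m) := by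
    refine hL.mono ?_ le_rfl le_rfl
    intro w hw
    simp only [Set.mem_iUnion, Set.mem_singleton_iff] at hw
    obtain ⟨i, hi, rfl⟩ := hw
    exact Or.inl ⟨i, hi, rfl⟩
  have hX : Cost (cx g (x 0)) (x '' Set.Iio m ∪ {g}) 1 1 := by
    refine (Cost.cx _ _).mono ?_ le_rfl le_rfl
    rintro _ (rfl | rfl)
    · exact Or.inr rfl
    · exact Or.inl ⟨0, hm, rfl⟩
  -- With all propagation bits `1`, the ladder forms prefix XORs. Undoing them, adding `g` to the
  -- first entry and forming them again adds `g` to every entry.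
  refine ⟨L.reverse ++ cx g (x 0) ++ L, ((hLc.reverse.append hX).append hLc).mono le_rfl ?_ ?_,
    fun s => ?_⟩
  · nlinarith
  · omega
  obtain ⟨h1, h2⟩ := hs (act L.reverse s)
  rw [act_act_reverse] at h1 h2
  obtain ⟨h1', h2'⟩ := hs (act (cx g (x 0)) (act L.reverse s))
  rw [act_append, act_append]
  have hgr : act L.reverse s g = s g := (h2 g fun i hi => (hg i hi).symm).symm
  rw [act_cx (hg 0 hm), hgr] at h1' h2' ⊢
  refine ⟨fun i hi => ?_, fun w hw => ?_⟩
  · rw [h1' i hi, h1 i hi]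
    clear h1 h2 h1' h2'
    induction i with
    | zero => exact xorAt_same _ _ _
    | succ i ih =>
      have hne : x (i + 1) ≠ x 0 := fun h => by have := hx hi hm h; omega
      rw [ladVal, ladVal, ih (by omega), xorAt_of_ne hne]
      simp
  · rw [h2' w hw, xorAt_of_ne (hw 0 hm), ← h2 w hw]

theorem exists_notFan (W : Type) [DecidableEq W] (m : ℕ) (x : ℕ → W) (g : W)
    (hx : Set.InjOn x (Set.Iio m)) (hg : ∀ i < m, x i ≠ g) :
    ∃ C : Circuit W, Cost C (x '' Set.Iio m ∪ {g}) (4 * m * (Nat.log 2 m + 1) + 3)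
      (4 * (Nat.log 2 m + 1) + 3) ∧ IsFan C m x fun s => !s g := by
  obtain ⟨F, hF, hs⟩ := exists_fan W m x g hx hg
  have hX : Cost (xg g) (x '' Set.Iio m ∪ {g}) 1 1 :=
    (Cost.xg g).mono Set.subset_union_right le_rfl le_rfl
  refine ⟨xg g ++ F ++ xg g, ((hX.append hF).append hX).mono le_rfl (by omega) (by omega),
    fun s => ?_⟩
  obtain ⟨h1, h2⟩ := hs (xorAt g true s)
  rw [act_append, act_append, act_xg, act_xg]
  refine ⟨fun i hi => ?_, fun w hw => ?_⟩
  · rw [xorAt_of_ne (hg i hi), h1 i hi, xorAt_of_ne (hg i hi)]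
    change (s (x i) ^^ xorAt g true s g) = (s (x i) ^^ !s g)
    rw [xorAt_same, Bool.xor_true]
  · by_cases hwg : w = g
    · subst hwg
      rw [xorAt_same, h2 w hw, xorAt_same]
      simp
    · rw [xorAt_of_ne hwg, h2 w hw, xorAt_of_ne hwg]

theorem bval_not {m : ℕ} {x : ℕ → W} {s s' : W → Bool} (h : ∀ i < m, s' (x i) = !s (x i)) :
    (bval m x s' : ℤ) = 2 ^ m - 1 - bval m x s := by
  induction m with
  | zero => simp [bval]
  | succ m ih =>
    have h1 := ih fun i hi => h i (by omega)
    have h2 : (bval (m + 1) x s' : ℤ) = bval m x s' + (s' (x m)).toNat * 2 ^ m := by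
      simp [bval, Finset.sum_range_succ]
    have h3 : (bval (m + 1) x s : ℤ) = bval m x s + (s (x m)).toNat * 2 ^ m := by
      simp [bval, Finset.sum_range_succ]
    rw [h2, h3, h1, h m (by omega), pow_succ]
    cases s (x m) <;> simp <;> ring

/-- Conjugation by a conditional negation changes the sign of an addition. -/
theorem IsAddBy.conj_sign {F : Circuit W} {m : ℕ} {x : ℕ → W} {g : W} {φ : (W → Bool) → ℤ}
    (h : IsAddBy C m x φ) (hF : IsFan F m x fun s => !s g) (hg : ∀ i < m, x i ≠ g)
    (hφ : ∀ s, φ (act F s) = φ s) :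
    IsAddBy (F ++ C ++ F) m x fun s => if s g then φ s else -φ s := by
  intro s
  rw [act_append, act_append]
  obtain ⟨f1, f2⟩ := hF s
  obtain ⟨h1, h2⟩ := h (act F s)
  obtain ⟨f1', f2'⟩ := hF (act C (act F s))
  refine ⟨?_, fun w hw => by rw [f2' w hw, h2 w hw, f2 w hw]⟩
  have hg' : ∀ i < m, g ≠ x i := fun i hi => (hg i hi).symm
  change ∀ i < m, act F (act C (act F s)) (x i) =
    (act C (act F s) (x i) ^^ !(act C (act F s) g)) at f1'
  rw [h2 g hg', f2 g hg'] at f1'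
  rw [hφ] at h1
  change _ ≡ (bval m x s : ℤ) + (if s g = true then φ s else -φ s) [ZMOD _]
  cases hsg : s g
  · simp only [hsg, Bool.not_false, Bool.xor_true] at f1 f1'
    -- Negation is `x ↦ 2 ^ m - 1 - x`, so an addition between two negations becomes a subtraction.
    have b1 := bval_not f1
    have b2 := bval_not f1'
    rw [b1] at h1
    rw [b2]
    have := (Int.ModEq.refl (2 ^ m - 1)).sub h1
    rw [if_neg Bool.false_ne_true]
    convert this using 1
    ring
  · simp only [hsg, Bool.not_true, Bool.xor_false] at f1 f1'
    rw [bval_congr f1] at h1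
    rw [bval_congr f1', if_pos rfl]
    exact h1

/-! ### Adding a constant with one dirty wire -/

/-- A register with an additional least significant wire. -/
def consReg (g : W) (x : ℕ → W) (i : ℕ) : W := if i = 0 then g else x (i - 1)

/-- A register of `m` wires with an additional most significant wire. -/
def snocReg (m : ℕ) (x : ℕ → W) (g : W) (i : ℕ) : W := if i < m then x i else g

theorem bval_consReg (m : ℕ) (x : ℕ → W) (g : W) (s : W → Bool) :
    bval (m + 1) (consReg g x) s = (s g).toNat + 2 * bval m x s := by
  rw [bval_succ']
  rfl

theorem bval_snocReg (m : ℕ) (x : ℕ → W) (g : W) (s : W → Bool) :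
    bval (m + 1) (snocReg m x g) s = bval m x s + 2 ^ m * (s g).toNat := by
  rw [bval, Finset.sum_range_succ, ← bval, snocReg, if_neg (lt_irrefl m), mul_comm (2 ^ m)]
  congr 1
  exact bval_congr fun i hi => by rw [snocReg, if_pos hi]

theorem consReg_injOn {m : ℕ} {x : ℕ → W} {g : W} (hx : Set.InjOn x (Set.Iio m))
    (hg : ∀ i < m, x i ≠ g) : Set.InjOn (consReg g x) (Set.Iio (m + 1)) := by
  intro i hi j hj h
  rw [Set.mem_Iio] at hi hj
  unfold consReg at h
  split_ifs at h with h1 h2 h2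
  · omega
  · exact absurd h.symm (hg _ (by omega))
  · exact absurd h (hg _ (by omega))
  · have := hx (by rw [Set.mem_Iio]; omega) (by rw [Set.mem_Iio]; omega) h
    omega

theorem snocReg_injOn {m : ℕ} {x : ℕ → W} {g : W} (hx : Set.InjOn x (Set.Iio m))
    (hg : ∀ i < m, x i ≠ g) : Set.InjOn (snocReg m x g) (Set.Iio (m + 1)) := by
  intro i hi j hj h
  rw [Set.mem_Iio] at hi hj
  unfold snocReg at h
  split_ifs at h with h1 h2 h2
  · exact hx h1 h2 h
  · exact absurd h (hg _ h1)
  · exact absurd h.symm (hg _ h2)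
  · omega

/-- Adding one to a register extended by `g` adds `g` to the register. -/
theorem IsAddBy.addBit {m : ℕ} {x : ℕ → W} {g : W}
    (h : IsAddBy C (m + 1) (consReg g x) fun _ => 1) (hg : ∀ i < m, x i ≠ g) :
    IsAddBy (C ++ xg g) m x fun s => (s g).toNat := by
  intro s
  obtain ⟨h1, h2⟩ := h s
  rw [bval_consReg, bval_consReg] at h1
  rw [act_append, act_xg]
  have hb : bval m x (xorAt g true (act C s)) = bval m x (act C s) :=
    bval_congr fun i hi => xorAt_of_ne (hg i hi) _ _
  obtain ⟨t, ht⟩ := h1.symm.dvd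
  rw [pow_succ, mul_comm ((2 : ℤ) ^ m), mul_assoc] at ht
  push_cast at ht
  -- Adding `1` flips the lowest bit `g` and carries its old value into the rest; the final `X`
  -- restores `g`.
  have hpar : act C s g = !s g := by
    cases h3 : act C s g <;> cases h4 : s g <;> simp [h3, h4] at ht ⊢ <;> omega
  refine ⟨?_, fun w hw => ?_⟩
  · rw [hb]
    refine Int.ModEq.symm (Int.modEq_iff_dvd.2 ⟨t, ?_⟩)
    rw [hpar] at ht
    cases h4 : s g <;> simp [h4] at ht ⊢ <;> omega
  · by_cases hwg : w = g
    · subst hwg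
      rw [xorAt_same, hpar]
      simp
    · rw [xorAt_of_ne hwg]
      refine h2 w fun i hi => ?_
      rw [consReg]
      split_ifs
      · exact hwg
      · exact hw _ (by omega)

theorem IsAddBy.bval_of_reverse {m : ℕ} {x : ℕ → W} {c : ℤ} (h : IsAddBy C m x fun _ => c)
    {s s' : W → Bool} (hs : ∀ i < m, s' (x i) = act C s (x i)) :
    ∀ i < m, act C.reverse s' (x i) = s (x i) := by
  have h1 := ((h.reverse fun _ => rfl) s').1
  have h2 := (h s).1
  rw [bval_congr hs] at h1
  have h3 := h1.trans (h2.add_right (-c))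
  rw [add_neg_cancel_right] at h3
  exact bits_eq_of_bval_eq (eq_of_modEq_of_lt (by exact_mod_cast h3) (bval_lt _ _ _)
    (bval_lt _ _ _))

/-- An extra top bit is flipped exactly when the sum on the lower bits overflows, whatever its
initial value. -/
theorem bval_add_carry (m : ℕ) (x : ℕ → W) (g : W) {c : ℤ} {s s' : W → Bool} (hc : 0 ≤ c)
    (hc' : c < 2 ^ m)
    (h : (bval (m + 1) (snocReg m x g) s' : ℤ) ≡ bval (m + 1) (snocReg m x g) s + c
      [ZMOD 2 ^ (m + 1)]) :
    s' g = (s g ^^ decide (2 ^ m ≤ bval m x s + c)) := by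
  rw [bval_snocReg, bval_snocReg] at h
  have h1 := bval_lt m x s
  have h2 := bval_lt m x s'
  zify at h1 h2
  obtain ⟨t, ht⟩ := h.symm.dvd
  rw [pow_succ] at ht
  push_cast at ht
  have hpos : (0 : ℤ) < 2 ^ m := by positivity
  have h3 : (0 : ℤ) ≤ bval m x s := Int.natCast_nonneg _
  have h4 : (0 : ℤ) ≤ bval m x s' := Int.natCast_nonneg _
  generalize (2 : ℤ) ^ m = M at *
  generalize (bval m x s : ℤ) = a at *
  generalize (bval m x s' : ℤ) = b at *
  have ht1 : t < 2 := by
    by_contra hcon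
    have : M * 2 * 2 ≤ M * 2 * t := by gcongr; omega
    cases hg : s g <;> cases hg' : s' g <;> simp [hg, hg'] at ht <;> linarith
  have ht2 : -2 < t := by
    by_contra hcon
    have : M * 2 * t ≤ M * 2 * (-2) := by gcongr; omega
    cases hg : s g <;> cases hg' : s' g <;> simp [hg, hg'] at ht <;> linarith
  by_cases hk : M ≤ a + c
  · rw [decide_eq_true hk]
    rcases (by omega : t = -1 ∨ t = 0 ∨ t = 1) with rfl | rfl | rfl <;>
      cases hg : s g <;> cases hg' : s' g <;> simp [hg, hg'] at ht ⊢ <;> linarith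
  · rw [decide_eq_false hk]
    rcases (by omega : t = -1 ∨ t = 0 ∨ t = 1) with rfl | rfl | rfl <;>
      cases hg : s g <;> cases hg' : s' g <;> simp [hg, hg'] at ht ⊢ <;> linarith

/-- Adding the carry of a constant addition on the register `x` to the register `z`. -/
theorem isAddBy_carry {m k : ℕ} {x z : ℕ → W} {g : W} {c : ℤ} (hc : 0 ≤ c) (hc' : c < 2 ^ m)
    {H L F : Circuit W} (hH : IsAddBy H k z fun s => (s g).toNat)
    (hL : IsAddBy L (m + 1) (snocReg m x g) fun _ => c) (hF : IsFan F k z fun s => !s g)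
    (hxz : ∀ i < m, ∀ j < k, x i ≠ z j) (hzg : ∀ j < k, z j ≠ g) :
    IsAddBy (F ++ (H ++ L ++ H.reverse ++ L.reverse) ++ F) k z
      fun s => if (2 : ℤ) ^ m ≤ bval m x s + c then 1 else 0 := by
  have hxg : ∀ i < m + 1, ∀ j < k, snocReg m x g i ≠ z j := by
    intro i hi j hj
    rw [snocReg]
    split_ifs with h
    exacts [hxz i h j hj, (hzg j hj).symm]
  -- Adding `g`, flipping `g` under the carry, subtracting the new `g` and flipping back changes `z`
  -- by the carry, with sign `+` for `g = 1` and `-` for `g = 0`. The conditional negations correct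
  -- the sign.
  have key : IsAddBy (H ++ L ++ H.reverse ++ L.reverse) k z fun s =>
      (s g).toNat - ((s g ^^ decide ((2 : ℤ) ^ m ≤ bval m x s + c)).toNat : ℤ) := by
    intro s
    simp only [act_append]
    have hHr := hH.reverse fun s => by rw [(hH s).2 g fun i hi => (hzg i hi).symm]
    have hLr := hL.reverse fun _ => rfl
    obtain ⟨h1, h1'⟩ := hH s
    set s₁ := act H s
    obtain ⟨h2, h2'⟩ := hL s₁
    set s₂ := act L s₁ with hs₂
    obtain ⟨h3, h3'⟩ := hHr s₂
    set s₃ := act H.reverse s₂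
    obtain ⟨h4, h4'⟩ := hLr s₃
    have hz2 : bval k z s₂ = bval k z s₁ :=
      bval_congr fun j hj => h2' _ fun i hi => (hxg i hi j hj).symm
    have hz4 : bval k z (act L.reverse s₃) = bval k z s₃ :=
      bval_congr fun j hj => h4' _ fun i hi => (hxg i hi j hj).symm
    have hx1 : bval m x s₁ = bval m x s := bval_congr fun i hi => h1' _ fun j hj => hxz i hi j hj
    have hg1 : s₁ g = s g := h1' g fun j hj => (hzg j hj).symm
    have hg2 := bval_add_carry m x g hc hc' h2
    rw [hg1, hx1] at hg2
    refine ⟨?_, fun w hw => ?_⟩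
    · rw [hz4]
      refine h3.trans ?_
      rw [hz2]
      change _ + -((s₂ g).toNat : ℤ) ≡ _ [ZMOD 2 ^ k]
      rw [hg2, ← sub_eq_add_neg, ← add_sub_assoc]
      exact h1.sub_right _
    · by_cases hwx : ∃ i < m + 1, w = snocReg m x g i
      · obtain ⟨i, hi, rfl⟩ := hwx
        rw [hL.bval_of_reverse (s := s₁) (fun i hi => h3' _ (hxg i hi)) i hi]
        exact h1' _ hw
      · push Not at hwx
        rw [h4' w hwx, h3' w hw, h2' w hwx, h1' w hw]
  refine (key.conj_sign hF hzg fun s => ?_).congr fun s => ?_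
  · rw [(hF s).2 g fun j hj => (hzg j hj).symm,
      bval_congr fun i hi => (hF s).2 _ fun j hj => hxz i hi j hj]
  · by_cases h : (2 : ℤ) ^ m ≤ bval m x s + c <;> cases hg : s g <;> simp [h]

/-- The carry goes into the high part first, while the low part still has the value that determines
it. -/
theorem isAddBy_concat {m k : ℕ} {x : ℕ → W} {c e : ℤ} (hc : 0 ≤ c) (hc' : c < 2 ^ m)
    {P L H : Circuit W} (hx : Set.InjOn x (Set.Iio (m + k)))
    (hP : IsAddBy P k (fun i => x (m + i))
      fun s => if (2 : ℤ) ^ m ≤ bval m x s + c then 1 else 0)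
    (hL : IsAddBy L m x fun _ => c) (hH : IsAddBy H k (fun i => x (m + i)) fun _ => e) :
    IsAddBy (P ++ L ++ H) (m + k) x fun _ => c + 2 ^ m * e := by
  have hne : ∀ i < m, ∀ j < k, x i ≠ x (m + j) := by
    intro i hi j hj h
    have := hx (by rw [Set.mem_Iio]; omega) (by rw [Set.mem_Iio]; omega) h
    omega
  intro s
  simp only [act_append]
  obtain ⟨h1, h1'⟩ := hP s
  obtain ⟨h2, h2'⟩ := hL (act P s)
  obtain ⟨h3, h3'⟩ := hH (act L (act P s))
  have e1 : bval m x (act P s) = bval m x s :=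
    bval_congr fun i hi => h1' _ fun j hj => hne i hi j hj
  have e2 : bval k (fun i => x (m + i)) (act L (act P s)) = bval k (fun i => x (m + i)) (act P s) :=
    bval_congr fun j hj => h2' _ fun i hi => (hne i hi j hj).symm
  have e3 : bval m x (act H (act L (act P s))) = bval m x (act L (act P s)) :=
    bval_congr fun i hi => h3' _ fun j hj => hne i hi j hj
  refine ⟨?_, fun w hw => ?_⟩
  · rw [bval_add, bval_add, e3, pow_add]
    rw [e1] at h2
    rw [e2] at h3
    have h4 := h3.trans (h1.add_right e)
    have b1 := bval_lt m x s
    have b2 := bval_lt m x (act L (act P s))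
    zify at b1 b2
    set a : ℤ := (bval m x s : ℤ)
    set a' : ℤ := (bval m x (act L (act P s)) : ℤ)
    have hpos : (0 : ℤ) < 2 ^ m := by positivity
    have ha : 0 ≤ a := Int.natCast_nonneg _
    have ha' : 0 ≤ a' := Int.natCast_nonneg _
    have hlow : a' + 2 ^ m * (if (2 : ℤ) ^ m ≤ a + c then 1 else 0) = a + c := by
      obtain ⟨t, ht⟩ := h2.symm.dvd
      generalize (2 : ℤ) ^ m = M at *
      have ht1 : t < 1 := by
        by_contra hcon
        have : M * 1 ≤ M * t := by gcongr; omega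
        linarith
      have ht2 : -2 < t := by
        by_contra hcon
        have : M * t ≤ M * (-2) := by gcongr; omega
        linarith
      split_ifs <;> rcases (by omega : t = -1 ∨ t = 0) with rfl | rfl <;> linarith
    push_cast
    have h5 := (h4.mul_left' (c := 2 ^ m)).add_left a'
    have h6 : (a' : ℤ) + 2 ^ m * (bval k (fun i => x (m + i)) s +
        (if (2 : ℤ) ^ m ≤ a + c then 1 else 0) + e) =
        a + 2 ^ m * bval k (fun i => x (m + i)) s + (c + 2 ^ m * e) := by
      linear_combination hlow
    rw [h6] at h5
    exact h5
  · rw [h3' w fun j hj => hw _ (by omega), h2' w fun i hi => hw _ (by omega),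
      h1' w fun j hj => hw _ (by omega)]

/-- Split the register in the middle. Additions on one half use the other half as dirty wires, and
the single wire `g` conveys the carry as in `isAddBy_carry`. There is no recursion, so the bounds of
`exists_add_dirty` survive up to constants. -/
theorem exists_add : ∃ A : ℕ, ∀ (W : Type) [DecidableEq W] (n : ℕ) (x : ℕ → W) (g : W) (c : ℤ),
    1 ≤ n → Set.InjOn x (Set.Iio n) → (∀ i < n, x i ≠ g) →
    ∃ C : Circuit W, Cost C (x '' Set.Iio n ∪ {g}) (A * n * (Nat.log 2 n + 1))
      (A * (Nat.log 2 n + 1) ^ 2) ∧ IsAddBy C n x fun _ => c := by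
  obtain ⟨A, hA⟩ := exists_add_dirty
  obtain ⟨B, hB⟩ := exists_add_short 32
  -- `B` is for short registers; otherwise there are six additions, two fan-outs at 7 each, and two
  -- `X` gates.
  refine ⟨B + 6 * A + 16, fun W _ n x g c hn hx hg => ?_⟩
  have hlog0 : 1 ≤ Nat.log 2 n + 1 := by omega
  have hlog2 : Nat.log 2 n + 1 ≤ (Nat.log 2 n + 1) ^ 2 := by nlinarith
  by_cases hshort : n < 32
  · obtain ⟨C, hC, hs⟩ := hB W n x g c hshort hx hg
    refine ⟨C, hC.mono le_rfl ?_ ?_, hs⟩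
    · have h1 : 1 ≤ n * (Nat.log 2 n + 1) := Nat.mul_pos hn (by omega)
      calc B ≤ B * (n * (Nat.log 2 n + 1)) := Nat.le_mul_of_pos_right _ h1
        _ ≤ (B + 6 * A + 16) * (n * (Nat.log 2 n + 1)) := Nat.mul_le_mul_right _ (by omega)
        _ = _ := by ring
    · calc B ≤ B * (Nat.log 2 n + 1) ^ 2 := Nat.le_mul_of_pos_right _ (by positivity)
        _ ≤ _ := Nat.mul_le_mul_right _ (by omega)
  obtain ⟨m, hm⟩ : ∃ m, m = n / 2 := ⟨_, rfl⟩
  obtain ⟨k, hk⟩ : ∃ k, k = n - m := ⟨_, rfl⟩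
  have hmk : n = m + k := by omega
  let z : ℕ → W := fun i => x (m + i)
  have hxm : Set.InjOn x (Set.Iio m) := hx.mono fun i hi => by rw [Set.mem_Iio] at hi ⊢; omega
  have hz : Set.InjOn z (Set.Iio k) := by
    intro i hi j hj h
    rw [Set.mem_Iio] at hi hj
    have := hx (by rw [Set.mem_Iio]; omega) (by rw [Set.mem_Iio]; omega) h
    omega
  have hxz : ∀ i < m, ∀ j < k, x i ≠ z j := by
    intro i hi j hj h
    have := hx (by rw [Set.mem_Iio]; omega) (by rw [Set.mem_Iio]; omega) h
    omega
  have hxg : ∀ i < m, x i ≠ g := fun i hi => hg i (by omega)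
  have hzg : ∀ i < k, z i ≠ g := fun i hi => hg _ (by omega)
  have hsub : ∀ {a b : ℕ} {u v : ℕ → W}, (∀ i < a, u i ∈ x '' Set.Iio n ∪ {g}) →
      (∀ i < b, v i ∈ x '' Set.Iio n ∪ {g}) →
      u '' Set.Iio a ∪ v '' Set.Iio b ⊆ x '' Set.Iio n ∪ {g} := by
    rintro a b u v hu hv _ (⟨i, hi, rfl⟩ | ⟨i, hi, rfl⟩)
    exacts [hu i hi, hv i hi]
  have mx : ∀ i < m, x i ∈ x '' Set.Iio n ∪ {g} := fun i hi =>
    Or.inl ⟨i, by rw [Set.mem_Iio]; omega, rfl⟩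
  have mz : ∀ i < k, z i ∈ x '' Set.Iio n ∪ {g} := fun i hi =>
    Or.inl ⟨m + i, by rw [Set.mem_Iio]; omega, rfl⟩
  have mg : g ∈ x '' Set.Iio n ∪ {g} := Or.inr rfl
  have mc : ∀ i < k + 1, consReg g z i ∈ x '' Set.Iio n ∪ {g} := by
    intro i hi
    rw [consReg]
    split_ifs
    exacts [mg, mz _ (by omega)]
  have ms : ∀ i < m + 1, snocReg m x g i ∈ x '' Set.Iio n ∪ {g} := by
    intro i hi
    rw [snocReg]
    split_ifs with h
    exacts [mx _ h, mg]
  have hcost : ∀ a, a ≤ n → A * a * (Nat.log 2 a + 1) ≤ A * n * (Nat.log 2 n + 1) ∧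
      A * (Nat.log 2 a + 1) ^ 2 ≤ A * (Nat.log 2 n + 1) ^ 2 := by
    intro a ha
    have : Nat.log 2 a ≤ Nat.log 2 n := Nat.log_mono_right ha
    exact ⟨by gcongr, by gcongr⟩
  have hm0 : (0 : ℤ) < 2 ^ m := by positivity
  -- This adder on `k + 1` wires borrows `k - 1` wires from the low half, which has at least that
  -- many since `k ≤ m + 1`.
  obtain ⟨H₁, hH₁, hHs₁⟩ := hA W (k + 1) (consReg g z) x 1 (by omega) (consReg_injOn hz hzg)
    (hxm.mono fun i hi => by rw [Set.mem_Iio] at hi ⊢; omega) (by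
      intro i hi j hj
      rw [consReg]
      split_ifs
      exacts [(hxg _ (by omega)).symm, (hxz _ (by omega) _ (by omega)).symm])
  obtain ⟨L₁, hL₁, hLs₁⟩ := hA W (m + 1) (snocReg m x g) z (c % 2 ^ m) (by omega)
    (snocReg_injOn hxm hxg)
    (hz.mono fun i hi => by rw [Set.mem_Iio] at hi ⊢; omega) (by
      intro i hi j hj
      rw [snocReg]
      split_ifs with h
      exacts [hxz _ h _ (by omega), (hzg _ (by omega)).symm])
  obtain ⟨F, hF, hFs⟩ := exists_notFan W k z g hz hzg
  obtain ⟨L, hL, hLs⟩ := hA W m x z (c % 2 ^ m) (by omega) hxm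
    (hz.mono fun i hi => by rw [Set.mem_Iio] at hi ⊢; omega)
    (fun i hi j hj => hxz i hi j (by omega))
  obtain ⟨H, hH, hHs⟩ := hA W k z x (c / 2 ^ m) (by omega) hz
    (hxm.mono fun i hi => by rw [Set.mem_Iio] at hi ⊢; omega)
    (fun i hi j hj => (hxz j (by omega) i hi).symm)
  have hcarry := isAddBy_carry (Int.emod_nonneg c hm0.ne') (Int.emod_lt_of_pos c hm0)
    (hHs₁.addBit hzg) hLs₁ hFs hxz hzg
  have key := isAddBy_concat (Int.emod_nonneg c hm0.ne') (Int.emod_lt_of_pos c hm0)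
    (by rwa [← hmk]) hcarry hLs hHs
  have cH₁ := hH₁.mono (hsub mc fun i hi => mx i (by omega)) (hcost (k + 1) (by omega)).1
    (hcost (k + 1) (by omega)).2
  have cL₁ := hL₁.mono (hsub ms fun i hi => mz i (by omega)) (hcost (m + 1) (by omega)).1
    (hcost (m + 1) (by omega)).2
  have cL := hL.mono (hsub mx fun i hi => mz i (by omega)) (hcost m (by omega)).1
    (hcost m (by omega)).2
  have cH := hH.mono (hsub mz fun i hi => mx i (by omega)) (hcost k (by omega)).1
    (hcost k (by omega)).2
  have hlk : Nat.log 2 k ≤ Nat.log 2 n := Nat.log_mono_right (by omega)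
  have cF : Cost F (x '' Set.Iio n ∪ {g}) (7 * n * (Nat.log 2 n + 1)) (7 * (Nat.log 2 n + 1) ^ 2) := by
    refine hF.mono ?_ ?_ ?_
    · rintro _ (⟨i, hi, rfl⟩ | rfl)
      exacts [mz i hi, mg]
    · have : 4 * k * (Nat.log 2 k + 1) ≤ 4 * n * (Nat.log 2 n + 1) := by
        gcongr; omega
      nlinarith
    · nlinarith
  have cX : Cost (xg g) (x '' Set.Iio n ∪ {g}) 1 1 :=
    (Cost.xg g).mono Set.subset_union_right le_rfl le_rfl
  have cHX := cH₁.append cX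
  have total := (((cF.append (((cHX.append cL₁).append cHX.reverse).append cL₁.reverse)).append
    cF).append cL).append cH
  refine ⟨_, total.mono le_rfl ?_ ?_, ?_⟩
  · nlinarith [Nat.zero_le (B * n * (Nat.log 2 n + 1))]
  · nlinarith [Nat.zero_le (B * (Nat.log 2 n + 1) ^ 2)]
  · rw [← hmk] at key
    exact key.congr fun s => Int.emod_add_mul_ediv c (2 ^ m)

/-! ### Controlled addition of a constant -/

/-- A signed addition, turned into a controlled one. -/
theorem IsAddBy.toggle {E M : Circuit W} {n : ℕ} {x : ℕ → W} {g : W} {U : Finset W} {a b : ℤ}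
    (hE : IsAddBy E n x fun s => if s g then a else b) (hM : IsMCX M U g) (hxg : ∀ i < n, x i ≠ g)
    (hxU : ∀ i < n, x i ∉ U) (hgU : g ∉ U) :
    IsAddBy (E ++ M ++ E.reverse ++ M) n x
      fun s => if s g then (if ∀ q ∈ U, s q = true then a - b else 0) else
        -(if ∀ q ∈ U, s q = true then a - b else 0) := by
  intro s
  simp only [act_append]
  have hEr := hE.reverse fun s => by simp only [(hE s).2 g fun i hi => (hxg i hi).symm]
  obtain ⟨h1, h1'⟩ := hE s
  set s₁ := act E s
  have hg1 : s₁ g = s g := h1' g fun i hi => (hxg i hi).symm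
  have hU1 : (∀ q ∈ U, s₁ q = true) ↔ ∀ q ∈ U, s q = true :=
    forall₂_congr fun q hq => by rw [h1' q fun i hi h => hxU i hi (h ▸ hq)]
  have hs2 : act M s₁ = xorAt g (decide (∀ q ∈ U, s q = true)) s₁ := by
    rw [hM, decide_eq_decide.2 hU1]
  obtain ⟨h3, h3'⟩ := hEr (act M s₁)
  rw [hs2] at h3 h3' ⊢
  set u := decide (∀ q ∈ U, s q = true) with hu
  set s₃ := act E.reverse (xorAt g u s₁)
  have hU3 : (∀ q ∈ U, s₃ q = true) ↔ ∀ q ∈ U, s q = true := by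
    rw [← hU1, ← xorAt_of_notMem hgU u s₁]
    exact forall₂_congr fun q hq => by rw [h3' q fun i hi h => hxU i hi (h ▸ hq)]
  have hs4 : act M s₃ = xorAt g u s₃ := by rw [hM, decide_eq_decide.2 hU3]
  rw [hs4]
  have e1 : bval n x (xorAt g u s₃) = bval n x s₃ :=
    bval_congr fun i hi => xorAt_of_ne (hxg i hi) _ _
  have e2 : bval n x (xorAt g u s₁) = bval n x s₁ :=
    bval_congr fun i hi => xorAt_of_ne (hxg i hi) _ _
  refine ⟨?_, fun w hw => ?_⟩
  · rw [e1]
    refine h3.trans ?_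
    rw [e2]
    -- The reversed `E` sees `g` flipped under the controls. If it was not flipped, it cancels `E`;
    -- if it was, `a - b` or `b - a` remains, depending on `g`.
    change _ + -(if xorAt g u s₁ g = true then a else b) ≡ _ [ZMOD 2 ^ n]
    rw [xorAt_same, hg1]
    refine (h1.add_right _).trans ?_
    refine congrArg (· % (2 : ℤ) ^ n) ?_
    beta_reduce
    by_cases hall : ∀ q ∈ U, s q = true
    · rw [hu, decide_eq_true hall, if_pos hall]
      cases s g <;> simp only [Bool.xor_true, Bool.not_true, Bool.not_false, if_true,
        Bool.false_eq_true, if_false] <;> ring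
    · rw [hu, decide_eq_false hall, if_neg hall]
      cases s g <;> simp
  · by_cases hwg : w = g
    · subst hwg
      rw [xorAt_same, h3' w hw, xorAt_same, hg1]
      simp
    · rw [xorAt_of_ne hwg, h3' w hw, xorAt_of_ne hwg, h1' w hw]

/-- An addition that depends only on the dirty bit `g` is run forwards, then backwards after `g` has
been flipped under the controls. The difference of the two constants remains, up to a sign that a
conditional negation repairs. Only one multiply controlled gate is used, twice, so the controls
enter additively in the cost. -/
theorem exists_controlled_add : ∃ A : ℕ, ∀ (W : Type) [DecidableEq W] (n : ℕ) (x : ℕ → W)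
    (U : Finset W) (g : W) (c : ℤ), 1 ≤ n → Set.InjOn x (Set.Iio n) → (∀ i < n, x i ≠ g) →
    (∀ i < n, x i ∉ U) → g ∉ U → U.Nonempty →
    ∃ C : Circuit W, Cost C (x '' Set.Iio n ∪ U ∪ {g}) (A * (U.card + n * (Nat.log 2 n + 1)))
      (A * (Nat.log 2 U.card + (Nat.log 2 n + 1) ^ 2)) ∧
      IsAddBy C n x fun s => if ∀ q ∈ U, s q = true then c else 0 := by
  obtain ⟨A, hA⟩ := exists_add
  obtain ⟨B, hB⟩ := exists_hasMCX
  refine ⟨16 * A + 4 * B + 60, fun W _ n x U g c hn hx hxg hxU hgU hU => ?_⟩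
  obtain ⟨q, hq⟩ := hU
  have hxq : ∀ i < n, x i ≠ q := fun i hi h => hxU i hi (h ▸ hq)
  have hqg : g ≠ q := fun h => hgU (h ▸ hq)
  set T : Set W := x '' Set.Iio n ∪ U ∪ {g} with hT
  have hxT : ∀ i < n, x i ∈ T := fun i hi => Or.inl (Or.inl ⟨i, hi, rfl⟩)
  have hUT : (U : Set W) ⊆ T := fun w hw => Or.inl (Or.inr hw)
  have hgT : g ∈ T := Or.inr rfl
  have hxgT : x '' Set.Iio n ∪ {g} ⊆ T := by
    rintro _ (⟨i, hi, rfl⟩ | rfl)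
    exacts [hxT i hi, hgT]
  set ℓ := n * (Nat.log 2 n + 1) with hℓ
  set δ := (Nat.log 2 n + 1) ^ 2 with hδ
  have hℓ1 : 1 ≤ ℓ := Nat.mul_pos hn (by omega)
  have hδ1 : 1 ≤ δ := Nat.one_le_pow _ _ (by omega)
  have hlδ : Nat.log 2 n + 1 ≤ δ := by nlinarith
  obtain ⟨F, hF, hFs⟩ := exists_notFan W n x g hx hxg
  have cF : Cost F T (7 * ℓ) (7 * δ) := hF.mono hxgT (by rw [mul_assoc]; omega) (by omega)
  obtain ⟨P, hP, hPs⟩ := hA W n x g (c / 2) hn hx hxg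
  have cP : Cost P T (A * ℓ) (A * δ) := hP.mono hxgT (by rw [mul_assoc]) le_rfl
  have hsgn := hPs.conj_sign hFs hxg fun _ => rfl
  have cS := (cF.append cP).append cF
  -- For odd `c` the two constants must have different absolute values, so `g` itself is added as
  -- well. Here `g` is part of the register, and a control `q` is the dirty wire.
  obtain ⟨G, hG, hGs⟩ := hA W (n + 1) (consReg g x) q 1 (by omega) (consReg_injOn hx hxg)
    (by
      intro i hi
      rw [consReg]
      split_ifs
      exacts [hqg, hxq _ (by omega)])
  have hln : Nat.log 2 (n + 1) ≤ Nat.log 2 n + 1 :=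
    (Nat.log_mono_right (by omega)).trans (log_mul_two_le n)
  have cG : Cost G T (A * (4 * ℓ)) (A * (4 * δ)) := by
    refine hG.mono ?_ ?_ ?_
    · rintro _ (⟨i, hi, rfl⟩ | rfl)
      · rw [Set.mem_Iio] at hi
        rw [consReg]
        split_ifs
        exacts [hgT, hxT _ (by omega)]
      · exact hUT hq
    · rw [mul_assoc]
      refine Nat.mul_le_mul_left _ ?_
      calc (n + 1) * (Nat.log 2 (n + 1) + 1) ≤ (2 * n) * (2 * (Nat.log 2 n + 1)) :=
            Nat.mul_le_mul (by omega) (by omega)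
        _ = 4 * ℓ := by rw [hℓ]; ring
    · refine Nat.mul_le_mul_left _ ?_
      calc (Nat.log 2 (n + 1) + 1) ^ 2 ≤ (2 * (Nat.log 2 n + 1)) ^ 2 :=
            Nat.pow_le_pow_left (by omega) 2
        _ = 4 * δ := by rw [hδ]; ring
  have cX : Cost (xg g) T 1 1 := (Cost.xg g).mono (by simpa using hgT) le_rfl le_rfl
  have hadd := hGs.addBit hxg
  have cGX := cG.append cX
  obtain ⟨E, cE, hE⟩ : ∃ E : Circuit W, Cost E T ((14 + 5 * A + 1) * ℓ) ((14 + 5 * A + 1) * δ) ∧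
      IsAddBy E n x fun s => if s g then c / 2 + c % 2 else -(c / 2) := by
    rcases Int.emod_two_eq_zero_or_one c with h | h
    · refine ⟨_, cS.mono le_rfl (by nlinarith) (by nlinarith), hsgn.congr fun s => ?_⟩
      rw [h, add_zero]
    · refine ⟨_, (cS.append cGX).mono le_rfl (by nlinarith) (by nlinarith),
        (hsgn.append hadd fun s => ?_).congr fun s => ?_⟩
      · rw [(hsgn s).2 g fun i hi => (hxg i hi).symm]
      · rw [h]
        cases s g <;> simp
  obtain ⟨M, hM, hMs⟩ := hB _ W U g (x 0) rfl hgU (hxU 0 hn) (hxg 0 hn)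
  have cM : Cost M T (B * (U.card + 1)) (B * (Nat.log 2 U.card + 1)) := by
    refine hM.mono ?_ le_rfl le_rfl
    rintro w (hw | rfl | rfl)
    exacts [hUT hw, hgT, hxT 0 hn]
  have key := (hE.toggle hMs hxg hxU hgU).conj_sign hFs hxg fun s => by
    have e1 : act F s g = s g := (hFs s).2 g fun i hi => (hxg i hi).symm
    have e2 : (∀ q ∈ U, act F s q = true) ↔ ∀ q ∈ U, s q = true :=
      forall₂_congr fun q hq => by rw [(hFs s).2 q fun i hi h => hxU i hi (h ▸ hq)]
    simp only [e1, e2]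
  refine ⟨_, ((cF.append (((cE.append cM).append cE.reverse).append cM)).append cF).mono le_rfl
    ?_ ?_, key.congr fun s => ?_⟩
  · nlinarith [Nat.zero_le (A * U.card), Nat.zero_le (B * ℓ), Nat.mul_le_mul_left B hℓ1,
      Nat.zero_le (A * ℓ)]
  · nlinarith [Nat.zero_le (A * Nat.log 2 U.card), Nat.zero_le (B * δ), Nat.mul_le_mul_left B hδ1,
      Nat.zero_le (A * δ)]
  · have : c / 2 + c % 2 - -(c / 2) = c := by omega
    rw [this]
    cases s g <;> simp

/-! ### Numbers and bits -/

theorem testBit_bval {m : ℕ} (x : ℕ → W) (s : W → Bool) {i : ℕ} (hi : i < m) :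
    (bval m x s).testBit i = s (x i) := by
  induction m generalizing x i with
  | zero => omega
  | succ m ih =>
    rw [bval_succ']
    rcases i with _ | i
    · cases h : s (x 0) <;> simp [Nat.testBit_zero]
    · rw [Nat.testBit_succ]
      have : ((s (x 0)).toNat + 2 * bval m (fun i => x (i + 1)) s) / 2 =
          bval m (fun i => x (i + 1)) s := by
        have := Bool.toNat_lt (s (x 0))
        omega
      rw [this, ih _ (by omega)]

theorem bval_eq_of_testBit {m : ℕ} {x : ℕ → W} {s : W → Bool} {v : ℕ} (hv : v < 2 ^ m)
    (h : ∀ i < m, s (x i) = v.testBit i) : bval m x s = v := by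
  refine Nat.eq_of_testBit_eq fun i => ?_
  by_cases hi : i < m
  · rw [testBit_bval x s hi, h i hi]
  · have hp : 2 ^ m ≤ 2 ^ i := Nat.pow_le_pow_right (by norm_num) (by omega)
    rw [Nat.testBit_lt_two_pow ((bval_lt m x s).trans_le hp),
      Nat.testBit_lt_two_pow (hv.trans_le hp)]

/-! ### Padding a circuit with pairs of `X` gates -/

/-- Operations on a common wire occupy different layers. This gives the lower bound on depth. -/
theorem countP_le_finishTime (L : List (Finset W)) (q : W) :
    L.countP (fun S => decide (q ∈ S)) ≤ finishTime L q := by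
  induction L using List.reverseRecOn with
  | nil => simp
  | append_singleton L S ih =>
    rw [finishTime_concat, List.countP_append]
    by_cases hq : q ∈ S
    · have := Finset.le_sup (f := finishTime L) hq
      simp only [List.countP_singleton, hq, decide_true, if_true]
      omega
    · simpa [List.countP_singleton, hq] using ih

/-- A trivial circuit: `2 * r` gates `X`. -/
def idleX (w : W) (r : ℕ) : Circuit W := List.replicate (2 * r) ⟨∅, w, by simp, by simp⟩

theorem act_idleX (w : W) (r : ℕ) (s : W → Bool) : act (idleX w r) s = s := by
  induction r with
  | zero => rfl
  | succ r ih =>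
    rw [idleX, show 2 * (r + 1) = 2 * r + 1 + 1 by ring, List.replicate_succ, List.replicate_succ,
      act_cons, act_cons, Gate.act_act]
    exact ih

theorem Cost.idleX (w : W) (r : ℕ) : Cost (idleX w r) {w} (2 * r) (2 * r) := by
  refine ⟨fun g hg => ?_, by simp [QCirc.idleX], ?_⟩
  · obtain rfl := List.eq_of_mem_replicate hg
    simp [Gate.support]
  · simpa [QCirc.idleX] using Sched.of_length ((QCirc.idleX w r).map Gate.support)

/-- Any circuit can be made longer and deeper. -/
theorem exists_padding [Fintype W] (C : Circuit W) (r : W → ℕ) (q : W) (hr : ∀ w, r w ≤ r q)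
    (hC : Cost C Set.univ ℓ d) : ∃ D : Circuit W, (∀ s, act D s = act C s) ∧
      2 * ∑ w, r w ≤ D.length ∧ D.length ≤ ℓ + 2 * ∑ w, r w ∧
      2 * r q ≤ Circuit.depth D ∧ Circuit.depth D ≤ d + 2 * r q := by
  set P : Circuit W := Finset.univ.toList.flatMap fun w => idleX w (r w) with hP
  have hlen : P.length = 2 * ∑ w, r w := by
    rw [hP, List.length_flatMap, Finset.mul_sum, ← Finset.sum_map_toList]
    simp [idleX]
  have hcost := Cost.parallel (T := Set.univ) (Finset.univ : Finset W).toList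
    (fun w => idleX w (r w)) (fun w => {w}) (2 * r q) (2 * r q)
    (fun w _ => (Cost.idleX w (r w)).mono le_rfl (by have := hr w; omega)
      (by have := hr w; omega))
    ((Finset.nodup_toList _).imp fun h => by simpa using h) (fun _ _ => Set.subset_univ _)
  have hact : ∀ s, act P s = s := by
    rw [hP]
    generalize (Finset.univ : Finset W).toList = I
    intro s
    induction I with
    | nil => rfl
    | cons i I ih => rw [List.flatMap_cons, act_append, act_idleX, ih]
  refine ⟨C ++ P, fun s => by rw [act_append, hact], ?_, ?_, ?_, ?_⟩
  · rw [List.length_append, hlen]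
    omega
  · rw [List.length_append, hlen]
    exact Nat.add_le_add_right hC.len _
  · have h1 : (idleX q (r q)).Sublist (C ++ P) := by
      refine (List.sublist_flatten_of_mem ?_).trans (List.sublist_append_right _ _)
      exact List.mem_map.2 ⟨q, by simp, rfl⟩
    have h2 := (h1.map Gate.support).countP_le (p := fun S => decide (q ∈ S))
    have h3 := countP_le_finishTime ((C ++ P).map Gate.support) q
    have h4 : ((idleX q (r q)).map Gate.support).countP (fun S => decide (q ∈ S)) = 2 * r q := by
      simp [idleX, Gate.support, List.countP_replicate]
    rw [h4] at h2
    exact (h2.trans h3).trans (Finset.le_sup (Finset.mem_univ q))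
  · have := hC.sched.append hcost.sched
    rw [← List.map_append] at this
    exact this.schedDepth_le

/-! ### Comparison of logarithms -/

theorem natLog_le_two_mul_log (n : ℕ) : (Nat.log 2 n : ℝ) ≤ 2 * Real.log n := by
  rcases Nat.eq_zero_or_pos n with rfl | hn
  · simp
  · have h1 : ((2 : ℝ) ^ Nat.log 2 n) ≤ n := by exact_mod_cast Nat.pow_log_le_self 2 hn.ne'
    have h2 := Real.log_le_log (by positivity) h1
    rw [Real.log_pow] at h2
    have := Real.log_two_gt_d9
    nlinarith [Nat.cast_nonneg (α := ℝ) (Nat.log 2 n)]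

theorem log_le_natLog_add_one (n : ℕ) : Real.log n ≤ Nat.log 2 n + 1 := by
  rcases Nat.eq_zero_or_pos n with rfl | hn
  · simp
  · have h1 : (n : ℝ) ≤ 2 ^ (Nat.log 2 n + 1) := by
      exact_mod_cast (Nat.lt_pow_succ_log_self (by norm_num) n).le
    have h2 := Real.log_le_log (by positivity) h1
    rw [Real.log_pow] at h2
    have := Real.log_two_lt_d9
    push_cast at h2
    nlinarith [Nat.cast_nonneg (α := ℝ) (Nat.log 2 n)]

theorem one_le_two_mul_log {n : ℕ} (hn : 2 ≤ n) : 1 ≤ 2 * Real.log n := by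
  have h1 := Real.log_le_log (by norm_num) (show (2 : ℝ) ≤ n by exact_mod_cast hn)
  have := Real.log_two_gt_d9
  linarith

/-! ### The controlled classical–quantum adder -/

/-- The register of the adder. -/
def adderReg (k n i : ℕ) : AdderQubit k n :=
  if h : i < n then .inr (.inl ⟨i, h⟩) else .inr (.inr ())

theorem adderReg_of_lt {k n i : ℕ} (h : i < n) : adderReg k n i = .inr (.inl ⟨i, h⟩) := dif_pos h

theorem bval_adderReg {k n : ℕ} (s : AdderQubit k n → Bool) :
    bval n (adderReg k n) s = Nat.ofBits fun i : Fin n => s (.inr (.inl i)) := by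
  refine bval_eq_of_testBit (Nat.ofBits_lt_two_pow _) fun i hi => ?_
  rw [adderReg_of_lt hi, Nat.testBit_ofBits_lt _ _ hi]

theorem implements_controlledAdder {k n : ℕ} {c : Fin n → Bool} {C : Circuit (AdderQubit k n)}
    (hC : IsAddBy C n (adderReg k n)
      fun s => if ∀ q ∈ Finset.univ.image (Sum.inl : Fin k → AdderQubit k n), s q = true then
        (Nat.ofBits c : ℤ) else 0) :
    Circuit.Implements C (controlledAdder c) := by
  intro s
  rw [apply_ket]
  congr 1
  obtain ⟨h1, h2⟩ := hC s
  have hoff : ∀ w, (∀ i : Fin n, w ≠ .inr (.inl i)) → act C s w = s w := fun w hw =>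
    h2 w fun i hi => by rw [adderReg_of_lt hi]; exact hw _
  ext w
  rcases w with i | i | i
  · exact hoff _ (by simp)
  · change _ = (if ∀ i, s (.inl i) = true then addConst c _ else _) i
    have e : act C s (.inr (.inl i)) = (bval n (adderReg k n) (act C s)).testBit i := by
      rw [testBit_bval _ _ i.2, adderReg_of_lt i.2]
    have e' : s (.inr (.inl i)) = (bval n (adderReg k n) s).testBit i := by
      rw [testBit_bval _ _ i.2, adderReg_of_lt i.2]
    have hall : (∀ q ∈ Finset.univ.image (Sum.inl : Fin k → AdderQubit k n), s q = true) ↔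
        ∀ i, s (.inl i) = true := by simp
    beta_reduce at h1
    rw [e]
    split_ifs with h
    · rw [if_pos (hall.2 h), bval_adderReg s] at h1
      rw [addConst]
      congr 1
      refine eq_of_modEq_of_lt (M := 2 ^ n) ?_ (bval_lt _ _ _) (Nat.mod_lt _ (by positivity))
      push_cast
      exact h1.trans (Int.mod_modEq _ _).symm
    · rw [if_neg fun h' => h (hall.1 h'), add_zero] at h1
      refine Eq.trans ?_ e'.symm
      congr 1
      exact eq_of_modEq_of_lt (M := 2 ^ n) (by exact_mod_cast h1) (bval_lt _ _ _) (bval_lt _ _ _)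
  · exact hoff _ (by simp)

theorem exists_adder_circuit : ∃ A : ℕ, ∀ k n : ℕ, 1 ≤ n → ∀ c : Fin n → Bool,
    ∃ C : Circuit (AdderQubit k n), Circuit.Implements C (controlledAdder c) ∧
      Cost C Set.univ (A * (k + n * (Nat.log 2 n + 1)))
        (A * (Nat.log 2 k + (Nat.log 2 n + 1) ^ 2)) := by
  obtain ⟨A, hA⟩ := exists_add
  obtain ⟨B, hB⟩ := exists_controlled_add
  refine ⟨A + B, fun k n hn c => ?_⟩
  have hx : Set.InjOn (adderReg k n) (Set.Iio n) := by
    intro i hi j hj h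
    rw [adderReg_of_lt hi, adderReg_of_lt hj] at h
    exact congrArg Fin.val (Sum.inl.inj (Sum.inr.inj h))
  have hxg : ∀ i < n, adderReg k n i ≠ .inr (.inr ()) := fun i hi => by
    rw [adderReg_of_lt hi]; simp
  rcases Nat.eq_zero_or_pos k with rfl | hk
  · obtain ⟨C, hC, hs⟩ := hA (AdderQubit 0 n) n (adderReg 0 n) (.inr (.inr ())) (Nat.ofBits c) hn
      hx hxg
    refine ⟨C, implements_controlledAdder (hs.congr fun s => by simp),
      hC.mono (Set.subset_univ _) ?_ ?_⟩
    · nlinarith [Nat.zero_le (B * (n * (Nat.log 2 n + 1)))]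
    · nlinarith [Nat.zero_le (B * (Nat.log 2 n + 1) ^ 2), Nat.zero_le ((A + B) * Nat.log 2 0)]
  · obtain ⟨C, hC, hs⟩ := hB (AdderQubit k n) n (adderReg k n)
      (Finset.univ.image (Sum.inl : Fin k → AdderQubit k n)) (.inr (.inr ())) (Nat.ofBits c) hn
      hx hxg (fun i hi => by rw [adderReg_of_lt hi]; simp) (by simp)
      ⟨.inl ⟨0, hk⟩, by simp⟩
    have hcard : (Finset.univ.image (Sum.inl : Fin k → AdderQubit k n)).card = k := by
      rw [Finset.card_image_of_injective _ Sum.inl_injective, Finset.card_univ, Fintype.card_fin]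
    rw [hcard] at hC
    exact ⟨C, implements_controlledAdder (hs.congr fun s => by congr), hC.mono (Set.subset_univ _)
      (Nat.mul_le_mul_right _ (by omega)) (Nat.mul_le_mul_right _ (by omega))⟩

theorem natLog_bound_length {k n : ℕ} (hn : 1 ≤ n) (h : 2 ≤ k ∨ 2 ≤ n) :
    ((k + n * (Nat.log 2 n + 1) : ℕ) : ℝ) ≤ 4 * (k + n * Real.log n) := by
  have h1 := natLog_le_two_mul_log n
  have hn0 : (0 : ℝ) ≤ n := Nat.cast_nonneg n
  have hk0 : (0 : ℝ) ≤ k := Nat.cast_nonneg k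
  have h2 := mul_le_mul_of_nonneg_left h1 hn0
  push_cast
  rcases Nat.lt_or_ge n 2 with hn2 | hn2
  · obtain rfl : n = 1 := by omega
    have : (2 : ℝ) ≤ k := by exact_mod_cast (by omega : 2 ≤ k)
    norm_num
    linarith
  · have := mul_le_mul_of_nonneg_left (one_le_two_mul_log hn2) hn0
    linarith

/-- The additive constant on the left is paid for by `log n` if `n ≥ 2`, and otherwise by `log k`
with `k ≥ 2`. -/
theorem natLog_bound_depth {k n : ℕ} (hn : 1 ≤ n) (h : 2 ≤ k ∨ 2 ≤ n) :
    ((Nat.log 2 k + (Nat.log 2 n + 1) ^ 2 : ℕ) : ℝ) ≤ 16 * (Real.log k + Real.log n ^ 2) := by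
  have hk := natLog_le_two_mul_log k
  have h1 := natLog_le_two_mul_log n
  have hk0 := Real.log_natCast_nonneg k
  push_cast
  rcases Nat.lt_or_ge n 2 with hn2 | hn2
  · obtain rfl : n = 1 := by omega
    have := one_le_two_mul_log (show 2 ≤ k by omega)
    norm_num
    linarith
  · have h2 := one_le_two_mul_log hn2
    have : ((Nat.log 2 n : ℝ) + 1) ^ 2 ≤ (4 * Real.log n) ^ 2 :=
      pow_le_pow_left₀ (by positivity) (by linarith) 2
    nlinarith

/-- The controlled adder. The lower bounds are reached by adding pairs of `X` gates. -/
theorem exists_controlledAdder : ∃ A B : ℝ, 0 < A ∧ 0 < B ∧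
    ∀ k n : ℕ, 1 ≤ n → (2 ≤ k ∨ 2 ≤ n) → ∀ c : Fin n → Bool,
      ∃ C : Circuit (AdderQubit k n),
        Circuit.Implements C (controlledAdder c) ∧
        A * (k + n * Real.log n) ≤ C.length ∧
        (C.length : ℝ) ≤ B * (k + n * Real.log n) ∧
        A * (Real.log k + Real.log n ^ 2) ≤ Circuit.depth C ∧
        (Circuit.depth C : ℝ) ≤ B * (Real.log k + Real.log n ^ 2) := by
  obtain ⟨A, hA⟩ := exists_adder_circuit
  refine ⟨1, 16 * (A + 6), one_pos, by positivity, fun k n hn h c => ?_⟩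
  obtain ⟨C, hC, hcost⟩ := hA k n hn c
  set l := Nat.log 2 n + 1 with hl
  set δ := Nat.log 2 k + 1 + l ^ 2 with hδ
  have hl1 : 1 ≤ l := by omega
  have hll : l ≤ l ^ 2 := Nat.le_self_pow (by norm_num) l
  -- Pairs of `X`: one per control and `l` per register wire give the size `k + n * l`, and `δ` on
  -- the ancilla give the depth. As `l ≤ n`, the latter do not change the order of the size.
  let r : AdderQubit k n → ℕ := Sum.elim (fun _ => 1) (Sum.elim (fun _ => l) fun _ => δ)
  have hr : ∑ w, r w = k + n * l + δ := by
    simp [r, Fintype.sum_sum_type, add_assoc]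
  obtain ⟨D, hD, h1, h2, h3, h4⟩ := exists_padding C r (.inr (.inr ()))
    (by rintro (i | i | i) <;> simp only [r, Sum.elim_inl, Sum.elim_inr] <;> omega) hcost
  rw [hr] at h1 h2
  have hrq : r (.inr (.inr ())) = δ := rfl
  rw [hrq] at h3 h4
  have hln : l ≤ n := Nat.log_lt_self 2 (by omega)
  have hlk : Nat.log 2 k ≤ k := Nat.log_le_self 2 k
  have hδℓ : δ ≤ 2 * (k + n * l) := by nlinarith [Nat.mul_le_mul_right l hln]
  have hlogn := log_le_natLog_add_one n
  have hlogn0 := Real.log_natCast_nonneg n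
  refine ⟨D, fun s => ?_, ?_, ?_, ?_, ?_⟩
  · rw [apply_ket, hD, ← apply_ket, hC]
  · have : ((k + n * l : ℕ) : ℝ) ≤ D.length := by exact_mod_cast (by omega)
    push_cast [hl] at this
    nlinarith [mul_le_mul_of_nonneg_left hlogn (Nat.cast_nonneg (α := ℝ) n)]
  · have e : D.length ≤ (A + 6) * (k + n * l) := by linarith
    have := natLog_bound_length hn h
    calc (D.length : ℝ) ≤ ((A + 6) * (k + n * l) : ℕ) := by exact_mod_cast e
      _ = (A + 6) * ((k + n * l : ℕ) : ℝ) := by push_cast; ring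
      _ ≤ (A + 6) * (4 * (k + n * Real.log n)) :=
        mul_le_mul_of_nonneg_left this (by positivity)
      _ ≤ _ := by
        have : 0 ≤ ((A : ℝ) + 6) * (k + n * Real.log n) := by positivity
        nlinarith
  · have e : ((Nat.log 2 k + 1 + l ^ 2 : ℕ) : ℝ) ≤ Circuit.depth D := by exact_mod_cast (by omega)
    push_cast [hl] at e
    have := log_le_natLog_add_one k
    have h5 := pow_le_pow_left₀ hlogn0 hlogn 2
    linarith
  · have e : Circuit.depth D ≤ (A + 6) * (Nat.log 2 k + l ^ 2) := by nlinarith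
    have := natLog_bound_depth hn h
    calc (Circuit.depth D : ℝ) ≤ ((A + 6) * (Nat.log 2 k + l ^ 2) : ℕ) := by exact_mod_cast e
      _ = (A + 6) * ((Nat.log 2 k + l ^ 2 : ℕ) : ℝ) := by push_cast; ring
      _ ≤ (A + 6) * (16 * (Real.log k + Real.log n ^ 2)) :=
        mul_le_mul_of_nonneg_left this (by positivity)
      _ = _ := by ring

/-! ### Controlled modular addition of a constant -/

theorem eq_of_modEq_of_add {M a b : ℕ} {c : ℤ} (h : (a : ℤ) ≡ c [ZMOD (M : ℤ)]) (k : ℤ)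
    (e : (b : ℤ) = c + k * M) (ha : a < M) (hb : b < M) : a = b := by
  refine eq_of_modEq_of_lt (h.trans ?_) ha hb
  rw [e]
  exact (Int.modEq_iff_dvd).2 ⟨k, by ring⟩

/-- Arithmetic of a modular addition with an overflow bit: `v` and `g` are the values of the
register and of the overflow bit, before and after four additions. -/
theorem modAdd_values {p N t v₀ v₁ v₂ v₃ v₄ : ℕ} {u g₁ g₃ : Bool} (hN : N < p) (ht : t < N)
    (h0 : v₀ < N) (l1 : v₁ < p) (l2 : v₂ < p) (l3 : v₃ < p) (l4 : v₄ < p)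
    (h1 : ((v₁ + p * g₁.toNat : ℕ) : ℤ) ≡ v₀ + (if u then (t : ℤ) - N else 0)
      [ZMOD ((2 * p : ℕ) : ℤ)])
    (h2 : (v₂ : ℤ) ≡ v₁ + (if g₁ then (N : ℤ) else 0) [ZMOD (p : ℤ)])
    (h3 : ((v₃ + p * g₃.toNat : ℕ) : ℤ) ≡ ((v₂ + p * g₁.toNat : ℕ) : ℤ) +
      (if u then -(t : ℤ) else 0) [ZMOD ((2 * p : ℕ) : ℤ)])
    (h4 : (v₄ : ℤ) ≡ v₃ + (if u then (t : ℤ) else 0) [ZMOD (p : ℤ)]) :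
    v₄ = (v₀ + if u then t else 0) % N ∧ g₃ = u := by
  have hg : ∀ b : Bool, p * b.toNat = if b then p else 0 := by intro b; cases b <;> simp
  have e1 : v₁ + p * g₁.toNat < 2 * p := by rw [hg]; split_ifs <;> omega
  have e3 : v₃ + p * g₃.toNat < 2 * p := by rw [hg]; split_ifs <;> omega
  rcases u with _ | _
  -- If `u` is off, no addition takes place and the overflow bit stays `0`.
  · simp only [Bool.false_eq_true, if_false, add_zero] at *
    have k1 := eq_of_modEq_of_add (b := v₀) h1 0 (by ring) e1 (by omega)
    have : g₁ = false := by cases g₁ <;> simp at k1 ⊢; omega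
    subst this
    simp only [Bool.false_eq_true, if_false, add_zero, Bool.toNat_false, mul_zero] at *
    have k2 := eq_of_modEq_of_add (b := v₁) h2 0 (by ring) l2 (by omega)
    have k3 := eq_of_modEq_of_add (b := v₂) h3 0 (by ring) e3 (by omega)
    have : g₃ = false := by cases g₃ <;> simp at k3 ⊢; omega
    subst this
    have k4 := eq_of_modEq_of_add (b := v₃) h4 0 (by ring) l4 (by omega)
    simp only [Bool.toNat_false, mul_zero, add_zero] at k3
    rw [Nat.mod_eq_of_lt h0]
    exact ⟨by omega, rfl⟩
  · simp only [if_true] at *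
    rcases Nat.lt_or_ge (v₀ + t) N with hlt | hge
    -- No reduction needed: subtracting `N` wraps around and sets the overflow bit, `N` is added
    -- back, and subtracting `t` does not borrow, so the bit remains `1`.
    · have k1 := eq_of_modEq_of_add (b := v₀ + t + 2 * p - N) h1 1 (by omega) e1 (by omega)
      have : g₁ = true := by cases g₁ <;> simp at k1 ⊢; omega
      subst this
      simp only [if_true, Bool.toNat_true, mul_one] at *
      have k2 := eq_of_modEq_of_add (b := v₀ + t) h2 (-1) (by omega) l2 (by omega)
      have k3 := eq_of_modEq_of_add (b := v₀ + p) h3 0 (by omega) e3 (by omega)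
      have : g₃ = true := by cases g₃ <;> simp at k3 ⊢; omega
      subst this
      simp only [Bool.toNat_true, mul_one] at k3
      have k4 := eq_of_modEq_of_add (b := v₀ + t) h4 0 (by omega) l4 (by omega)
      rw [Nat.mod_eq_of_lt hlt]
      exact ⟨k4, rfl⟩
    -- Reduction needed: the overflow bit is `0`, and the result is less than `t`, so subtracting
    -- `t` borrows and sets the bit. In all cases it ends up equal to `u`.
    · have k1 := eq_of_modEq_of_add (b := v₀ + t - N) h1 0 (by omega) e1 (by omega)
      have : g₁ = false := by cases g₁ <;> simp at k1 ⊢; omega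
      subst this
      simp only [Bool.false_eq_true, if_false, add_zero, Bool.toNat_false, mul_zero] at *
      have k2 := eq_of_modEq_of_add (b := v₀ + t - N) h2 0 (by omega) l2 (by omega)
      have k3 := eq_of_modEq_of_add (b := v₀ + 2 * p - N) h3 1 (by omega) e3 (by omega)
      have : g₃ = true := by cases g₃ <;> simp at k3 ⊢; omega
      subst this
      simp only [Bool.toNat_true, mul_one] at k3
      have k4 := eq_of_modEq_of_add (b := v₀ + t - N) h4 (-1) (by omega) l4 (by omega)
      rw [Nat.mod_eq_sub_mod hge, Nat.mod_eq_of_lt (by omega)]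
      exact ⟨k4, rfl⟩

/-! ### The registers of Shor's circuit and modular addition -/

/-- The first register of Shor's circuit. -/
def regX (n i : ℕ) : ShorQubit n := if h : i < n then .inl (.inl ⟨i, h⟩) else .inr (.inl ())

/-- The second register of Shor's circuit. -/
def regY (n i : ℕ) : ShorQubit n := if h : i < n then .inl (.inr ⟨i, h⟩) else .inr (.inl ())

/-- The ancilla of Shor's circuit. -/
def ancQubit (n : ℕ) : ShorQubit n := .inr (.inl ())

theorem regX_of_lt {n i : ℕ} (h : i < n) : regX n i = .inl (.inl ⟨i, h⟩) := dif_pos h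

theorem regY_of_lt {n i : ℕ} (h : i < n) : regY n i = .inl (.inr ⟨i, h⟩) := dif_pos h

theorem regX_injOn (n : ℕ) : Set.InjOn (regX n) (Set.Iio n) := by
  intro i hi j hj h
  rw [regX_of_lt hi, regX_of_lt hj] at h
  exact congrArg Fin.val (Sum.inl.inj (Sum.inl.inj h))

theorem regY_injOn (n : ℕ) : Set.InjOn (regY n) (Set.Iio n) := by
  intro i hi j hj h
  rw [regY_of_lt hi, regY_of_lt hj] at h
  exact congrArg Fin.val (Sum.inr.inj (Sum.inl.inj h))

theorem regY_ne_regX {n i j : ℕ} (hi : i < n) (hj : j < n) : regY n i ≠ regX n j := by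
  rw [regY_of_lt hi, regX_of_lt hj]; simp

theorem regY_ne_anc {n i : ℕ} (hi : i < n) : regY n i ≠ ancQubit n := by
  rw [regY_of_lt hi, ancQubit]; simp

theorem regY_ne_ctrl {n i : ℕ} (hi : i < n) : regY n i ≠ ctrlQubit n := by
  rw [regY_of_lt hi, ctrlQubit]; simp

theorem regX_ne_anc {n i : ℕ} (hi : i < n) : regX n i ≠ ancQubit n := by
  rw [regX_of_lt hi, ancQubit]; simp

theorem regX_ne_ctrl {n i : ℕ} (hi : i < n) : regX n i ≠ ctrlQubit n := by
  rw [regX_of_lt hi, ctrlQubit]; simp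

/-- If the ancilla is `0`, the circuit adds `φ` modulo `N` to the second register. -/
def IsModAddBy (n N : ℕ) (C : Circuit (ShorQubit n)) (φ : (ShorQubit n → Bool) → ℕ) : Prop :=
  ∀ s, s (ancQubit n) = false → bval n (regY n) s < N →
    bval n (regY n) (act C s) = (bval n (regY n) s + φ s) % N ∧
      ∀ w, (∀ i < n, w ≠ regY n i) → act C s w = s w

theorem IsModAddBy.append {n N : ℕ} {C D : Circuit (ShorQubit n)}
    {φ ψ : (ShorQubit n → Bool) → ℕ} (hN : 0 < N) (h : IsModAddBy n N C φ)
    (h' : IsModAddBy n N D ψ)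
    (hψ : ∀ s s', (∀ w, (∀ i < n, w ≠ regY n i) → s' w = s w) → ψ s' = ψ s) :
    IsModAddBy n N (C ++ D) fun s => φ s + ψ s := by
  intro s hs hv
  obtain ⟨h1, h2⟩ := h s hs hv
  obtain ⟨h3, h4⟩ := h' (act C s) (by rw [h2 _ fun i hi => (regY_ne_anc hi).symm, hs])
    (by rw [h1]; exact Nat.mod_lt _ hN)
  rw [act_append]
  refine ⟨?_, fun w hw => (h4 w hw).trans (h2 w hw)⟩
  rw [h3, h1, hψ s _ h2, Nat.mod_add_mod, add_assoc]

/-- Four additions as in `modAdd_values`, with the ancilla as overflow bit. It ends up equal to the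
conjunction of the two controls, so a `CCX` clears it. -/
theorem exists_modAdd : ∃ A : ℕ, ∀ n N t i : ℕ, 2 ≤ n → N < 2 ^ n → t < N → i < n →
    ∃ C : Circuit (ShorQubit n),
      Cost C Set.univ (A * (n * (Nat.log 2 n + 1))) (A * (Nat.log 2 n + 1) ^ 2) ∧
      IsModAddBy n N C fun s => if (s (regX n i) && s (ctrlQubit n)) then t else 0 := by
  obtain ⟨A, hA⟩ := exists_controlled_add
  refine ⟨32 * A + 1, fun n N t i hn hN ht hi => ?_⟩
  -- The ancilla is in use, so another wire of the first register is borrowed as the dirty wire;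
  -- hence `2 ≤ n`.
  obtain ⟨j, hj, hij⟩ : ∃ j < n, j ≠ i := by
    rcases Nat.eq_zero_or_pos i with h | h
    · exact ⟨1, by omega, by omega⟩
    · exact ⟨0, by omega, by omega⟩
  set l := Nat.log 2 n + 1 with hl
  have hln : Nat.log 2 (n + 1) ≤ l := (Nat.log_mono_right (by omega)).trans (log_mul_two_le n)
  have hl1 : 1 ≤ l := by omega
  have hnl : 1 ≤ n * l := Nat.mul_pos (by omega) (by omega)
  have hl2 : 1 ≤ l ^ 2 := Nat.one_le_pow _ _ (by omega)
  have hcost : ∀ m ≤ n + 1, ∀ U : Finset (ShorQubit n), U.card ≤ 2 →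
      A * (U.card + m * (Nat.log 2 m + 1)) ≤ A * (8 * (n * l)) ∧
        A * (Nat.log 2 U.card + (Nat.log 2 m + 1) ^ 2) ≤ A * (8 * l ^ 2) := by
    intro m hm U hU
    have h1 : Nat.log 2 m ≤ l := (Nat.log_mono_right hm).trans hln
    have h2 : Nat.log 2 U.card ≤ 1 := by
      refine (Nat.log_mono_right hU).trans (by norm_num [Nat.log])
    have h3 : m * (Nat.log 2 m + 1) ≤ (2 * n) * (2 * l) := Nat.mul_le_mul (by omega) (by omega)
    have h4 : (Nat.log 2 m + 1) ^ 2 ≤ (2 * l) ^ 2 := Nat.pow_le_pow_left (by omega) 2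
    constructor <;> refine Nat.mul_le_mul_left _ ?_
    · nlinarith
    · nlinarith
  set U : Finset (ShorQubit n) := {regX n i, ctrlQubit n} with hUdef
  have hUc : U.card ≤ 2 := Finset.card_le_two
  have hU : ∀ s : ShorQubit n → Bool, (∀ q ∈ U, s q = true) ↔
      (s (regX n i) && s (ctrlQubit n)) = true := by
    intro s; simp [hUdef]
  have hanc : ancQubit n ∉ U := by
    simp only [hUdef, Finset.mem_insert, Finset.mem_singleton, not_or]
    exact ⟨(regX_ne_anc hi).symm, by simp [ancQubit, ctrlQubit]⟩
  have hXj : regX n j ∉ U := by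
    simp only [hUdef, Finset.mem_insert, Finset.mem_singleton, not_or]
    exact ⟨fun h => hij (regX_injOn n hj hi h), regX_ne_ctrl hj⟩
  have hYU : ∀ k < n, regY n k ∉ U := by
    intro k hk
    simp only [hUdef, Finset.mem_insert, Finset.mem_singleton, not_or]
    exact ⟨regY_ne_regX hk hi, regY_ne_ctrl hk⟩
  set z := snocReg n (regY n) (ancQubit n) with hz
  have hzinj : Set.InjOn z (Set.Iio (n + 1)) :=
    snocReg_injOn (regY_injOn n) fun k hk => regY_ne_anc hk
  have hzj : ∀ k < n + 1, z k ≠ regX n j := by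
    intro k hk
    rw [hz, snocReg]
    split_ifs with h
    exacts [regY_ne_regX h hj, (regX_ne_anc hj).symm]
  have hzU : ∀ k < n + 1, z k ∉ U := by
    intro k hk
    rw [hz, snocReg]
    split_ifs with h
    exacts [hYU k h, hanc]
  have hzoff : ∀ w, (∀ k < n, w ≠ regY n k) → w ≠ ancQubit n → ∀ k < n + 1, w ≠ z k := by
    intro w h1 h2 k hk
    rw [hz, snocReg]
    split_ifs with h
    exacts [h1 k h, h2]
  obtain ⟨C₁, c1, s1⟩ := hA _ (n + 1) z U (regX n j) ((t : ℤ) - N) (by omega) hzinj hzj hzU hXj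
    ⟨_, Finset.mem_insert_self _ _⟩
  obtain ⟨C₂, c2, s2⟩ := hA _ n (regY n) {ancQubit n} (regX n j) N (by omega) (regY_injOn n)
    (fun k hk => regY_ne_regX hk hj) (fun k hk => by simpa using regY_ne_anc hk)
    (by simpa using regX_ne_anc hj) (Finset.singleton_nonempty _)
  obtain ⟨C₃, c3, s3⟩ := hA _ (n + 1) z U (regX n j) (-(t : ℤ)) (by omega) hzinj hzj hzU hXj
    ⟨_, Finset.mem_insert_self _ _⟩
  obtain ⟨C₄, c4, s4⟩ := hA _ n (regY n) U (regX n j) t (by omega) (regY_injOn n)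
    (fun k hk => regY_ne_regX hk hj) hYU hXj ⟨_, Finset.mem_insert_self _ _⟩
  have hm := fun (C : Circuit (ShorQubit n)) (S : Set (ShorQubit n)) (m : ℕ) (hm : m ≤ n + 1)
      (V : Finset (ShorQubit n)) (hV : V.card ≤ 2)
      (h : Cost C S (A * (V.card + m * (Nat.log 2 m + 1)))
        (A * (Nat.log 2 V.card + (Nat.log 2 m + 1) ^ 2))) =>
    h.mono (Set.subset_univ _) (hcost m hm V hV).1 (hcost m hm V hV).2
  refine ⟨C₁ ++ C₂ ++ C₃ ++ C₄ ++ ccx (regX n i) (ctrlQubit n) (ancQubit n),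
    (((((hm _ _ _ le_rfl _ hUc c1).append (hm _ _ _ (by omega) _ (by simp) c2)).append
      (hm _ _ _ le_rfl _ hUc c3)).append (hm _ _ _ (by omega) _ hUc c4)).append
      ((Cost.ccx _ _ _).mono (Set.subset_univ _) le_rfl le_rfl)).mono le_rfl (by nlinarith)
      (by nlinarith), fun s hs hv => ?_⟩
  simp only [act_append]
  obtain ⟨a1, b1⟩ := s1 s
  set r₁ := act C₁ s
  obtain ⟨a2, b2⟩ := s2 r₁
  set r₂ := act C₂ r₁
  obtain ⟨a3, b3⟩ := s3 r₂
  set r₃ := act C₃ r₂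
  obtain ⟨a4, b4⟩ := s4 r₃
  set r₄ := act C₄ r₃
  have hoff : ∀ w, (∀ k < n, w ≠ regY n k) → w ≠ ancQubit n →
      r₁ w = s w ∧ r₂ w = s w ∧ r₃ w = s w ∧ r₄ w = s w := by
    intro w h1 h2
    have e1 := b1 w (hzoff w h1 h2)
    have e2 := (b2 w h1).trans e1
    have e3 := (b3 w (hzoff w h1 h2)).trans e2
    exact ⟨e1, e2, e3, (b4 w h1).trans e3⟩
  have hx := hoff (regX n i) (fun k hk => (regY_ne_regX hk hi).symm) (regX_ne_anc hi)
  have hb := hoff (ctrlQubit n) (fun k hk => (regY_ne_ctrl hk).symm)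
    (by simp [ancQubit, ctrlQubit])
  have hg2 : r₂ (ancQubit n) = r₁ (ancQubit n) := b2 _ fun k hk => (regY_ne_anc hk).symm
  have hg4 : r₄ (ancQubit n) = r₃ (ancQubit n) := b4 _ fun k hk => (regY_ne_anc hk).symm
  beta_reduce at a1 a2 a3 a4 ⊢
  simp only [hU, hx.2.1, hx.2.2.1, hb.2.1, hb.2.2.1, Finset.mem_singleton,
    forall_eq] at a1 a2 a3 a4
  rw [hz, bval_snocReg, bval_snocReg] at a1 a3
  rw [hg2] at a3
  rw [hs] at a1
  have key := modAdd_values (p := 2 ^ n) (u := s (regX n i) && s (ctrlQubit n)) hN ht hv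
    (bval_lt n (regY n) r₁) (bval_lt n (regY n) r₂) (bval_lt n (regY n) r₃)
    (bval_lt n (regY n) r₄) (g₁ := r₁ (ancQubit n)) (g₃ := r₃ (ancQubit n))
    (by simpa [pow_succ', mul_comm] using a1) (by simpa using a2)
    (by simpa [pow_succ', mul_comm] using a3) (by simpa using a4)
  rw [act_ccx (regX_ne_anc hi).symm (by simp [ancQubit, ctrlQubit])]
  refine ⟨?_, fun w hw => ?_⟩
  · rw [← key.1]
    exact bval_congr fun k hk => xorAt_of_ne (regY_ne_anc hk) _ _
  · by_cases hwg : w = ancQubit n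
    · subst hwg
      rw [xorAt_same, hg4, key.2, hx.2.2.2, hb.2.2.2, hs, Bool.xor_self]
    · rw [xorAt_of_ne hwg]
      exact (hoff w hw hwg).2.2.2

/-! ### Controlled modular multiplication -/

/-- The bit string with `x` and `y` in the registers, `0` in the ancilla and `b` in the control. -/
def pairBits (n x y : ℕ) (b : Bool) : ShorQubit n → Bool :=
  Sum.elim (Sum.elim (fun i => x.testBit i) (fun i => y.testBit i))
    (Sum.elim (fun _ => false) (fun _ => b))

theorem pairBits_zero (n x : ℕ) (b : Bool) : pairBits n x 0 b = shorBits n x b := by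
  simp [pairBits, shorBits]

theorem bval_regX_pairBits {n x : ℕ} (hx : x < 2 ^ n) (y : ℕ) (b : Bool) :
    bval n (regX n) (pairBits n x y b) = x :=
  bval_eq_of_testBit hx fun i hi => by rw [regX_of_lt hi]; rfl

theorem bval_regY_pairBits {n y : ℕ} (hy : y < 2 ^ n) (x : ℕ) (b : Bool) :
    bval n (regY n) (pairBits n x y b) = y :=
  bval_eq_of_testBit hy fun i hi => by rw [regY_of_lt hi]; rfl

theorem eq_pairBits {n x y y' : ℕ} {b : Bool} {s : ShorQubit n → Bool}
    (h : ∀ w, (∀ i < n, w ≠ regY n i) → s w = pairBits n x y b w)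
    (h' : bval n (regY n) s = y') : s = pairBits n x y' b := by
  ext w
  by_cases hw : ∀ i < n, w ≠ regY n i
  · rw [h w hw]
    rcases w with (i | i) | i
    · rfl
    · exact absurd (regY_of_lt i.2).symm (hw i i.2)
    · rfl
  · push Not at hw
    obtain ⟨i, hi, rfl⟩ := hw
    rw [← testBit_bval (regY n) s hi, h', regY_of_lt hi]
    rfl

/-- Binary expansion: for each `i`, add `2 ^ i * a` modulo `N` under the `i`-th bit of `x` and the
control. -/
theorem exists_modMulAdd : ∃ A : ℕ, ∀ n N a : ℕ, 2 ≤ n → 0 < N → N < 2 ^ n →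
    ∃ C : Circuit (ShorQubit n),
      Cost C Set.univ (A * (n ^ 2 * (Nat.log 2 n + 1))) (A * (n * (Nat.log 2 n + 1) ^ 2)) ∧
      ∀ x < N, ∀ b, act C (pairBits n x 0 b) = pairBits n x (if b then a * x % N else 0) b := by
  obtain ⟨A, hA⟩ := exists_modAdd
  refine ⟨A, fun n N a hn hN0 hN => ?_⟩
  have key : ∀ m ≤ n, ∃ C : Circuit (ShorQubit n),
      Cost C Set.univ (m * (A * (n * (Nat.log 2 n + 1)))) (m * (A * (Nat.log 2 n + 1) ^ 2)) ∧
      IsModAddBy n N C fun s => ∑ i ∈ Finset.range m,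
        if (s (regX n i) && s (ctrlQubit n)) then 2 ^ i * a % N else 0 := by
    intro m
    induction m with
    | zero =>
      exact fun _ => ⟨[], Cost.nil _ _ _, fun s _ hv =>
        ⟨by simpa using (Nat.mod_eq_of_lt hv).symm, fun w _ => rfl⟩⟩
    | succ m ih =>
      intro hm
      obtain ⟨C, hC, hs⟩ := ih (by omega)
      obtain ⟨D, hD, hs'⟩ := hA n N (2 ^ m * a % N) m hn hN (Nat.mod_lt _ hN0) (by omega)
      refine ⟨C ++ D, (hC.append hD).mono le_rfl (by linarith) (by linarith), ?_⟩
      have := hs.append hN0 hs' fun s s' h => by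
        rw [h _ fun k hk => (regY_ne_regX hk (by omega)).symm,
          h _ fun k hk => (regY_ne_ctrl hk).symm]
      simpa only [Finset.sum_range_succ] using this
  obtain ⟨C, hC, hs⟩ := key n le_rfl
  refine ⟨C, hC.mono le_rfl (le_of_eq (by ring)) (le_of_eq (by ring)), fun x hx b => ?_⟩
  obtain ⟨h1, h2⟩ := hs (pairBits n x 0 b) rfl
    (by rw [bval_regY_pairBits (by positivity)]; exact hN0)
  refine eq_pairBits h2 ?_
  rw [h1, bval_regY_pairBits (by positivity), zero_add]
  beta_reduce
  have hb : pairBits n x 0 b (ctrlQubit n) = b := rfl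
  rw [hb]
  cases b
  · simp
  · simp only [Bool.and_true, if_true]
    have e : bval n (regX n) (pairBits n x 0 true) = x := bval_regX_pairBits (hx.trans hN) _ _
    rw [Finset.sum_nat_mod]
    have : ∀ i ∈ Finset.range n, (if pairBits n x 0 true (regX n i) = true then 2 ^ i * a % N
        else 0) % N = (a * ((pairBits n x 0 true (regX n i)).toNat * 2 ^ i)) % N := by
      intro i _
      split_ifs with h
      · rw [h, Nat.mod_mod, Bool.toNat_true, one_mul, mul_comm]
      · simp [h]
    rw [Finset.sum_congr rfl this, ← Finset.sum_nat_mod, ← Finset.mul_sum, ← bval, e]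

/-- A controlled swap of two wires. -/
def cswap (b p q : W) : Circuit W := cx q p ++ ccx b p q ++ cx q p

theorem Cost.cswap (b p q : W) : Cost (cswap b p q) Set.univ 3 3 :=
  (((Cost.cx q p).mono (Set.subset_univ _) le_rfl le_rfl).append
    ((Cost.ccx b p q).mono (Set.subset_univ _) le_rfl le_rfl)).append
    ((Cost.cx q p).mono (Set.subset_univ _) le_rfl le_rfl)

theorem act_cswap {b p q : W} (hb : b ≠ p) (hb' : b ≠ q) (hpq : p ≠ q) (s : W → Bool) (w : W) :
    act (cswap b p q) s w = if s b = true ∧ w = p then s q else if s b = true ∧ w = q then s p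
      else s w := by
  rw [cswap, act_append, act_append, act_cx hpq, act_ccx hb'.symm hpq.symm, act_cx hpq]
  by_cases h1 : w = p
  · subst h1
    simp only [xorAt_apply, hpq, hpq.symm, hb, decide_true,
      decide_false, and_false, and_true, Bool.true_and, Bool.false_and, Bool.xor_false, if_false]
    cases s b <;> cases s w <;> cases s q <;> rfl
  · by_cases h2 : w = q
    · subst h2
      simp only [xorAt_apply, hpq.symm, hb, decide_true,
        decide_false, and_false, and_true, Bool.true_and, Bool.false_and, Bool.xor_false, if_false]
      cases s b <;> cases s p <;> cases s w <;> rfl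
    · simp [xorAt_apply, h1, h2]

theorem exists_cswap_registers (n : ℕ) : ∃ C : Circuit (ShorQubit n),
    Cost C Set.univ (3 * n) (3 * n) ∧
      ∀ x y b, act C (pairBits n x y b) = if b then pairBits n y x b else pairBits n x y b := by
  have key : ∀ m ≤ n, ∃ C : Circuit (ShorQubit n), Cost C Set.univ (3 * m) (3 * m) ∧
      ∀ x y b, ∀ w, act C (pairBits n x y b) w =
        if (∃ i < m, w = regX n i ∨ w = regY n i) ∧ b = true then pairBits n y x b w
        else pairBits n x y b w := by
    intro m
    induction m with
    | zero => exact fun _ => ⟨[], Cost.nil _ _ _, fun x y b w => by simp⟩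
    | succ m ih =>
      intro hm
      obtain ⟨C, hC, hs⟩ := ih (by omega)
      refine ⟨C ++ cswap (ctrlQubit n) (regX n m) (regY n m),
        (hC.append (Cost.cswap _ _ _)).mono le_rfl (by omega) (by omega), fun x y b w => ?_⟩
      have hX : ¬∃ i < m, regX n m = regX n i ∨ regX n m = regY n i := by
        rintro ⟨i, hi, h | h⟩
        · have := regX_injOn n (by rw [Set.mem_Iio]; omega) (by rw [Set.mem_Iio]; omega) h
          omega
        · exact regY_ne_regX (by omega) (by omega) h.symm
      have hY : ¬∃ i < m, regY n m = regX n i ∨ regY n m = regY n i := by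
        rintro ⟨i, hi, h | h⟩
        · exact regY_ne_regX (by omega) (by omega) h
        · have := regY_injOn n (by rw [Set.mem_Iio]; omega) (by rw [Set.mem_Iio]; omega) h
          omega
      have hc : act C (pairBits n x y b) (ctrlQubit n) = b := by
        rw [hs]
        split_ifs <;> rfl
      rw [act_append, act_cswap (regX_ne_ctrl (by omega)).symm (regY_ne_ctrl (by omega)).symm
        (regY_ne_regX (by omega) (by omega)).symm, hc]
      cases b
      · simp [hs]
      · by_cases h1 : w = regX n m
        · subst h1
          rw [if_pos ⟨rfl, rfl⟩, hs, if_neg fun h => hY h.1,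
            if_pos ⟨⟨m, by omega, Or.inl rfl⟩, rfl⟩, regX_of_lt (by omega), regY_of_lt (by omega)]
          rfl
        · rw [if_neg fun h => h1 h.2]
          by_cases h2 : w = regY n m
          · subst h2
            rw [if_pos ⟨rfl, rfl⟩, hs, if_neg fun h => hX h.1,
              if_pos ⟨⟨m, by omega, Or.inr rfl⟩, rfl⟩, regX_of_lt (by omega),
              regY_of_lt (by omega)]
            rfl
          · rw [if_neg fun h => h2 h.2, hs]
            have : (∃ i < m, w = regX n i ∨ w = regY n i) ↔
                ∃ i < m + 1, w = regX n i ∨ w = regY n i := by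
              refine ⟨fun ⟨i, hi, h⟩ => ⟨i, by omega, h⟩, fun ⟨i, hi, h⟩ => ⟨i, ?_, h⟩⟩
              rcases Nat.lt_succ_iff_lt_or_eq.1 hi with h' | rfl
              · exact h'
              · rcases h with h | h
                exacts [absurd h h1, absurd h h2]
            simp only [this]
  obtain ⟨C, hC, hs⟩ := key n le_rfl
  refine ⟨C, hC, fun x y b => ?_⟩
  cases b
  · ext w
    simp [hs]
  · ext w
    rw [hs, if_pos rfl]
    rcases w with (i | i) | i
    · rw [if_pos ⟨⟨i, i.2, Or.inl (regX_of_lt i.2).symm⟩, rfl⟩]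
    · rw [if_pos ⟨⟨i, i.2, Or.inr (regY_of_lt i.2).symm⟩, rfl⟩]
    · split_ifs <;> rfl

/-- With the control on, `(x, 0) ↦ (x, a x) ↦ (a x, x) ↦ (a x, 0)`: the last arrow reverses the
multiplication by an inverse of `a`, which takes `(a x, 0)` to `(a x, x)`. With the control off, all
three parts do nothing. -/
theorem exists_controlledModMul : ∃ A : ℕ, ∀ n N a : ℕ, 2 ≤ n → 1 < N → N < 2 ^ n →
    a.Coprime N → ∃ M : Circuit (ShorQubit n), IsControlledModMul n N a M ∧
      Cost M Set.univ (A * (n ^ 2 * (Nat.log 2 n + 1))) (A * (n * (Nat.log 2 n + 1) ^ 2)) := by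
  obtain ⟨A, hA⟩ := exists_modMulAdd
  refine ⟨2 * A + 3, fun n N a hn hN1 hN ha => ?_⟩
  obtain ⟨a', ha'⟩ := Nat.exists_mul_mod_eq_one_of_coprime ha hN1
  replace ha' := ha'.2
  obtain ⟨C, hC, hs⟩ := hA n N a hn (by omega) hN
  obtain ⟨D, hD, hs'⟩ := hA n N a' hn (by omega) hN
  obtain ⟨E, hE, hE'⟩ := exists_cswap_registers n
  refine ⟨C ++ E ++ D.reverse, fun x hx b => ?_, ((hC.append hE).append hD.reverse).mono le_rfl
    ?_ ?_⟩
  · rw [apply_ket, ← pairBits_zero, act_append, act_append, hs x hx, hE', ← pairBits_zero]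
    congr 1
    refine act_reverse_eq ?_
    cases b
    · simp only [Bool.false_eq_true, if_false]
      rw [hs' x hx]
      simp
    · simp only [if_true]
      rw [hs' _ (Nat.mod_lt _ (by omega)), if_pos rfl]
      congr 1
      rw [Nat.mul_mod_mod, ← mul_assoc, mul_comm a', Nat.mul_mod, ha', one_mul, Nat.mod_mod,
        Nat.mod_eq_of_lt hx]
  · have : n * 1 ≤ n ^ 2 * (Nat.log 2 n + 1) :=
      Nat.mul_le_mul (Nat.le_self_pow (by norm_num) n) (by omega)
    linarith
  · have : n * 1 ≤ n * (Nat.log 2 n + 1) ^ 2 :=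
      Nat.mul_le_mul_left _ (Nat.one_le_pow _ _ (by omega))
    linarith

/-! ### The output distribution of Shor's circuit -/

/-- Instructions act linearly on the state of a branch. -/
theorem step_sum {ι : Type*} (y j : ℕ) (I : Finset ι) (c : ι → ℂ) (φ : ι → State W) (p : Instr W) :
    Instr.step y (j, fun s => ∑ i ∈ I, c i * φ i s) p =
      ((Instr.step y (j, fun _ => 0) p).1,
        fun s => ∑ i ∈ I, c i * (Instr.step y (j, φ i) p).2 s) := by
  rcases p with g | q | q | q
  · rfl
  · simp only [Instr.step, Finset.mul_sum, ← Finset.sum_add_distrib, Finset.sum_div]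
    congr 1
    ext s
    exact Finset.sum_congr rfl fun i _ => by ring
  · simp only [Instr.step, Finset.mul_sum]
    congr 1
    ext s
    exact Finset.sum_congr rfl fun i _ => by ring
  · simp only [Instr.step]
    congr 1
    ext s
    split_ifs <;> simp

theorem step_fst (y j : ℕ) (φ ψ : State W) (p : Instr W) :
    (Instr.step y (j, φ) p).1 = (Instr.step y (j, ψ) p).1 := by
  rcases p with g | q | q | q <;> rfl

/-- Linearity reduces the analysis of a branch to basis states. Nonemptiness is needed to know the
final value of the counter. -/
theorem foldl_step_sum {ι : Type*} (y : ℕ) (I : Finset ι) (c : ι → ℂ) (P : List (Instr W)) (j : ℕ)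
    (φ φ' : ι → State W) (j' : ℕ)
    (h : ∀ i ∈ I, P.foldl (Instr.step y) (j, φ i) = (j', φ' i)) (hI : I.Nonempty) :
    P.foldl (Instr.step y) (j, fun s => ∑ i ∈ I, c i * φ i s) =
      (j', fun s => ∑ i ∈ I, c i * φ' i s) := by
  induction P generalizing j φ with
  | nil =>
    obtain ⟨i, hi⟩ := hI
    have h1 : j = j' := congrArg Prod.fst (h i hi)
    have h2 : ∀ i ∈ I, φ i = φ' i := fun i hi => congrArg Prod.snd (h i hi)
    rw [List.foldl_nil, h1]
    congr 1
    ext s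
    exact Finset.sum_congr rfl fun i hi => by rw [h2 i hi]
  | cons p P ih =>
    rw [List.foldl_cons, step_sum]
    refine ih _ _ fun i hi => ?_
    rw [← h i hi, List.foldl_cons, step_fst y j (fun _ => 0) (φ i)]

theorem foldl_step_gate (y j : ℕ) (C : Circuit W) (ψ : State W) :
    (C.map Instr.gate).foldl (Instr.step y) (j, ψ) = (j, Circuit.apply C ψ) := by
  induction C generalizing ψ with
  | nil => rfl
  | cons g C ih => exact ih _

theorem ket_update_ctrl (n z : ℕ) (b v : Bool) (s : ShorQubit n → Bool) :
    ket (shorBits n z b) (Function.update s (ctrlQubit n) v) =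
      if v = b then ket (shorBits n z (s (ctrlQubit n))) s else 0 := by
  have : Function.update s (ctrlQubit n) v = shorBits n z b ↔
      v = b ∧ s = shorBits n z (s (ctrlQubit n)) := by
    constructor
    · intro h
      refine ⟨by simpa [shorBits, ctrlQubit] using congrFun h (ctrlQubit n), ?_⟩
      ext w
      by_cases hw : w = ctrlQubit n
      · subst hw; rfl
      · have := congrFun h w
        rw [Function.update_of_ne hw] at this
        rw [this]
        rcases w with (w | w) | w | w
        · rfl
        · rfl
        · rfl
        · exact absurd rfl hw
    · rintro ⟨rfl, h⟩
      rw [h]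
      ext w
      by_cases hw : w = ctrlQubit n
      · subst hw; simp [shorBits, ctrlQubit]
      · rw [Function.update_of_ne hw]
        rcases w with (w | w) | w | w
        · rfl
        · rfl
        · rfl
        · exact absurd rfl hw
  simp only [ket, this]
  split_ifs with h1 h2 h3 h4 h5 <;> tauto

theorem ket_of_ctrl_ne {n z : ℕ} {b : Bool} {s : ShorQubit n → Bool} (h : s (ctrlQubit n) ≠ b) :
    ket (shorBits n z b) s = 0 := by
  rw [ket, if_neg]
  rintro rfl
  exact h rfl

theorem step_had_ket (n z y j : ℕ) :
    Instr.step y (j, ket (shorBits n z false)) (.had (ctrlQubit n)) =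
      (j, fun s => ∑ b : Bool, (1 / (Real.sqrt 2 : ℂ)) * ket (shorBits n z b) s) := by
  simp only [Instr.step]
  congr 1
  ext s
  rw [ket_update_ctrl, ket_update_ctrl, Fintype.sum_bool]
  cases h : s (ctrlQubit n)
  · rw [ket_of_ctrl_ne (b := true) (by simp [h])]
    simp
    ring
  · rw [ket_of_ctrl_ne (b := false) (by simp [h])]
    simp
    ring

/-- The phase that a round of the semiclassical Fourier transform gives to a control bit. -/
noncomputable def roundPhase (y j : ℕ) (b : Bool) : ℂ :=
  (if b then Complex.exp (-2 * Real.pi * Complex.I * (y % 2 ^ j : ℕ) / 2 ^ (j + 1)) else 1) *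
    (if b && y.testBit j then -1 else 1)

theorem foldl_step_fourier (n z y j : ℕ) (b : Bool) :
    [Instr.rot (ctrlQubit n), .had (ctrlQubit n), .measure (ctrlQubit n)].foldl (Instr.step y)
      (j, ket (shorBits n z b)) =
      (j + 1, fun s => roundPhase y j b / (Real.sqrt 2 : ℂ) * ket (shorBits n z false) s) := by
  simp only [List.foldl_cons, List.foldl_nil, Instr.step]
  congr 1
  ext s
  simp only [Function.update_idem, Function.update_self, ket_update_ctrl]
  cases h : s (ctrlQubit n)
  · rw [roundPhase]
    cases b <;> cases y.testBit j <;> simp <;> ring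
  · rw [ket_of_ctrl_ne (b := false) (by simp [h])]
    simp

/-- One round of Shor's circuit. -/
def shorRound (n : ℕ) (M : Circuit (ShorQubit n)) : List (Instr (ShorQubit n)) :=
  [.had (ctrlQubit n)] ++ M.map .gate ++
    [.rot (ctrlQubit n), .had (ctrlQubit n), .measure (ctrlQubit n)]

theorem shorCircuit_eq (n : ℕ) (M : ℕ → Circuit (ShorQubit n)) :
    shorCircuit n M = (List.range (2 * n)).flatMap fun j => shorRound n (M j) := rfl

theorem foldl_step_round {n N m : ℕ} {M : Circuit (ShorQubit n)} (hM : IsControlledModMul n N m M)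
    (y j z : ℕ) (hz : z < N) :
    (shorRound n M).foldl (Instr.step y) (j, ket (shorBits n z false)) =
      (j + 1, fun s => ∑ b : Bool, (1 / (Real.sqrt 2 : ℂ)) * (roundPhase y j b / (Real.sqrt 2 : ℂ) *
        ket (shorBits n (if b then m * z % N else z) false) s)) := by
  have h : [Instr.had (ctrlQubit n)].foldl (Instr.step y) (j, ket (shorBits n z false)) = _ :=
    step_had_ket n z y j
  rw [shorRound, List.append_assoc, List.foldl_append, h]
  refine foldl_step_sum y _ _ _ j _ _ _ (fun b _ => ?_) Finset.univ_nonempty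
  rw [List.foldl_append, foldl_step_gate, hM z hz b, foldl_step_fourier]

theorem sum_range_two_mul {α : Type*} [AddCommMonoid α] (g : ℕ → α) (m : ℕ) :
    ∑ x ∈ Finset.range (2 * m), g x =
      ∑ x ∈ Finset.range m, (g (2 * x) + g (2 * x + 1)) := by
  induction m with
  | zero => simp
  | succ m ih =>
    rw [show 2 * (m + 1) = 2 * m + 1 + 1 by ring, Finset.sum_range_succ, Finset.sum_range_succ, ih,
      Finset.sum_range_succ, add_assoc]

/-- Appending the bit `b` to `x` adds the phase of `y / 2 ^ (j + 1)` if `b` is set. Modulo integers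
this fraction is determined by the bits of `y` up to `j`: the bits below `j` give the classically
controlled rotation and bit `j` gives the sign from the Hadamard gate. -/
theorem exp_roundPhase (y j x : ℕ) (b : Bool) :
    Complex.exp (-2 * Real.pi * Complex.I * (2 * x + b.toNat : ℕ) * y / 2 ^ (j + 1)) =
      Complex.exp (-2 * Real.pi * Complex.I * x * y / 2 ^ j) * roundPhase y j b := by
  have h2 : (2 : ℂ) ^ j ≠ 0 := pow_ne_zero _ two_ne_zero
  cases b
  · rw [roundPhase]
    simp only [Bool.toNat_false, Bool.false_eq_true, if_false, Bool.false_and, mul_one, add_zero]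
    congr 1
    push_cast
    rw [pow_succ]
    field_simp
  · obtain ⟨q, hq⟩ : ∃ q, y = y % 2 ^ j + 2 ^ j * (y.testBit j).toNat + 2 ^ (j + 1) * q := by
      refine ⟨y / 2 ^ j / 2, ?_⟩
      have h1 := Nat.mod_add_div y (2 ^ j)
      have h3 := Nat.mod_add_div (y / 2 ^ j) 2
      rw [Nat.toNat_testBit]
      calc y = y % 2 ^ j + 2 ^ j * (y / 2 ^ j) := h1.symm
        _ = y % 2 ^ j + 2 ^ j * (y / 2 ^ j % 2 + 2 * (y / 2 ^ j / 2)) := by rw [h3]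
        _ = _ := by ring
    have hy : (y : ℂ) = (y % 2 ^ j : ℕ) + 2 ^ j * ((y.testBit j).toNat : ℂ) + 2 ^ (j + 1) * q := by
      exact_mod_cast congrArg (Nat.cast (R := ℂ)) hq
    have e : -2 * Real.pi * Complex.I * ((2 * x + true.toNat : ℕ) : ℂ) * y / 2 ^ (j + 1) =
        -2 * Real.pi * Complex.I * x * y / 2 ^ j +
          (-2 * Real.pi * Complex.I * (y % 2 ^ j : ℕ) / 2 ^ (j + 1) +
            ((y.testBit j).toNat * (-(Real.pi * Complex.I)) +
              ((-q : ℤ) : ℂ) * (2 * Real.pi * Complex.I))) := by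
      have : -2 * Real.pi * Complex.I * ((2 * x + true.toNat : ℕ) : ℂ) * y / 2 ^ (j + 1) =
          -2 * Real.pi * Complex.I * x * y / 2 ^ j +
            -2 * Real.pi * Complex.I * y / 2 ^ (j + 1) := by
        simp only [Bool.toNat_true]
        push_cast
        rw [pow_succ]
        field_simp
        ring
      rw [this]
      congr 1
      conv_lhs => rw [hy]
      push_cast
      rw [pow_succ]
      field_simp
      ring
    rw [e, Complex.exp_add, Complex.exp_add, Complex.exp_add, Complex.exp_int_mul_two_pi_mul_I,
      roundPhase]
    congr 1
    simp only [if_true, Bool.true_and, mul_one]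
    congr 1
    cases y.testBit j
    · simp
    · simp [Complex.exp_neg]

/-- The bits of the exponent are used from the most significant one down. After `j` rounds its top
`j` bits form `x`, and the next round replaces `x` by `2 * x + b`. The control is back in `|0⟩`
after each round. -/
theorem foldl_step_shor {n N a : ℕ} (hN : 1 < N) {M : ℕ → Circuit (ShorQubit n)} (t : ℕ)
    (hM : ∀ j < t, IsControlledModMul n N (a ^ 2 ^ (t - 1 - j)) (M j)) (y j : ℕ) (hj : j ≤ t) :
    ((List.range j).flatMap fun j => shorRound n (M j)).foldl (Instr.step y)
      (0, ket (shorBits n 1 false)) =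
      (j, fun s => ∑ x ∈ Finset.range (2 ^ j),
        Complex.exp (-2 * Real.pi * Complex.I * x * y / 2 ^ j) / 2 ^ j *
          ket (shorBits n (a ^ (x * 2 ^ (t - j)) % N) false) s) := by
  induction j with
  | zero => simp [Nat.mod_eq_of_lt hN]
  | succ j ih =>
    rw [List.range_succ, List.flatMap_append, List.foldl_append, ih (by omega),
      List.flatMap_singleton]
    -- Each round contributes two factors `1 / √2`, one per Hadamard gate, hence the normalisation
    -- `1 / 2 ^ j`.
    rw [foldl_step_sum y _ _ _ j _ _ _
      (fun x _ => foldl_step_round (hM j (by omega)) y j _ (Nat.mod_lt _ (by omega)))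
      ⟨0, by simp⟩]
    congr 1
    ext s
    rw [pow_succ' 2 j, sum_range_two_mul]
    refine Finset.sum_congr rfl fun x _ => ?_
    rw [Fintype.sum_bool, mul_add, add_comm]
    have hs : (Real.sqrt 2 : ℂ) * Real.sqrt 2 = 2 := by
      rw [← Complex.ofReal_mul, Real.mul_self_sqrt (by norm_num)]
      norm_num
    have hs0 : (Real.sqrt 2 : ℂ) ≠ 0 := by
      intro h
      rw [h] at hs
      norm_num at hs
    have hc : ∀ b, Complex.exp (-2 * Real.pi * Complex.I * x * y / 2 ^ j) / 2 ^ j *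
        (1 / (Real.sqrt 2 : ℂ) * (roundPhase y j b / (Real.sqrt 2 : ℂ))) =
        Complex.exp (-2 * Real.pi * Complex.I * (2 * x + b.toNat : ℕ) * y / 2 ^ (j + 1)) /
          2 ^ (j + 1) := by
      intro b
      rw [exp_roundPhase, pow_succ, ← hs]
      field_simp
    have ht : t - j = t - 1 - j + 1 := by omega
    have ht' : t - (j + 1) = t - 1 - j := by omega
    have e1 : a ^ 2 ^ (t - 1 - j) * (a ^ (x * 2 ^ (t - j)) % N) % N =
        a ^ ((2 * x + 1) * 2 ^ (t - (j + 1))) % N := by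
      rw [Nat.mul_mod_mod, ← pow_add, ht, ht', pow_succ]
      congr 2
      ring
    have e0 : x * 2 ^ (t - j) = 2 * x * 2 ^ (t - (j + 1)) := by
      rw [ht, ht', pow_succ]
      ring
    have h0 := hc false
    have h1 := hc true
    simp only [Bool.toNat_false, Bool.toNat_true, add_zero] at h0 h1
    congr 1
    · rw [← h0, e0]
      simp only [Bool.false_eq_true, if_false]
      ring
    · rw [← h1, if_pos rfl, e1]
      ring

theorem shorBits_injOn (n : ℕ) :
    Set.InjOn (fun z => shorBits n z false) (Set.Iio (2 ^ n)) := by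
  intro z hz z' hz' h
  have h1 := bval_regX_pairBits hz 0 false
  have h2 := bval_regX_pairBits hz' 0 false
  rw [pairBits_zero] at h1 h2
  rw [← h1, ← h2]
  exact congrArg _ h

/-- The final branch is supported on the strings of residues `z < N`. Grouping the exponents by `z`
gives the amplitudes of order finding up to complex conjugation, which does not affect the norm. -/
theorem outcomeProb_shorCircuit {n N a : ℕ} (hN : 1 < N) (hN' : N < 2 ^ n)
    {M : ℕ → Circuit (ShorQubit n)}
    (hM : ∀ j < 2 * n, IsControlledModMul n N (a ^ 2 ^ (2 * n - 1 - j)) (M j)) (y : ℕ) :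
    outcomeProb (shorCircuit n M) (ket (shorBits n 1 false)) y = shorProb (2 * n) N a y := by
  rw [outcomeProb, shorCircuit_eq, foldl_step_shor hN (2 * n) hM y (2 * n) le_rfl, shorProb]
  simp only [Nat.sub_self, pow_zero, mul_one]
  set c : ℕ → ℂ := fun x =>
    Complex.exp (-2 * Real.pi * Complex.I * x * y / 2 ^ (2 * n)) / 2 ^ (2 * n) with hc
  have hinj : Set.InjOn (fun z => shorBits n z false) (Finset.range N : Set ℕ) :=
    (shorBits_injOn n).mono fun z hz => by
      rw [Finset.coe_range, Set.mem_Iio] at hz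
      exact hz.trans hN'
  rw [← Finset.sum_subset (Finset.subset_univ ((Finset.range N).image fun z => shorBits n z false)),
    Finset.sum_image hinj]
  · refine Finset.sum_congr rfl fun z hz => ?_
    congr 1
    have e : ∑ x ∈ Finset.range (2 ^ (2 * n)),
        c x * ket (shorBits n (a ^ x % N) false) (shorBits n z false) =
        (starRingEnd ℂ) ((∑ x ∈ Finset.range (2 ^ (2 * n)) with a ^ x % N = z,
          Complex.exp (2 * Real.pi * Complex.I * x * y / 2 ^ (2 * n))) / 2 ^ (2 * n)) := by
      rw [map_div₀, map_sum, Finset.sum_div, Finset.sum_filter]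
      refine Finset.sum_congr rfl fun x _ => ?_
      have hiff : shorBits n z false = shorBits n (a ^ x % N) false ↔ a ^ x % N = z := by
        refine ⟨fun h => ?_, fun h => by rw [h]⟩
        exact (hinj hz (by simpa using Nat.mod_lt _ (by omega)) h).symm
      simp only [ket, hiff, hc]
      split_ifs
      · rw [← Complex.exp_conj]
        have h2 : (starRingEnd ℂ) 2 = 2 := Complex.conj_ofNat 2
        simp [h2]
      · simp
    rw [e, Complex.norm_conj]
  · intro s _ hs
    rw [Finset.sum_eq_zero, norm_zero, zero_pow two_ne_zero]
    intro x _
    rw [ket, if_neg, mul_zero]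
    rintro rfl
    exact hs (Finset.mem_image_of_mem _ (by simpa using Nat.mod_lt _ (by omega)))

/-! ### Size and depth of Shor's circuit -/

theorem Sched.flatMap_sequential {ι : Type*} {F : ι → List (Finset W)} (I : List ι)
    (h : ∀ i ∈ I, Sched (F i) d) : Sched (I.flatMap F) (I.length * d) := by
  induction I with
  | nil => exact Sched.nil _
  | cons i I ih =>
    rw [List.flatMap_cons, List.length_cons, add_mul, one_mul, add_comm]
    exact (h i (by simp)).append (ih fun j hj => h j (by simp [hj]))

theorem length_shorRound (n : ℕ) (M : Circuit (ShorQubit n)) :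
    (shorRound n M).length = M.length + 4 := by
  simp [shorRound]

theorem sched_shorRound {n : ℕ} {M : Circuit (ShorQubit n)} (hM : Sched (M.map Gate.support) d) :
    Sched ((shorRound n M).map Instr.support) (d + 4) := by
  have h1 : Sched ((M.map Instr.gate).map Instr.support) d := by
    have := hM.map (Option.some_injective (ShorQubit n))
    rw [List.map_map] at this ⊢
    exact this
  have h2 := ((Sched.singleton (Instr.support (.had (ctrlQubit n)))).append h1).append
    (Sched.of_length ([.rot (ctrlQubit n), .had (ctrlQubit n), .measure (ctrlQubit n)].map
      Instr.support))
  rw [shorRound, List.map_append, List.map_append]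
  refine h2.mono ?_
  simp
  omega

theorem length_shorCircuit_le {n : ℕ} {M : ℕ → Circuit (ShorQubit n)}
    (hM : ∀ j, (M j).length ≤ ℓ) : (shorCircuit n M).length ≤ 2 * n * (ℓ + 4) := by
  rw [shorCircuit_eq, List.length_flatMap]
  have : ∀ x ∈ (List.range (2 * n)).map (fun j => (shorRound n (M j)).length), x ≤ ℓ + 4 := by
    intro x hx
    obtain ⟨i, -, rfl⟩ := List.mem_map.1 hx
    rw [length_shorRound]
    exact Nat.add_le_add_right (hM i) 4
  simpa using List.sum_le_card_nsmul _ _ this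

theorem instrDepth_shorCircuit_le {n : ℕ} {M : ℕ → Circuit (ShorQubit n)}
    (hM : ∀ j, Sched ((M j).map Gate.support) d) :
    instrDepth (shorCircuit n M) ≤ 2 * n * (d + 4) := by
  refine Sched.schedDepth_le ?_
  rw [shorCircuit_eq, List.map_flatMap]
  simpa using Sched.flatMap_sequential (List.range (2 * n)) fun j _ => sched_shorRound (hM j)

/-- Shor's circuit on `2n + 2` qubits. -/
theorem exists_shorCircuit : ∃ B : ℝ, 0 < B ∧
    ∀ n N a : ℕ, 2 ≤ n → 2 ^ (n - 1) ≤ N → N < 2 ^ n → a.Coprime N →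
      Fintype.card (ShorQubit n) = 2 * n + 2 ∧
      ∃ M : ℕ → Circuit (ShorQubit n),
        (∀ j < 2 * n, IsControlledModMul n N (a ^ 2 ^ (2 * n - 1 - j)) (M j)) ∧
        (∀ y < 2 ^ (2 * n),
          outcomeProb (shorCircuit n M) (ket (shorBits n 1 false)) y = shorProb (2 * n) N a y) ∧
        ((shorCircuit n M).length : ℝ) ≤ B * (n ^ 3 * Real.log n) ∧
        (instrDepth (shorCircuit n M) : ℝ) ≤ B * (n ^ 2 * Real.log n ^ 2) := by
  obtain ⟨A, hA⟩ := exists_controlledModMul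
  -- There are `2 * n` rounds, each with four operations besides the multiplication, and `(4 * log
  -- n) ^ 2` contributes a factor 16.
  refine ⟨32 * (A + 4), by positivity, fun n N a hn hN1 hN ha => ⟨?_, ?_⟩⟩
  · simp only [Fintype.card_sum, Fintype.card_fin, Fintype.card_unit]
    ring
  have hN2 : 1 < N :=
    (Nat.one_lt_two_pow (by omega)).trans_le hN1
  choose M hM hcost using fun j => hA n N (a ^ 2 ^ (2 * n - 1 - j)) hn hN2 hN (ha.pow_left _)
  refine ⟨M, fun j _ => hM j, fun y _ => outcomeProb_shorCircuit hN2 hN (fun j _ => hM j) y,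
    ?_, ?_⟩
  all_goals
    set l := Nat.log 2 n + 1 with hl
    have h0 := Real.log_natCast_nonneg n
    have hlog : (l : ℝ) ≤ 4 * Real.log n := by
      have h1 := natLog_le_two_mul_log n
      have h2 := one_le_two_mul_log hn
      rw [hl]
      push_cast
      linarith
    have hl1 : 1 ≤ l := by omega
  · have h1 : 1 ≤ n ^ 2 * l := Nat.mul_pos (by positivity) hl1
    have h2 : (shorCircuit n M).length ≤ 2 * (A + 4) * (n ^ 3 * l) := by
      refine (length_shorCircuit_le fun j => (hcost j).len).trans ?_
      calc 2 * n * (A * (n ^ 2 * l) + 4) ≤ 2 * n * (A * (n ^ 2 * l) + 4 * (n ^ 2 * l)) :=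
            Nat.mul_le_mul_left _ (by omega)
        _ = 2 * (A + 4) * (n ^ 3 * l) := by ring
    calc ((shorCircuit n M).length : ℝ) ≤ (2 * (A + 4) * (n ^ 3 * l) : ℕ) := by exact_mod_cast h2
      _ = 2 * (A + 4) * (n ^ 3 * (l : ℝ)) := by push_cast; ring
      _ ≤ 2 * (A + 4) * (n ^ 3 * (4 * Real.log n)) := by gcongr
      _ ≤ 32 * (A + 4) * (n ^ 3 * Real.log n) := by
        have : 0 ≤ ((A : ℝ) + 4) * (n ^ 3 * Real.log n) := by positivity
        linarith
  · have h1 : 1 ≤ n * l ^ 2 := Nat.mul_pos (by omega) (by positivity)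
    have h2 : instrDepth (shorCircuit n M) ≤ 2 * (A + 4) * (n ^ 2 * l ^ 2) := by
      refine (instrDepth_shorCircuit_le fun j => (hcost j).sched).trans ?_
      calc 2 * n * (A * (n * l ^ 2) + 4) ≤ 2 * n * (A * (n * l ^ 2) + 4 * (n * l ^ 2)) :=
            Nat.mul_le_mul_left _ (by omega)
        _ = 2 * (A + 4) * (n ^ 2 * l ^ 2) := by ring
    calc (instrDepth (shorCircuit n M) : ℝ) ≤ (2 * (A + 4) * (n ^ 2 * l ^ 2) : ℕ) := by
          exact_mod_cast h2
      _ = 2 * (A + 4) * (n ^ 2 * (l : ℝ) ^ 2) := by push_cast; ring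
      _ ≤ 2 * (A + 4) * (n ^ 2 * (4 * Real.log n) ^ 2) := by gcongr
      _ = 32 * (A + 4) * (n ^ 2 * Real.log n ^ 2) := by ring

end QCirc

theorem mainTheorem10 :
    -- the controlled classical–quantum adder
    (∃ A B : ℝ, 0 < A ∧ 0 < B ∧
      ∀ k n : ℕ, 1 ≤ n → (2 ≤ k ∨ 2 ≤ n) → ∀ c : Fin n → Bool,
        ∃ C : Circuit (AdderQubit k n),
          Circuit.Implements C (controlledAdder c) ∧
          A * (k + n * Real.log n) ≤ C.length ∧
          (C.length : ℝ) ≤ B * (k + n * Real.log n) ∧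
          A * (Real.log k + Real.log n ^ 2) ≤ Circuit.depth C ∧
          (Circuit.depth C : ℝ) ≤ B * (Real.log k + Real.log n ^ 2)) ∧
    -- Shor's circuit for an `n`-bit integer `N`
    (∃ B : ℝ, 0 < B ∧
      ∀ n N a : ℕ, 2 ≤ n → 2 ^ (n - 1) ≤ N → N < 2 ^ n → a.Coprime N →
        Fintype.card (ShorQubit n) = 2 * n + 2 ∧
        ∃ M : ℕ → Circuit (ShorQubit n),
          (∀ j < 2 * n, IsControlledModMul n N (a ^ 2 ^ (2 * n - 1 - j)) (M j)) ∧
          (∀ y < 2 ^ (2 * n),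
            outcomeProb (shorCircuit n M) (ket (shorBits n 1 false)) y = shorProb (2 * n) N a y) ∧
          ((shorCircuit n M).length : ℝ) ≤ B * (n ^ 3 * Real.log n) ∧
          (instrDepth (shorCircuit n M) : ℝ) ≤ B * (n ^ 2 * Real.log n ^ 2)) := by
  exact ⟨exists_controlledAdder, exists_shorCircuit⟩
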